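/- Let $n\ge 1$, $a\in(-1,1)$ and $R_0>0$. Write points of $\mathbb R^{n+1}$ as $(x,y)$ with $x\in\mathbb R^n$, $y\in\mathbb R$, let $B_r$ be the open ball of radius $r$ centred at the origin, $B_r'=B_r\cap\{y=0\}$, and $L_a=\operatorname{div}(|y|^a\nabla\,\cdot\,)$. Let $\tilde u$ be a solution in $B_{R_0}$ of the even thin obstacle problem for $L_a$ with zero obstacle, that is: $\tilde u$ is continuous in $B_{R_0}$, of class $C^2$ in $B_{R_0}\setminus\{y=0\}$, $\int_{B_r}|\nabla\tilde u|^2|y|^a<\infty$ for all $r<R_0$, and $$L_a\tilde u=0\ \text{ in } B_{R_0}\setminus\{y=0\},\qquad \tilde u(x,0)\ge 0\ \text{ on } B_{R_0}',\qquad \tilde u(x,-y)=\tilde u(x,y),$$ $$-\lim_{y\to0^+}y^aD_y\tilde u(x,y)\ge 0\ \text{ on } B_{R_0}',\qquad \lim_{y\to0^+}y^aD_y\tilde u(x,y)=0\ \text{ on } B_{R_0}'\cap\{\tilde u>0\},$$ where the last two conditions are understood in the weak (variational) sense: $\int_{B_{R_0}}\langle\nabla\tilde u,\nabla\varphi\rangle|y|^a\ge0$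 for every $0\le\varphi\in C_0^\infty(B_{R_0})$, and $\int_{B_{R_0}}\langle\nabla\tilde u,\nabla\varphi\rangle|y|^a=0$ for every $\varphi\in C_0^\infty(B_{R_0})$ whose support does not meet $\{y=0,\ \tilde u=0\}$. For $0<r<R_0$ put $$\tilde D(r)=\int_{B_r}|\nabla\tilde u|^2|y|^a,\qquad \tilde H(r)=\int_{\partial B_r}\tilde u^2|y|^a\,dH_n,\qquad \tilde N(r)=\frac{r\tilde D(r)}{\tilde H(r)}$$ (with $\tilde N(r)=0$ if $\tilde H(r)=0$). Then the limit $\tilde\kappa:=\tilde N(0^+)=\lim_{r\to0^+}\tilde N(r)$ exists in $\mathbb R$. Let $\tilde P$ be any polynomial on $\mathbb R^{n+1}$ such that $L_a\tilde P=0$ for $y\neq0$, $\langle x,\nabla_x\tilde P\rangle+yD_y\tilde P=\tilde\kappa\tilde P$, $\tilde P(x,0)\ge0$ and $\tilde P(x,-y)=\tilde P(x,y)$, and set $$\tilde{\mathcal M}(r)=\frac1{r^{n+a+2\tilde\kappa}}\int_{\partial B_r}(\tilde u-\tilde P)^2|y|^a\,dH_n,\qquad \tilde{\mathcal W}(r)=\frac{\tilde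 D(r)}{r^{n+a-1+2\tilde\kappa}}-\frac{\tilde\kappa}{r^{n+a+2\tilde\kappa}}\tilde H(r).$$ Then $\tilde{\mathcal M}$ is differentiable at every $r\in(0,R_0)$, $$\frac{d}{dr}\tilde{\mathcal M}(r)\ \ge\ \frac2r\,\tilde{\mathcal W}(r)\qquad\text{for all } r\in(0,R_0),$$ and $r\mapsto\tilde{\mathcal M}(r)$ is nondecreasing on $(0,R_0)$. -/

import Mathlib

open MeasureTheory Set Filter Topology
open scoped ContDiff

noncomputable section

namespace ThinObstacle

/-- The space `ℝⁿ⁺¹` with points `(x, y)`, `x ∈ ℝⁿ`, `y ∈ ℝ`; the variable `y` is the last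
coordinate. -/
abbrev Space (n : ℕ) := EuclideanSpace ℝ (Fin (n + 1))

/-- The coordinate `y` of a point `(x, y)`. -/
def yCoord {n : ℕ} (p : Space n) : ℝ := p (Fin.last n)

/-- The reflection `(x, y) ↦ (x, -y)`. -/
def reflect {n : ℕ} (p : Space n) : Space n :=
  WithLp.toLp 2 (fun i => if i = Fin.last n then -p i else p i)

/-- The weight `|y|^a`. -/
def weight {n : ℕ} (a : ℝ) (p : Space n) : ℝ := |yCoord p| ^ a

/-- The partial derivative in the `i`-th coordinate. -/
def partialDeriv {n : ℕ} (i : Fin (n + 1)) (f : Space n → ℝ) (p : Space n) : ℝ :=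
  fderiv ℝ f p (EuclideanSpace.single i 1)

/-- The operator `L_a f = div (|y|^a ∇ f)`. -/
def La {n : ℕ} (a : ℝ) (f : Space n → ℝ) (p : Space n) : ℝ :=
  ∑ i, partialDeriv i (fun q => weight a q * partialDeriv i f q) p

/-- `u` is a solution in the ball `B(R)`, centred at the origin, of the even thin obstacle problem
for `L_a` with zero obstacle. Away from `{y = 0}` the equation holds in the classical sense. The two
conditions on `lim_{y → 0+} y^a D_y u` are imposed in the weak (variational) sense:
for `u` even and `L_a`-harmonic off `{y = 0}`, integration by parts gives
`∫ |y|^a ⟨∇u, ∇φ⟩ = 2 ∫_{ℝⁿ} (- lim_{y → 0+} y^a D_y u(x, y)) φ(x, 0) dx`. -/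
structure IsSolution {n : ℕ} (a R : ℝ) (u : Space n → ℝ) : Prop where
  continuousOn : ContinuousOn u (Metric.ball 0 R)
  contDiffOn : ContDiffOn ℝ 2 u {p | p ∈ Metric.ball 0 R ∧ yCoord p ≠ 0}
  /-- finite weighted Dirichlet energy on smaller balls -/
  finite_energy : ∀ r, r < R →
    IntegrableOn (fun p => ‖gradient u p‖ ^ 2 * weight a p) (Metric.ball 0 r)
  /-- `L_a u = 0` in the open upper and lower half balls -/
  harmonic : ∀ p ∈ Metric.ball (0 : Space n) R, yCoord p ≠ 0 → La a u p = 0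
  /-- `u(x, 0) ≥ 0` -/
  nonneg : ∀ p ∈ Metric.ball (0 : Space n) R, yCoord p = 0 → 0 ≤ u p
  /-- `u(x, -y) = u(x, y)` -/
  even : ∀ p ∈ Metric.ball (0 : Space n) R, u (reflect p) = u p
  /-- `- lim_{y → 0+} y^a D_y u(x, y) ≥ 0` -/
  neumann_nonneg : ∀ φ : Space n → ℝ, ContDiff ℝ ∞ φ → HasCompactSupport φ →
    tsupport φ ⊆ Metric.ball 0 R → (∀ p, 0 ≤ φ p) →
    0 ≤ ∫ p, inner ℝ (gradient u p) (gradient φ p) * weight a p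
  /-- `lim_{y → 0+} y^a D_y u(x, y) = 0` on the set where `u(x, 0) > 0` -/
  neumann_eq_zero : ∀ φ : Space n → ℝ, ContDiff ℝ ∞ φ → HasCompactSupport φ →
    tsupport φ ⊆ {p | p ∈ Metric.ball 0 R ∧ (yCoord p = 0 → 0 < u p)} →
    ∫ p, inner ℝ (gradient u p) (gradient φ p) * weight a p = 0

/-- The integral of `f` over the sphere `S(r) = ∂B(r)` with respect to the (standard)
surface measure, that is, `rⁿ ∫_{S(1)} f(r ζ) dσ(ζ)`. -/
def sphereIntegral {n : ℕ} (r : ℝ) (f : Space n → ℝ) : ℝ :=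
  r ^ n * ∫ ζ : Metric.sphere (0 : Space n) 1, f (r • (ζ : Space n))
    ∂((volume : Measure (Space n)).toSphere)

/-- The weighted Dirichlet integral `D(u, r) = ∫_{B(r)} |∇u|² |y|^a`. -/
def dirichlet {n : ℕ} (a : ℝ) (u : Space n → ℝ) (r : ℝ) : ℝ :=
  ∫ p in Metric.ball (0 : Space n) r, ‖gradient u p‖ ^ 2 * weight a p

/-- The height `H(u, r) = ∫_{S(r)} u² |y|^a`. -/
def height {n : ℕ} (a : ℝ) (u : Space n → ℝ) (r : ℝ) : ℝ :=
  sphereIntegral r (fun p => u p ^ 2 * weight a p)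

/-- The frequency `N(u, r) = r D(u, r) / H(u, r)`. -/
def frequency {n : ℕ} (a : ℝ) (u : Space n → ℝ) (r : ℝ) : ℝ :=
  r * dirichlet a u r / height a u r

/-- The Weiss energy
`W_κ(u, r) = r^{-(n+a-1+2κ)} D(u, r) - κ r^{-(n+a+2κ)} H(u, r)`. -/
def weiss {n : ℕ} (a κ : ℝ) (u : Space n → ℝ) (r : ℝ) : ℝ :=
  dirichlet a u r / r ^ ((n : ℝ) + a - 1 + 2 * κ) -
    κ / r ^ ((n : ℝ) + a + 2 * κ) * height a u r

/-- The function on `ℝⁿ⁺¹` defined by a polynomial. -/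
def polyFun {n : ℕ} (P : MvPolynomial (Fin (n + 1)) ℝ) (p : Space n) : ℝ :=
  MvPolynomial.eval (fun i => p i) P

/-- The even `L_a`-solid harmonics of degree `κ` that are nonnegative on `{y = 0}`. -/
structure IsSolidHarmonicPlus {n : ℕ} (a κ : ℝ) (P : MvPolynomial (Fin (n + 1)) ℝ) : Prop where
  harmonic : ∀ p : Space n, yCoord p ≠ 0 → La a (polyFun P) p = 0
  /-- `Z P = κ P`, where `Z = ⟨x, ∇ₓ⟩ + y D_y` generates the Euclidean dilations -/
  homogeneous : ∀ p : Space n, ∑ i, p i * partialDeriv i (polyFun P) p = κ * polyFun P p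
  nonneg : ∀ p : Space n, yCoord p = 0 → 0 ≤ polyFun P p
  even : ∀ p : Space n, polyFun P (reflect p) = polyFun P p

/-- The Monneau functional
`M_κ(u, P, r) = r^{-(n+a+2κ)} ∫_{S(r)} (u - P)² |y|^a`. -/
def monneau {n : ℕ} (a κ : ℝ) (u : Space n → ℝ) (P : MvPolynomial (Fin (n + 1)) ℝ) (r : ℝ) : ℝ :=
  1 / r ^ ((n : ℝ) + a + 2 * κ) *
    sphereIntegral r (fun p => (u p - polyFun P p) ^ 2 * weight a p)

end ThinObstacle

end

/-! Write Zu = ⟨p, ∇u⟩, let h(r) be the weighted integral of u(rζ)² over the unit sphere, and let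
f(r) be r^(-2κ) times the weighted integral of u(rζ)P(rζ). Since P is homogeneous of degree κ,
expanding the square gives M(r) = r^(-2κ) h(r) - 2 f(r) + const (`monneau_eq`). Three facts then
suffice: (1) h is C¹ and the derivative of r^(-2κ) h is exactly 2W/r; (2) f is differentiable
everywhere with f' ≤ 0; (3) W ≥ 0.

Fact (1) is complementarity. The product of u with its weighted normal derivative vanishes on {y =
0} (`pairing_cutoff_self`), so ∫_{∂B(r)} u ∂_ν u |y|^a = D(r), and D is continuous.

The inequality in (2) is Green's formula. The Dirichlet form of u against cP is nonnegative because
P ≥ 0 on {y = 0}. The form of P against cu vanishes because P is smooth, even and L_a-harmonic,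
hence has zero weighted normal derivative. Comparing the two fluxes shows that f is nonincreasing,
so it is differentiable almost everywhere. Every radius is reached by an equicontinuity property of
the increments under dilation (`exists_dilation_equicontinuity`,
`differentiableAt_of_dilation_equicontinuity`).

Fact (3) follows from monotonicity of the Weiss energy for every exponent γ (`weiss_mono`). The
choice γ = N(r₁) makes the frequency nondecreasing, so κ is its infimum and W, a nonnegative
multiple of N - κ, is nonnegative.

Weiss monotonicity rests on the Rellich identity, obtained here variationally and without regularity
of ∇u up to {y = 0}. Testing with c(u(l·) - u), c ≥ 0, gives a nonnegative number, bounded above by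
an explicit function of l that vanishes at l = 1. That function has a minimum at 1, and the
vanishing of its derivative is the identity. The O((l-1)²) remainder is controlled by Caccioppoli's
inequality for u(l·) - u, available because u and u(l·) are admissible competitors for each other
(`pairing_dilation_sub_le_zero`).

All these test functions are built from u and are merely continuous across {y = 0}, while the
definition of a solution allows smooth ones only. The bridge is `exists_traceExt_pairing_approx`: a
test function is replaced by the y-independent extension of its trace on a well chosen hyperplane {y
= δ}. Identities on spheres are proved against derivatives of radial profiles, hence for almost
every radius, and are then integrated by absolute continuity. -/

noncomputable section

namespace ThinObstacle

/-! ### The weighted measure: slices, local finiteness, scaling. -/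

section

variable {n : ℕ}

/-- The measure `|y|^a dx dy`. -/
def wvol (a : ℝ) : Measure (Space n) :=
  volume.withDensity fun p => ENNReal.ofReal (weight a p)

lemma continuous_yCoord : Continuous (yCoord : Space n → ℝ) := by
  unfold yCoord; fun_prop

lemma yCoord_smul (c : ℝ) (p : Space n) : yCoord (c • p) = c * yCoord p := by
  simp [yCoord]

lemma abs_yCoord_le (p : Space n) : |yCoord p| ≤ ‖p‖ := by
  simpa [yCoord] using PiLp.norm_apply_le p (Fin.last n)

lemma measurable_weight (a : ℝ) : Measurable (weight a : Space n → ℝ) := by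
  unfold weight
  exact (continuous_yCoord.abs.measurable).pow_const a

lemma weight_nonneg (a : ℝ) (p : Space n) : 0 ≤ weight a p := by
  unfold weight; positivity

lemma weight_smul (a : ℝ) {c : ℝ} (hc : 0 < c) (p : Space n) :
    weight a (c • p) = c ^ a * weight a p := by
  unfold weight
  rw [yCoord_smul, abs_mul, abs_of_pos hc, Real.mul_rpow hc.le (abs_nonneg _)]

lemma integral_wvol (a : ℝ) (f : Space n → ℝ) :
    ∫ p, f p ∂(wvol a) = ∫ p, f p * weight a p := by
  unfold wvol
  rw [integral_withDensity_eq_integral_toReal_smul (measurable_weight a).ennreal_ofReal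
    (by simp)]
  simp [ENNReal.toReal_ofReal (weight_nonneg a _), mul_comm]

lemma setIntegral_wvol (a : ℝ) (f : Space n → ℝ) {s : Set (Space n)} (hs : MeasurableSet s) :
    ∫ p in s, f p ∂(wvol a) = ∫ p in s, f p * weight a p := by
  unfold wvol
  rw [restrict_withDensity hs, integral_withDensity_eq_integral_toReal_smul
    (measurable_weight a).ennreal_ofReal (by simp)]
  simp [ENNReal.toReal_ofReal (weight_nonneg a _), mul_comm]

lemma integrableOn_wvol_iff (a : ℝ) (f : Space n → ℝ) {s : Set (Space n)} (hs : MeasurableSet s) :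
    IntegrableOn f s (wvol a) ↔ IntegrableOn (fun p => f p * weight a p) s := by
  unfold IntegrableOn wvol
  rw [restrict_withDensity hs, integrable_withDensity_iff_integrable_smul'
    (measurable_weight a).ennreal_ofReal (by simp)]
  simp [ENNReal.toReal_ofReal (weight_nonneg a _), mul_comm]

lemma wvol_absolutelyContinuous (a : ℝ) : (wvol a : Measure (Space n)) ≪ volume :=
  withDensity_absolutelyContinuous _ _

/-- The point `(x, y)`. -/
def mkPt (y : ℝ) (x : Fin n → ℝ) : Space n :=
  WithLp.toLp 2 (Fin.insertNth (α := fun _ => ℝ) (Fin.last n) y x)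

@[simp] lemma yCoord_mkPt (y : ℝ) (x : Fin n → ℝ) : yCoord (mkPt y x) = y := by
  simp [yCoord, mkPt]

lemma measurePreserving_mkPt :
    MeasurePreserving (fun z : ℝ × (Fin n → ℝ) => (mkPt z.1 z.2 : Space n)) := by
  have h1 := (volume_preserving_piFinSuccAbove (fun _ : Fin (n + 1) => ℝ) (Fin.last n)).symm
  exact (PiLp.volume_preserving_toLp (Fin (n + 1))).comp h1

lemma lintegral_eq_slices {f : Space n → ENNReal} (hf : Measurable f) :
    ∫⁻ p, f p = ∫⁻ y, ∫⁻ x : Fin n → ℝ, f (mkPt y x) := by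
  have h := measurePreserving_mkPt (n := n)
  rw [← h.lintegral_comp hf, Measure.volume_eq_prod, lintegral_prod]
  exact (hf.comp h.measurable).aemeasurable

lemma lintegral_wvol (a : ℝ) (f : Space n → ENNReal) :
    ∫⁻ p, f p ∂(wvol a) = ∫⁻ p, ENNReal.ofReal (weight a p) * f p := by
  unfold wvol
  rw [lintegral_withDensity_eq_lintegral_mul_non_measurable _ (measurable_weight a).ennreal_ofReal]
  · rfl
  · simp

lemma lintegral_wvol_eq_slices (a : ℝ) {f : Space n → ENNReal} (hf : Measurable f) :
    ∫⁻ p, f p ∂(wvol a) =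
      ∫⁻ y : ℝ, ENNReal.ofReal (|y| ^ a) * ∫⁻ x : Fin n → ℝ, f (mkPt y x) := by
  rw [lintegral_wvol, lintegral_eq_slices (f := fun p => ENNReal.ofReal (weight a p) * f p)
    ((measurable_weight a).ennreal_ofReal.mul hf)]
  congr 1; ext y
  simp_rw [weight, yCoord_mkPt]
  rw [lintegral_const_mul' _ _ (by simp)]

lemma volume_thin : volume {p : Space n | yCoord p = 0} = 0 := by
  have hm : MeasurableSet {p : Space n | yCoord p = 0} :=
    continuous_yCoord.measurable (measurableSet_singleton 0)
  rw [← lintegral_indicator_one hm, lintegral_eq_slices (measurable_one.indicator hm)]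
  have : ∀ᵐ y : ℝ, y ≠ 0 := by simp [ae_iff]
  rw [lintegral_congr_ae (g := 0)]
  · simp
  · filter_upwards [this] with y hy
    simp [indicator, hy]

lemma ae_yCoord_ne_zero : ∀ᵐ p : Space n, yCoord p ≠ 0 := by
  rw [ae_iff]; simpa using volume_thin

lemma ae_wvol_yCoord_ne_zero (a : ℝ) : ∀ᵐ p : Space n ∂(wvol a), yCoord p ≠ 0 :=
  (wvol_absolutelyContinuous a).ae_le ae_yCoord_ne_zero

/-- The weight is integrable across {y = 0} precisely because a > -1; local finiteness of the
weighted measure and the trace estimate both come from here. -/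
lemma lintegral_abs_rpow {a : ℝ} (ha : -1 < a) {δ : ℝ} (hδ : 0 ≤ δ) :
    ∫⁻ y in Ioo (-δ) δ, ENNReal.ofReal (|y| ^ a) =
      ENNReal.ofReal (2 * (δ ^ (a + 1) / (a + 1))) := by
  have hi : ∀ s t : ℝ, IntervalIntegrable (fun y : ℝ => y ^ a) volume s t :=
    fun s t => intervalIntegral.intervalIntegrable_rpow' ha
  have h0 : IntegrableOn (fun y : ℝ => |y| ^ a) (Ioc 0 δ) := by
    refine ((intervalIntegrable_iff_integrableOn_Ioc_of_le hδ).1 (hi 0 δ)).congr_fun ?_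
      measurableSet_Ioc
    intro y hy; simp [abs_of_pos hy.1]
  have h1 : IntegrableOn (fun y : ℝ => |y| ^ a) (Ioo (-δ) δ) := by
    have h2 : IntervalIntegrable (fun y : ℝ => |y| ^ a) volume 0 δ :=
      (intervalIntegrable_iff_integrableOn_Ioc_of_le hδ).2 h0
    have h3 : IntervalIntegrable (fun y : ℝ => |y| ^ a) volume (-δ) 0 := by
      have := h2.comp_sub_left 0
      simpa using this.symm
    exact ((intervalIntegrable_iff_integrableOn_Ioc_of_le (by linarith)).1 (h3.trans h2)).mono_set
      Ioo_subset_Ioc_self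
  rw [← ofReal_integral_eq_lintegral_ofReal h1 (by filter_upwards with y; positivity)]
  congr 1
  rw [← integral_Ioc_eq_integral_Ioo, ← intervalIntegral.integral_of_le (by linarith)]
  have h2 : ∫ y in (0 : ℝ)..δ, |y| ^ a = δ ^ (a + 1) / (a + 1) := by
    rw [intervalIntegral.integral_congr (g := fun y => y ^ a), integral_rpow (Or.inl ha)]
    · simp [Real.zero_rpow (show a + 1 ≠ 0 by linarith)]
    · intro y hy
      rw [uIcc_of_le hδ] at hy
      simp [abs_of_nonneg hy.1]
  have h3 : ∫ y in (-δ)..0, |y| ^ a = δ ^ (a + 1) / (a + 1) := by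
    rw [← h2]
    simpa using intervalIntegral.integral_comp_neg (a := -δ) (b := 0) fun y : ℝ => |y| ^ a
  rw [← intervalIntegral.integral_add_adjacent_intervals (b := 0), h2, h3]
  · ring
  · rw [intervalIntegrable_iff_integrableOn_Ioo_of_le (by linarith)]
    exact h1.mono_set (Ioo_subset_Ioo_right hδ)
  · rw [intervalIntegrable_iff_integrableOn_Ioo_of_le hδ]
    exact h1.mono_set (Ioo_subset_Ioo_left (by linarith))

/-- The ball sits inside the product of (-r, r) in y and a sup-norm ball in x, so only the
one-dimensional integral of the weight matters. -/
lemma wvol_slab_inter_ball_lt_top {a : ℝ} (ha : -1 < a) (r : ℝ) :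
    wvol a (Metric.ball (0 : Space n) r) < ⊤ := by
  rcases le_or_gt r 0 with hr | hr
  · simp [Metric.ball_eq_empty.2 hr]
  have hb : MeasurableSet (Metric.ball (0 : Space n) r) := measurableSet_ball
  rw [← lintegral_indicator_one hb, lintegral_wvol_eq_slices a (measurable_one.indicator hb)]
  calc _ ≤ ∫⁻ y in Ioo (-r) r, ENNReal.ofReal (|y| ^ a) *
            volume (Metric.closedBall (0 : Fin n → ℝ) r) := by
        rw [← lintegral_indicator measurableSet_Ioo]
        refine lintegral_mono fun y => ?_
        by_cases hy : y ∈ Ioo (-r) r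
        · rw [indicator_of_mem hy]
          gcongr
          rw [← lintegral_indicator_one measurableSet_closedBall]
          refine lintegral_mono fun x => ?_
          by_cases hx : mkPt y x ∈ Metric.ball (0 : Space n) r
          · have : x ∈ Metric.closedBall (0 : Fin n → ℝ) r := by
              rw [mem_closedBall_zero_iff, pi_norm_le_iff_of_nonneg hr.le]
              intro i
              rw [mem_ball_zero_iff] at hx
              have := PiLp.norm_apply_le (mkPt y x) ((Fin.last n).succAbove i)
              simp only [mkPt, Fin.insertNth_apply_succAbove] at this
              exact this.trans hx.le
            rw [indicator_of_mem hx, indicator_of_mem this]; rfl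
          · rw [indicator_of_notMem hx]; simp
        · rw [indicator_of_notMem hy]
          have : ∀ x, (Metric.ball (0 : Space n) r).indicator (1 : Space n → ENNReal) (mkPt y x)
              = 0 := by
            intro x
            refine indicator_of_notMem (fun hx => hy ?_) _
            rw [mem_ball_zero_iff] at hx
            have := (abs_yCoord_le (mkPt y x)).trans_lt hx
            rw [yCoord_mkPt] at this
            exact abs_lt.1 this
          simp [this]
    _ < ⊤ := by
        rw [lintegral_mul_const' _ _ measure_closedBall_lt_top.ne, lintegral_abs_rpow ha hr.le]
        exact ENNReal.mul_lt_top ENNReal.ofReal_lt_top measure_closedBall_lt_top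

lemma wvol_lt_top_of_isCompact {a : ℝ} (ha : -1 < a) {K : Set (Space n)} (hK : IsCompact K) :
    wvol a K < ⊤ := by
  obtain ⟨r, hr⟩ := hK.isBounded.subset_ball 0
  exact (measure_mono hr).trans_lt (wvol_slab_inter_ball_lt_top ha r)

lemma lintegral_comp_smul_volume {c : ℝ} (hc : 0 < c) (f : Space n → ENNReal) :
    ∫⁻ p : Space n, f (c • p) = ENNReal.ofReal (c ^ (-((n : ℝ) + 1))) * ∫⁻ p, f p := by
  have he : MeasurableEmbedding (fun p : Space n => c • p) :=
    (Homeomorph.smulOfNeZero c hc.ne').measurableEmbedding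
  rw [← he.lintegral_map, Measure.map_addHaar_smul volume hc.ne', lintegral_smul_measure]
  congr 2
  rw [abs_of_pos (by positivity), Real.rpow_neg hc.le, finrank_euclideanSpace_fin]
  norm_cast

/-- Homogeneity of degree n + 1 + a: Lebesgue measure contributes n + 1 and the weight contributes
a. The powers of l in the scaling of the Dirichlet form come from it. -/
lemma map_smul_wvol (a : ℝ) {c : ℝ} (hc : 0 < c) :
    Measure.map (fun p : Space n => c • p) (wvol a) =
      ENNReal.ofReal (c ^ (-((n : ℝ) + 1 + a))) • wvol a := by
  have he : MeasurableEmbedding (fun p : Space n => c • p) :=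
    (Homeomorph.smulOfNeZero c hc.ne').measurableEmbedding
  ext s hs
  rw [he.map_apply, Measure.smul_apply, smul_eq_mul, ← lintegral_indicator_one hs,
    ← lintegral_indicator_one (he.measurable hs), lintegral_wvol, lintegral_wvol]
  have h1 : ∀ p : Space n, ENNReal.ofReal (weight a p) *
      ((fun p : Space n => c • p) ⁻¹' s).indicator 1 p = ENNReal.ofReal (c ^ (-a)) *
      (fun q : Space n => ENNReal.ofReal (weight a q) * s.indicator 1 q) (c • p) := by
    intro p
    simp only [weight_smul a hc]
    rw [← mul_assoc, ← ENNReal.ofReal_mul (by positivity), ← mul_assoc, ← Real.rpow_add hc]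
    simp only [neg_add_cancel, Real.rpow_zero, one_mul]
    rfl
  simp_rw [h1]
  rw [lintegral_const_mul' _ _ (by simp),
    lintegral_comp_smul_volume hc fun q : Space n => ENNReal.ofReal (weight a q) * s.indicator 1 q,
    ← mul_assoc, ← ENNReal.ofReal_mul (by positivity), ← Real.rpow_add hc]
  congr 3; ring

lemma lintegral_comp_smul_wvol (a : ℝ) {c : ℝ} (hc : 0 < c) (f : Space n → ENNReal) :
    ∫⁻ p, f (c • p) ∂(wvol a) =
      ENNReal.ofReal (c ^ (-((n : ℝ) + 1 + a))) * ∫⁻ p, f p ∂(wvol a) := by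
  have he : MeasurableEmbedding (fun p : Space n => c • p) :=
    (Homeomorph.smulOfNeZero c hc.ne').measurableEmbedding
  rw [← he.lintegral_map, map_smul_wvol a hc, lintegral_smul_measure, smul_eq_mul]

lemma integral_comp_smul_wvol (a : ℝ) {c : ℝ} (hc : 0 < c) (f : Space n → ℝ) :
    ∫ p, f (c • p) ∂(wvol a) = c ^ (-((n : ℝ) + 1 + a)) * ∫ p, f p ∂(wvol a) := by
  have he : MeasurableEmbedding (fun p : Space n => c • p) :=
    (Homeomorph.smulOfNeZero c hc.ne').measurableEmbedding
  rw [← he.integral_map, map_smul_wvol a hc, integral_smul_measure,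
    ENNReal.toReal_ofReal (by positivity), smul_eq_mul]

lemma integrable_comp_smul_wvol_iff (a : ℝ) {c : ℝ} (hc : 0 < c) (f : Space n → ℝ) :
    Integrable (fun p => f (c • p)) (wvol a) ↔ Integrable f (wvol a) := by
  have he : MeasurableEmbedding (fun p : Space n => c • p) :=
    (Homeomorph.smulOfNeZero c hc.ne').measurableEmbedding
  have := he.integrable_map_iff (μ := wvol a) (g := f)
  rw [map_smul_wvol a hc, integrable_smul_measure
    (by simpa using (by positivity : (0 : ℝ) < c ^ (-((n : ℝ) + 1 + a)))) (by simp)] at this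
  exact this.symm

end

/-! ### Gradients and mollification. -/

section

variable {n : ℕ}

section Gradient

lemma norm_gradient (f : Space n → ℝ) (p : Space n) : ‖gradient f p‖ = ‖fderiv ℝ f p‖ := by
  simp [gradient]

lemma norm_gradient_sub (f g : Space n → ℝ) (p : Space n) :
    ‖gradient f p - gradient g p‖ = ‖fderiv ℝ f p - fderiv ℝ g p‖ := by
  simp only [gradient]
  rw [← map_sub, LinearIsometryEquiv.norm_map]

lemma measurable_gradient (f : Space n → ℝ) : Measurable (gradient f) :=
  (InnerProductSpace.toDual ℝ (Space n)).symm.continuous.measurable.comp (measurable_fderiv ℝ f)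

lemma gradient_add {f g : Space n → ℝ} {p : Space n} (hf : DifferentiableAt ℝ f p)
    (hg : DifferentiableAt ℝ g p) :
    gradient (fun q => f q + g q) p = gradient f p + gradient g p := by
  simp only [gradient]; rw [fderiv_fun_add hf hg, map_add]

lemma gradient_sub {f g : Space n → ℝ} {p : Space n} (hf : DifferentiableAt ℝ f p)
    (hg : DifferentiableAt ℝ g p) :
    gradient (fun q => f q - g q) p = gradient f p - gradient g p := by
  simp only [gradient]; rw [fderiv_fun_sub hf hg, map_sub]

lemma gradient_mul {f g : Space n → ℝ} {p : Space n} (hf : DifferentiableAt ℝ f p)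
    (hg : DifferentiableAt ℝ g p) :
    gradient (fun q => f q * g q) p = f p • gradient g p + g p • gradient f p := by
  simp only [gradient]; rw [fderiv_fun_mul hf hg, map_add, map_smul, map_smul]

lemma gradient_const_mul (c : ℝ) (f : Space n → ℝ) (p : Space n) :
    gradient (fun q => c * f q) p = c • gradient f p := by
  simp only [gradient]
  have : fderiv ℝ (fun q => c * f q) p = c • fderiv ℝ f p := by
    exact congrFun (fderiv_const_smul_field (𝕜 := ℝ) (f := f) c) p
  rw [this, map_smul]

lemma gradient_comp_smul {c : ℝ} (f : Space n → ℝ) (p : Space n) :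
    gradient (fun q => f (c • q)) p = c • gradient f (c • p) := by
  simp only [gradient]
  have : fderiv ℝ (fun q => f (c • q)) p = c • fderiv ℝ f (c • p) := fderiv_comp_smul c
  rw [this, map_smul]

lemma isOpen_off_thin : IsOpen {p : Space n | yCoord p ≠ 0} :=
  isOpen_ne_fun continuous_yCoord continuous_const

lemma continuousOn_gradient {f : Space n → ℝ} {s : Set (Space n)} (hs : IsOpen s)
    (hf : ContDiffOn ℝ 1 f s) : ContinuousOn (gradient f) s :=
  (InnerProductSpace.toDual ℝ (Space n)).symm.continuous.comp_continuousOn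
    (hf.continuousOn_fderiv_of_isOpen hs le_rfl)

lemma gradient_eq_zero_of_notMem_tsupport {f : Space n → ℝ} {p : Space n} (hp : p ∉ tsupport f) :
    gradient f p = 0 := by
  have : f =ᶠ[𝓝 p] fun _ => 0 := notMem_tsupport_iff_eventuallyEq.1 hp
  rw [this.gradient_eq, gradient_fun_const]

end Gradient

/-- A `C¹` function with compact support in an open set can be approximated in the `C¹` norm by
smooth functions with support in a fixed compact subset of the open set, preserving
nonnegativity. -/
lemma exists_smooth_approx {O : Set (Space n)} (hO : IsOpen O) {T : Space n → ℝ}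
    (hT : ContDiff ℝ 1 T) (hc : HasCompactSupport T) (hs : tsupport T ⊆ O) :
    ∃ K : Set (Space n), IsCompact K ∧ K ⊆ O ∧ tsupport T ⊆ K ∧ ∀ ε > 0, ∃ φ : Space n → ℝ,
      ContDiff ℝ ∞ φ ∧ HasCompactSupport φ ∧ tsupport φ ⊆ K ∧ ((∀ p, 0 ≤ T p) → ∀ p, 0 ≤ φ p) ∧
      ∀ p, ‖gradient φ p - gradient T p‖ ≤ ε := by
  obtain ⟨δ, hδ, hδO⟩ := hc.isCompact.exists_cthickening_subset_open hO hs
  have hKc : IsCompact (Metric.cthickening δ (tsupport T)) := hc.isCompact.cthickening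
  refine ⟨Metric.cthickening δ (tsupport T), hKc, hδO,
    Metric.self_subset_cthickening _, fun ε hε => ?_⟩
  have hdc : Continuous (fderiv ℝ T) := hT.continuous_fderiv one_ne_zero
  have hdu : UniformContinuous (fderiv ℝ T) :=
    (hc.fderiv ℝ).uniformContinuous_of_continuous hdc
  obtain ⟨η, hη, hηε⟩ := Metric.uniformContinuous_iff.1 hdu ε hε
  set r := min η δ with hr
  have hr0 : 0 < r := lt_min hη hδ
  -- A radius at most δ keeps the mollified function supported in the thickening; a radius at most η
  -- keeps its gradient within ε of that of `T`.
  let b : ContDiffBump (0 : Space n) := ⟨r / 2, r, half_pos hr0, half_lt_self hr0⟩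
  have hTl : LocallyIntegrable T (volume : Measure (Space n)) := hT.continuous.locallyIntegrable
  have hbc : HasCompactSupport (b.normed (volume : Measure (Space n))) := b.hasCompactSupport_normed
  have hbs : ContDiff ℝ ∞ (b.normed (volume : Measure (Space n))) := b.contDiff_normed
  refine ⟨convolution (b.normed volume) T (ContinuousLinearMap.lsmul ℝ ℝ) volume, ?_, ?_, ?_, ?_, ?_⟩
  · exact HasCompactSupport.contDiff_convolution_left (𝕜 := ℝ) _ hbc hbs hTl
  · exact hbc.convolution _ hc
  · refine closure_minimal ?_ Metric.isClosed_cthickening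
    intro x hx
    obtain ⟨y, hy, z, hz, rfl⟩ := support_convolution_subset _ hx
    rw [b.support_normed_eq, mem_ball_zero_iff] at hy
    refine Metric.mem_cthickening_of_dist_le _ z δ _ (subset_tsupport _ hz) ?_
    simpa using (hy.le.trans (min_le_right _ _) : ‖y‖ ≤ δ)
  · intro h0 p
    exact integral_nonneg fun t => mul_nonneg (b.nonneg_normed t) (h0 _)
  · intro p
    rw [norm_gradient_sub]
    have h1 := hc.hasFDerivAt_convolution_right (ContinuousLinearMap.lsmul ℝ ℝ)
      (b.integrable_normed (μ := volume)).locallyIntegrable hT p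
    have h2 : convolution (b.normed volume) (fderiv ℝ T)
        ((ContinuousLinearMap.lsmul ℝ ℝ).precompR (Space n)) volume p =
        convolution (b.normed volume) (fderiv ℝ T) (ContinuousLinearMap.lsmul ℝ ℝ) volume p := by
      rfl
    rw [h1.fderiv, h2, ← dist_eq_norm]
    refine b.dist_normed_convolution_le hdc.aestronglyMeasurable fun x hx => ?_
    exact (hηε ((Metric.mem_ball.1 hx).trans_le (min_le_left _ _))).le

end

/-! ### The Dirichlet form and C¹ test functions. -/

section

variable {n : ℕ}

section Inner

variable {μ : Measure (Space n)} {F G : Space n → Space n}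

lemma abs_inner_le_add_sq (v w : Space n) {t : ℝ} (ht : 0 < t) :
    |inner ℝ v w| ≤ 1 / (2 * t) * ‖v‖ ^ 2 + t / 2 * ‖w‖ ^ 2 := by
  have h1 : ‖v‖ * ‖w‖ ≤ 1 / (2 * t) * ‖v‖ ^ 2 + t / 2 * ‖w‖ ^ 2 := by
    have h2 : 1 / (2 * t) * ‖v‖ ^ 2 + t / 2 * ‖w‖ ^ 2 - ‖v‖ * ‖w‖ =
        1 / (2 * t) * (‖v‖ - t * ‖w‖) ^ 2 := by field_simp; ring
    have h3 : 0 ≤ 1 / (2 * t) * (‖v‖ - t * ‖w‖) ^ 2 := by positivity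
    linarith
  exact (abs_real_inner_le_norm v w).trans h1

lemma integrable_inner_of_sq (hF : AEStronglyMeasurable F μ) (hG : AEStronglyMeasurable G μ)
    (hF2 : Integrable (fun p => ‖F p‖ ^ 2) μ) (hG2 : Integrable (fun p => ‖G p‖ ^ 2) μ) :
    Integrable (fun p => inner ℝ (F p) (G p)) μ := by
  refine ((hF2.const_mul (1 / (2 * 1))).add (hG2.const_mul (1 / 2))).mono' (hF.inner hG) ?_
  exact Eventually.of_forall fun p => abs_inner_le_add_sq (F p) (G p) one_pos

/-- Young's inequality with a free parameter `t`, so that a tiny energy of `F` can be weighed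
against a merely bounded energy of `G`. -/
lemma abs_integral_inner_le (hF2 : Integrable (fun p => ‖F p‖ ^ 2) μ)
    (hG2 : Integrable (fun p => ‖G p‖ ^ 2) μ) {t : ℝ} (ht : 0 < t) :
    |∫ p, inner ℝ (F p) (G p) ∂μ| ≤
      1 / (2 * t) * ∫ p, ‖F p‖ ^ 2 ∂μ + t / 2 * ∫ p, ‖G p‖ ^ 2 ∂μ := by
  rw [← integral_const_mul, ← integral_const_mul,
    ← integral_add (hF2.const_mul _) (hG2.const_mul _), ← Real.norm_eq_abs]
  exact norm_integral_le_of_norm_le ((hF2.const_mul (1 / (2 * t))).add (hG2.const_mul (t / 2)))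
    (Eventually.of_forall fun p => abs_inner_le_add_sq (F p) (G p) ht)

end Inner

/-- The weighted Dirichlet form `∫ ⟨∇u, ∇φ⟩ |y|^a`. -/
def pairing (a : ℝ) (u φ : Space n → ℝ) : ℝ :=
  ∫ p, inner ℝ (gradient u p) (gradient φ p) ∂(wvol a)

lemma pairing_eq (a : ℝ) (u φ : Space n → ℝ) :
    pairing a u φ = ∫ p, inner ℝ (gradient u p) (gradient φ p) * weight a p :=
  integral_wvol a _

/-- Finiteness of the weighted Dirichlet energy on the balls `B(r)`, `r < R`. -/
def LocEnergy (a R : ℝ) (u : Space n → ℝ) : Prop :=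
  ∀ r, r < R → IntegrableOn (fun p => ‖gradient u p‖ ^ 2) (Metric.ball 0 r) (wvol a)

lemma IsSolution.locEnergy {a R : ℝ} {u : Space n → ℝ} (hu : IsSolution a R u) :
    LocEnergy a R u := fun r hr =>
  (integrableOn_wvol_iff a _ measurableSet_ball).2 (hu.finite_energy r hr)

lemma LocEnergy.integrableOn {a R : ℝ} (hR : 0 < R) {u : Space n → ℝ} (hu : LocEnergy a R u)
    {K : Set (Space n)} (hK : IsClosed K) (hKR : K ⊆ Metric.ball 0 R) :
    IntegrableOn (fun p => ‖gradient u p‖ ^ 2) K (wvol a) := by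
  obtain ⟨r, hr, hKr⟩ := exists_pos_lt_subset_ball hR hK hKR
  exact (hu r hr.2).mono_set hKr

lemma LocEnergy.integrableOn_norm {a R : ℝ} (ha : -1 < a) (hR : 0 < R) {u : Space n → ℝ}
    (hu : LocEnergy a R u) {K : Set (Space n)} (hK : IsCompact K) (hKR : K ⊆ Metric.ball 0 R) :
    IntegrableOn (fun p => ‖gradient u p‖) K (wvol a) := by
  have h1 := hu.integrableOn hR hK.isClosed hKR
  have h2 : IntegrableOn (fun _ : Space n => (1 : ℝ)) K (wvol a) :=
    integrableOn_const (wvol_lt_top_of_isCompact ha hK).ne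
  refine (h1.add h2).mono' (measurable_gradient u).norm.aestronglyMeasurable ?_
  refine Eventually.of_forall fun p => ?_
  simp only [norm_norm, Pi.add_apply]
  nlinarith [sq_nonneg (‖gradient u p‖ - 1), norm_nonneg (gradient u p)]

lemma LocEnergy.integrable_inner {a R : ℝ} (hR : 0 < R) {u φ : Space n → ℝ}
    (hu : LocEnergy a R u) (hφ : tsupport φ ⊆ Metric.ball 0 R)
    (hφ2 : Integrable (fun p => ‖gradient φ p‖ ^ 2) (wvol a)) :
    Integrable (fun p => inner ℝ (gradient u p) (gradient φ p)) (wvol a) := by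
  have h1 : IntegrableOn (fun p => inner ℝ (gradient u p) (gradient φ p)) (tsupport φ) (wvol a) :=
    integrable_inner_of_sq (measurable_gradient u).aestronglyMeasurable
      (measurable_gradient φ).aestronglyMeasurable
      (hu.integrableOn hR (isClosed_tsupport φ) hφ) hφ2.integrableOn
  refine (integrableOn_iff_integrable_of_support_subset fun p hp => ?_).1 h1
  by_contra h
  exact hp (by simp [gradient_eq_zero_of_notMem_tsupport h])

lemma integrable_sq_gradient_of_contDiff {a : ℝ} (ha : -1 < a) {φ : Space n → ℝ}
    (h1 : ContDiff ℝ 1 φ) (h2 : HasCompactSupport φ) :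
    Integrable (fun p => ‖gradient φ p‖ ^ 2) (wvol a) := by
  have hc : Continuous fun p => ‖gradient φ p‖ ^ 2 := by
    simp_rw [norm_gradient]
    exact (h1.continuous_fderiv one_ne_zero).norm.pow 2
  obtain ⟨C, hC⟩ := h2.isCompact.exists_bound_of_continuousOn hc.continuousOn
  have h3 : IntegrableOn (fun p => ‖gradient φ p‖ ^ 2) (tsupport φ) (wvol a) :=
    Measure.integrableOn_of_bounded (wvol_lt_top_of_isCompact ha h2.isCompact).ne
      hc.aestronglyMeasurable (M := C)
      ((ae_restrict_iff' (isClosed_tsupport φ).measurableSet).2 (Eventually.of_forall hC))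
  refine (integrableOn_iff_integrable_of_support_subset fun p hp => ?_).1 h3
  by_contra h
  exact hp (by simp [gradient_eq_zero_of_notMem_tsupport h])

/-- Passing to the limit in the Dirichlet form along `C¹` approximations. -/
lemma exists_smooth_pairing_approx {a R : ℝ} (ha : -1 < a) (hR : 0 < R) {u : Space n → ℝ}
    (hu : LocEnergy a R u) {O : Set (Space n)} (hO : IsOpen O) (hOR : O ⊆ Metric.ball 0 R)
    {T : Space n → ℝ} (hT : ContDiff ℝ 1 T) (hc : HasCompactSupport T) (hs : tsupport T ⊆ O)
    {ε : ℝ} (hε : 0 < ε) :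
    ∃ φ : Space n → ℝ, ContDiff ℝ ∞ φ ∧ HasCompactSupport φ ∧ tsupport φ ⊆ O ∧
      ((∀ p, 0 ≤ T p) → ∀ p, 0 ≤ φ p) ∧ |pairing a u φ - pairing a u T| ≤ ε := by
  obtain ⟨K, hK, hKO, hTK, happ⟩ := exists_smooth_approx hO hT hc hs
  set C := ∫ p in K, ‖gradient u p‖ ∂(wvol a)
  have hC : 0 ≤ C := integral_nonneg fun _ => norm_nonneg _
  have hn := hu.integrableOn_norm ha hR hK (hKO.trans hOR)
  obtain ⟨φ, h1, h2, h3, h4, h5⟩ := happ (ε / (C + 1)) (by positivity)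
  refine ⟨φ, h1, h2, h3.trans hKO, h4, ?_⟩
  have i1 := hu.integrable_inner hR (h3.trans (hKO.trans hOR))
    (integrable_sq_gradient_of_contDiff ha (h1.of_le (by simp)) h2)
  have i2 := hu.integrable_inner hR (hs.trans hOR) (integrable_sq_gradient_of_contDiff ha hT hc)
  rw [pairing, pairing, ← integral_sub i1 i2]
  have h6 : ∀ p, p ∉ K → inner ℝ (gradient u p) (gradient φ p) -
      inner ℝ (gradient u p) (gradient T p) = 0 := by
    intro p hp
    rw [gradient_eq_zero_of_notMem_tsupport fun h => hp (h3 h),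
      gradient_eq_zero_of_notMem_tsupport fun h => hp (hTK h)]
    simp
  rw [← setIntegral_eq_integral_of_forall_compl_eq_zero h6, ← Real.norm_eq_abs]
  calc _ ≤ ∫ p in K, ‖gradient u p‖ * (ε / (C + 1)) ∂(wvol a) := by
        refine norm_integral_le_of_norm_le (hn.mul_const _) (Eventually.of_forall fun p => ?_)
        rw [← inner_sub_right]
        exact (norm_inner_le_norm _ _).trans (by gcongr; exact h5 p)
    _ = C * (ε / (C + 1)) := integral_mul_const _ _
    _ ≤ ε := by
        rw [mul_div_assoc', div_le_iff₀ (by positivity)]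
        nlinarith

namespace IsSolution

variable {a R : ℝ} {u : Space n → ℝ}

lemma pairing_nonneg_of_contDiff (hu : IsSolution a R u) (ha : -1 < a) (hR : 0 < R)
    {T : Space n → ℝ} (hT : ContDiff ℝ 1 T) (hc : HasCompactSupport T)
    (hs : tsupport T ⊆ Metric.ball 0 R) (h0 : ∀ p, 0 ≤ T p) : 0 ≤ pairing a u T := by
  refine le_of_forall_pos_le_add fun ε hε => ?_
  obtain ⟨φ, h1, h2, h3, h4, h5⟩ := exists_smooth_pairing_approx ha hR hu.locEnergy
    Metric.isOpen_ball subset_rfl hT hc hs hε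
  have := hu.neumann_nonneg φ h1 h2 h3 (h4 h0)
  rw [← pairing_eq] at this
  linarith [(abs_le.1 h5).2]

/-- The set is the union of {u > 0} and {y ≠ 0}, both intersected with the ball. -/
lemma isOpen_noncontact (hu : IsSolution a R u) :
    IsOpen {p : Space n | p ∈ Metric.ball 0 R ∧ (yCoord p = 0 → 0 < u p)} := by
  have h1 : IsOpen (Metric.ball (0 : Space n) R ∩ u ⁻¹' Ioi 0) :=
    hu.continuousOn.isOpen_inter_preimage Metric.isOpen_ball isOpen_Ioi
  have h2 : IsOpen (Metric.ball (0 : Space n) R ∩ {p | yCoord p ≠ 0}) :=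
    Metric.isOpen_ball.inter isOpen_off_thin
  convert h1.union h2 using 1
  ext p
  simp only [mem_ofPred_eq, mem_union, mem_inter_iff, mem_preimage, mem_Ioi]
  tauto

lemma pairing_eq_zero_of_contDiff (hu : IsSolution a R u) (ha : -1 < a) (hR : 0 < R)
    {T : Space n → ℝ} (hT : ContDiff ℝ 1 T) (hc : HasCompactSupport T)
    (hs : tsupport T ⊆ {p | p ∈ Metric.ball 0 R ∧ (yCoord p = 0 → 0 < u p)}) :
    pairing a u T = 0 := by
  refine abs_eq_zero.1 (le_antisymm (le_of_forall_pos_le_add fun ε hε => ?_) (abs_nonneg _))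
  obtain ⟨φ, h1, h2, h3, h4, h5⟩ := exists_smooth_pairing_approx ha hR hu.locEnergy
    hu.isOpen_noncontact (fun p hp => hp.1) hT hc hs hε
  have := hu.neumann_eq_zero φ h1 h2 h3
  rw [← pairing_eq] at this
  rw [this, zero_sub, abs_neg] at h5
  linarith

end IsSolution

end

/-! ### Projection onto {y = δ} and cutoffs of slabs. -/

section

variable {n : ℕ}

/-- The orthogonal projection onto the hyperplane `{y = δ}`. -/
def setY (δ : ℝ) (p : Space n) : Space n :=
  p + (δ - yCoord p) • EuclideanSpace.single (Fin.last n) 1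

@[simp] lemma yCoord_setY (δ : ℝ) (p : Space n) : yCoord (setY δ p) = δ := by
  simp [yCoord, setY]

lemma setY_sub (δ : ℝ) (p : Space n) :
    setY δ p - p = (δ - yCoord p) • EuclideanSpace.single (Fin.last n) 1 := by
  simp [setY]

lemma norm_setY_sub (δ : ℝ) (p : Space n) : ‖setY δ p - p‖ = |δ - yCoord p| := by
  rw [setY_sub, norm_smul]; simp

lemma setY_eq_self {δ : ℝ} {p : Space n} (h : yCoord p = δ) : setY δ p = p := by
  simp [setY, h]

lemma setY_mkPt (δ y : ℝ) (x : Fin n → ℝ) : setY δ (mkPt y x) = mkPt δ x := by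
  ext i
  simp only [setY, mkPt, yCoord]
  refine Fin.lastCases ?_ (fun j => ?_) i
  · simp
  · simp [Fin.castSucc_ne_last]

lemma dist_setY_setY (δ ε : ℝ) (p : Space n) : dist (setY δ p) (setY ε p) = |δ - ε| := by
  rw [dist_eq_norm]
  have : setY δ p - setY ε p = (δ - ε) • EuclideanSpace.single (Fin.last n) (1 : ℝ) := by
    simp only [setY]; module
  rw [this, norm_smul]; simp

lemma contDiff_yCoord {k : WithTop ℕ∞} : ContDiff ℝ k (yCoord : Space n → ℝ) := by
  have : (yCoord : Space n → ℝ) = EuclideanSpace.proj (𝕜 := ℝ) (Fin.last n) := by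
    ext p; simp [yCoord]
  rw [this]; exact ContinuousLinearMap.contDiff _

lemma contDiff_setY (δ : ℝ) {k : WithTop ℕ∞} : ContDiff ℝ k (setY δ : Space n → Space n) := by
  unfold setY
  exact contDiff_id.add ((contDiff_const.sub contDiff_yCoord).smul contDiff_const)

lemma norm_fderiv_setY_le (δ : ℝ) (p : Space n) : ‖fderiv ℝ (setY δ : Space n → Space n) p‖ ≤ 2 := by
  have hl : LipschitzWith 2 (setY δ : Space n → Space n) := by
    refine LipschitzWith.of_dist_le_mul fun p q => ?_
    rw [dist_eq_norm, dist_eq_norm]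
    have h1 : setY δ p - setY δ q =
        (p - q) - yCoord (p - q) • EuclideanSpace.single (Fin.last n) (1 : ℝ) := by
      have : yCoord (p - q) = yCoord p - yCoord q := by simp [yCoord]
      rw [this]; simp only [setY]; module
    rw [h1]
    refine (norm_sub_le _ _).trans ?_
    rw [norm_smul]
    have := abs_yCoord_le (p - q)
    simp only [Real.norm_eq_abs, PiLp.norm_single, abs_one, mul_one]
    norm_num; linarith
  exact norm_fderiv_le_of_lipschitz ℝ hl

lemma norm_gradient_comp_setY_le {φ : Space n → ℝ} {δ : ℝ} {p : Space n}
    (h : DifferentiableAt ℝ φ (setY δ p)) :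
    ‖gradient (fun q => φ (setY δ q)) p‖ ≤ 2 * ‖gradient φ (setY δ p)‖ := by
  rw [norm_gradient, norm_gradient]
  have h1 : fderiv ℝ (fun q => φ (setY δ q)) p =
      (fderiv ℝ φ (setY δ p)).comp (fderiv ℝ (setY δ) p) :=
    fderiv_comp p h ((contDiff_setY δ (k := 1)).differentiable one_ne_zero p)
  rw [h1]
  refine (ContinuousLinearMap.opNorm_comp_le _ _).trans ?_
  rw [mul_comm]
  gcongr
  exact norm_fderiv_setY_le δ p

/-- A smooth function of `y` vanishing for `|y| ≤ δ` and equal to `1` for `k (y² - δ²) ≥ 1`. -/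
def slabCut (k δ : ℝ) (p : Space n) : ℝ := Real.smoothTransition (k * (yCoord p ^ 2 - δ ^ 2))

lemma contDiff_slabCut (k δ : ℝ) : ContDiff ℝ ∞ (slabCut k δ : Space n → ℝ) := by
  unfold slabCut
  exact Real.smoothTransition.contDiff.comp
    (contDiff_const.mul ((contDiff_yCoord.pow 2).sub contDiff_const))

lemma slabCut_nonneg (k δ : ℝ) (p : Space n) : 0 ≤ slabCut k δ p := Real.smoothTransition.nonneg _

lemma slabCut_le_one (k δ : ℝ) (p : Space n) : slabCut k δ p ≤ 1 := Real.smoothTransition.le_one _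

lemma slabCut_eq_zero {k δ : ℝ} (hk : 0 ≤ k) {p : Space n} (h : |yCoord p| ≤ |δ|) :
    slabCut k δ p = 0 := by
  refine Real.smoothTransition.zero_of_nonpos ?_
  have := sq_le_sq.2 h
  nlinarith

lemma slabCut_eq_one {k δ : ℝ} {p : Space n} (h : 1 ≤ k * (yCoord p ^ 2 - δ ^ 2)) :
    slabCut k δ p = 1 := Real.smoothTransition.one_of_one_le h

/-- The transition is constant outside [0, 1], so continuity of the derivative on a slightly larger
compact interval is enough. -/
lemma exists_deriv_smoothTransition_bound :
    ∃ C : ℝ, 0 ≤ C ∧ ∀ t, |deriv Real.smoothTransition t| ≤ C := by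
  have hc : Continuous (deriv Real.smoothTransition) :=
    (Real.smoothTransition.contDiff (n := 1)).continuous_deriv le_rfl
  obtain ⟨C, hC⟩ := isCompact_Icc.exists_bound_of_continuousOn (s := Icc (-1 : ℝ) 2)
    hc.continuousOn
  refine ⟨C, (norm_nonneg _).trans (hC 0 (by norm_num)), fun t => ?_⟩
  by_cases ht : t ∈ Icc (-1 : ℝ) 2
  · exact hC t ht
  · have h0 : deriv Real.smoothTransition t = 0 := by
      rw [mem_Icc, not_and_or, not_le, not_le] at ht
      rcases ht with ht | ht
      · have : Real.smoothTransition =ᶠ[𝓝 t] fun _ => 0 := by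
          filter_upwards [Iio_mem_nhds ht] with s hs
          exact Real.smoothTransition.zero_of_nonpos (by linarith [mem_Iio.1 hs])
        rw [this.deriv_eq]; simp
      · have : Real.smoothTransition =ᶠ[𝓝 t] fun _ => 1 := by
          filter_upwards [Ioi_mem_nhds ht] with s hs
          exact Real.smoothTransition.one_of_one_le (by linarith [mem_Ioi.1 hs])
        rw [this.deriv_eq]; simp
    rw [h0, abs_zero]
    exact (norm_nonneg _).trans (hC 0 (by norm_num))

lemma norm_gradient_yCoord_le (p : Space n) : ‖gradient (yCoord : Space n → ℝ) p‖ ≤ 1 := by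
  rw [norm_gradient]
  have hl : LipschitzWith 1 (yCoord : Space n → ℝ) := by
    refine LipschitzWith.of_dist_le_mul fun p q => ?_
    have := abs_yCoord_le (p - q)
    rw [Real.dist_eq, dist_eq_norm]
    simpa [yCoord] using this
  simpa using norm_fderiv_le_of_lipschitz ℝ hl

/-- The factor |y|, due to the use of y² in the cutoff, is what makes the later bounds uniform: it
is multiplied by a quantity that is itself small near the level set where the cutoff acts. -/
lemma norm_gradient_slabCut_le {C : ℝ} (hC : ∀ t, |deriv Real.smoothTransition t| ≤ C)
    {k : ℝ} (hk : 0 ≤ k) (δ : ℝ) (p : Space n) :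
    ‖gradient (slabCut k δ : Space n → ℝ) p‖ ≤ C * (k * (2 * |yCoord p|)) := by
  have hC0 : 0 ≤ C := (abs_nonneg _).trans (hC 0)
  rw [norm_gradient]
  have hy : HasFDerivAt (yCoord : Space n → ℝ) (fderiv ℝ yCoord p) p :=
    ((contDiff_yCoord (k := 1)).differentiable one_ne_zero p).hasFDerivAt
  have h1 : HasFDerivAt (fun q : Space n => k * (yCoord q ^ 2 - δ ^ 2))
      (k • ((2 * yCoord p) • fderiv ℝ yCoord p)) p := by
    have := ((hy.pow 2).sub_const (δ ^ 2)).const_mul k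
    simpa using this
  have h2 : HasDerivAt Real.smoothTransition
      (deriv Real.smoothTransition (k * (yCoord p ^ 2 - δ ^ 2))) (k * (yCoord p ^ 2 - δ ^ 2)) :=
    ((Real.smoothTransition.contDiff (n := 1)).differentiable one_ne_zero _).hasDerivAt
  have h3 := h2.comp_hasFDerivAt p h1
  have h4 : fderiv ℝ (slabCut k δ : Space n → ℝ) p = _ := h3.fderiv
  rw [h4, norm_smul, norm_smul, norm_smul, norm_mul, ← norm_gradient]
  simp only [Real.norm_eq_abs, abs_of_nonneg hk, abs_two]
  have := norm_gradient_yCoord_le p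
  calc _ ≤ C * (k * (2 * |yCoord p| * 1)) := by gcongr; exact hC _
    _ = _ := by ring

end

/-! ### Cutting off at a level {|y| = δ}. -/

section

variable {n : ℕ}

/-- Mean value inequality on the convex half-space {y ≥ δ} or {y ≤ -δ}, starting from the foot of
the perpendicular on its boundary, where ψ vanishes. -/
lemma abs_le_of_vanish_on_level {δ C : ℝ} (hδ : 0 < δ) {ψ : Space n → ℝ}
    (h1 : ∀ p, yCoord p ≠ 0 → DifferentiableAt ℝ ψ p)
    (hC : ∀ p, δ ≤ |yCoord p| → ‖gradient ψ p‖ ≤ C)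
    (h0 : ∀ p, |yCoord p| = δ → ψ p = 0) {p : Space n} (hp : δ ≤ |yCoord p|) :
    |ψ p| ≤ C * (|yCoord p| - δ) := by
  rcases le_abs.1 hp with h | h
  · have hconv : Convex ℝ {q : Space n | δ ≤ yCoord q} := by
      have := (convex_Ici δ).is_linear_preimage (f := (yCoord : Space n → ℝ))
        ⟨fun x y => by simp [yCoord], fun (c : ℝ) x => by simp [yCoord]⟩
      exact this
    have h2 := hconv.norm_image_sub_le_of_norm_fderiv_le (𝕜 := ℝ) (f := ψ) (C := C)
      (fun q hq => h1 q (by have : δ ≤ yCoord q := hq; linarith [this]))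
      (fun q hq => by rw [← norm_gradient]; exact hC q (le_abs.2 (Or.inl hq)))
      (x := setY δ p) (y := p) (by simp) h
    rw [h0 (setY δ p) (by simp [abs_of_pos hδ]), sub_zero, norm_sub_rev, norm_setY_sub] at h2
    rwa [abs_sub_comm, abs_of_nonneg (by linarith : 0 ≤ yCoord p - δ),
      ← abs_of_nonneg (by linarith : 0 ≤ yCoord p), Real.norm_eq_abs] at h2
  · have hconv : Convex ℝ {q : Space n | yCoord q ≤ -δ} := by
      have := (convex_Iic (-δ)).is_linear_preimage (f := (yCoord : Space n → ℝ))
        ⟨fun x y => by simp [yCoord], fun (c : ℝ) x => by simp [yCoord]⟩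
      exact this
    have h2 := hconv.norm_image_sub_le_of_norm_fderiv_le (𝕜 := ℝ) (f := ψ) (C := C)
      (fun q hq => h1 q (by have : yCoord q ≤ -δ := hq; linarith [this]))
      (fun q hq => by
        rw [← norm_gradient]
        exact hC q (le_abs.2 (Or.inr (by have : yCoord q ≤ -δ := hq; linarith))))
      (x := setY (-δ) p) (y := p) (by simp) (show yCoord p ≤ -δ by linarith)
    rw [h0 (setY (-δ) p) (by simp [abs_of_pos hδ]), sub_zero, norm_sub_rev, norm_setY_sub] at h2
    rwa [abs_of_nonneg (by linarith : 0 ≤ -δ - yCoord p),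
      show -δ - yCoord p = -yCoord p - δ by ring,
      ← abs_of_nonpos (by linarith : yCoord p ≤ 0), Real.norm_eq_abs] at h2

lemma bounded_gradient_off_slab {δ : ℝ} (hδ : 0 < δ) {ψ : Space n → ℝ}
    (h1 : ContDiffOn ℝ 1 ψ {p | yCoord p ≠ 0}) (hc : HasCompactSupport ψ) :
    ∃ C, 0 ≤ C ∧ ∀ p, δ ≤ |yCoord p| → ‖gradient ψ p‖ ≤ C := by
  have hK : IsCompact (tsupport ψ ∩ {p | δ ≤ |yCoord p|}) :=
    hc.isCompact.inter_right (isClosed_le continuous_const continuous_yCoord.abs)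
  have hcont : ContinuousOn (gradient ψ) (tsupport ψ ∩ {p | δ ≤ |yCoord p|}) :=
    (continuousOn_gradient isOpen_off_thin h1).mono fun p hp =>
      abs_pos.1 (hδ.trans_le hp.2)
  obtain ⟨C, hC⟩ := hK.exists_bound_of_continuousOn hcont
  refine ⟨max C 0, le_max_right _ _, fun p hp => ?_⟩
  by_cases h : p ∈ tsupport ψ
  · exact (hC p ⟨h, hp⟩).trans (le_max_left _ _)
  · rw [gradient_eq_zero_of_notMem_tsupport h]; simp

/-- A function vanishing on `{|y| = δ}` may be cut off at this level in the Dirichlet form. -/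
lemma IsSolution.setIntegral_inner_eq_zero {a R : ℝ} {u : Space n → ℝ} (hu : IsSolution a R u)
    (ha : -1 < a) (hR : 0 < R) {δ : ℝ} (hδ : 0 < δ) {ψ : Space n → ℝ}
    (h1 : ContDiffOn ℝ 1 ψ {p | yCoord p ≠ 0}) (hc : HasCompactSupport ψ)
    (hs : tsupport ψ ⊆ Metric.ball 0 R) (h0 : ∀ p, |yCoord p| = δ → ψ p = 0) :
    ∫ p in {p | δ < |yCoord p|}, inner ℝ (gradient u p) (gradient ψ p) ∂(wvol a) = 0 := by
  obtain ⟨C₁, hC₁0, hC₁⟩ := exists_deriv_smoothTransition_bound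
  obtain ⟨C, hC0, hC⟩ := bounded_gradient_off_slab hδ h1 hc
  have hdψ : ∀ p, yCoord p ≠ 0 → DifferentiableAt ℝ ψ p := fun p hp =>
    (h1.differentiableOn one_ne_zero).differentiableAt (isOpen_off_thin.mem_nhds hp)
  have hS : MeasurableSet {p : Space n | δ < |yCoord p|} :=
    (isOpen_lt continuous_const continuous_yCoord.abs).measurableSet
  -- Each `F k` vanishes for |y| ≤ δ, so its support avoids {y = 0} and the variational equality
  -- applies whatever the contact set is. As k grows the cutoff tends to the indicator of {δ < |y|}.
  set F : ℕ → Space n → ℝ := fun k p => slabCut k δ p * ψ p with hF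
  have hdcut : ∀ k : ℕ, ∀ p : Space n, DifferentiableAt ℝ (slabCut (k : ℝ) δ) p := fun k p =>
    (contDiff_slabCut (n := n) k δ).differentiable (by simp) p
  have hloc : ∀ k : ℕ, ∀ p, |yCoord p| < δ → F k =ᶠ[𝓝 p] fun _ => 0 := by
    intro k p hp
    filter_upwards [(isOpen_lt continuous_yCoord.abs continuous_const).mem_nhds hp] with q hq
    have hq' : |yCoord q| < δ := hq
    simp [hF, slabCut_eq_zero (Nat.cast_nonneg k) (hq'.le.trans (le_abs_self δ))]
  have hFC : ∀ k, ContDiff ℝ 1 (F k) := by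
    intro k
    rw [contDiff_iff_contDiffAt]
    intro p
    by_cases hp : yCoord p = 0
    · exact contDiffAt_const.congr_of_eventuallyEq (hloc k p (by simp [hp, hδ]))
    · exact ((contDiff_slabCut k δ).of_le (by simp)).contDiffAt.mul
        (h1.contDiffAt (isOpen_off_thin.mem_nhds hp))
  have hFs : ∀ k, tsupport (F k) ⊆ tsupport ψ := fun k => tsupport_mul_subset_right
  have hFs2 : ∀ k, tsupport (F k) ⊆ {p | δ ≤ |yCoord p|} := by
    intro k
    refine closure_minimal (fun p hp => ?_) (isClosed_le continuous_const continuous_yCoord.abs)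
    by_contra h
    exact hp (hloc k p (not_le.1 h)).eq_of_nhds
  have hz : ∀ k, pairing a u (F k) = 0 := by
    intro k
    refine hu.pairing_eq_zero_of_contDiff ha hR (hFC k) (hc.mono' ((subset_tsupport _).trans
      (hFs k))) fun p hp => ⟨hs (hFs k hp), fun h => ?_⟩
    have := hFs2 k hp
    simp only [mem_ofPred_eq, h, abs_zero] at this
    linarith
  have hn := hu.locEnergy.integrableOn_norm ha hR hc.isCompact hs
  -- The cutoff has a gradient of size k|y|, but only where k(y² - δ²) < 1. There |ψ| ≤ C(|y| - δ),
  -- and k(|y| - δ)|y| ≤ 1, so the product is bounded independently of k.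
  have hbound : ∀ k p, ‖gradient (F k) p‖ ≤ C + 2 * C * C₁ := by
    intro k p
    have hpos : 0 ≤ C + 2 * C * C₁ := by positivity
    rcases lt_or_ge (|yCoord p|) δ with hp | hp
    · rw [(hloc k p hp).gradient_eq, gradient_fun_const]; simpa
    · have hp0 : yCoord p ≠ 0 := abs_pos.1 (hδ.trans_le hp)
      rw [hF, gradient_mul (hdcut k p) (hdψ p hp0)]
      refine (norm_add_le _ _).trans ?_
      rw [norm_smul, norm_smul, Real.norm_eq_abs, Real.norm_eq_abs,
        abs_of_nonneg (slabCut_nonneg _ _ _)]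
      have e1 : slabCut k δ p * ‖gradient ψ p‖ ≤ C :=
        (mul_le_of_le_one_left (norm_nonneg _) (slabCut_le_one _ _ _)).trans (hC p hp)
      have e2 : |ψ p| * ‖gradient (slabCut (k : ℝ) δ) p‖ ≤ 2 * C * C₁ := by
        rcases lt_or_ge ((k : ℝ) * (yCoord p ^ 2 - δ ^ 2)) 1 with hk | hk
        · have e3 := abs_le_of_vanish_on_level hδ hdψ hC h0 hp
          have e4 := norm_gradient_slabCut_le hC₁ (Nat.cast_nonneg k) δ p
          have e5 : (k : ℝ) * ((|yCoord p| - δ) * |yCoord p|) ≤ 1 := by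
            have : (|yCoord p| - δ) * |yCoord p| ≤ yCoord p ^ 2 - δ ^ 2 := by
              rw [← sq_abs (yCoord p)]; nlinarith
            exact (mul_le_mul_of_nonneg_left this (Nat.cast_nonneg k)).trans hk.le
          calc _ ≤ C * (|yCoord p| - δ) * (C₁ * (k * (2 * |yCoord p|))) :=
                mul_le_mul e3 e4 (norm_nonneg _) (mul_nonneg hC0 (sub_nonneg.2 hp))
            _ = 2 * C * C₁ * (k * ((|yCoord p| - δ) * |yCoord p|)) := by ring
            _ ≤ 2 * C * C₁ * 1 := by gcongr
            _ = _ := mul_one _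
        · have hk1 : gradient (slabCut (k : ℝ) δ : Space n → ℝ) p = 0 := by
            have hmax : IsLocalMax (slabCut (k : ℝ) δ : Space n → ℝ) p := by
              refine Eventually.of_forall fun q => ?_
              rw [slabCut_eq_one hk]; exact slabCut_le_one _ _ _
            simp [gradient, hmax.fderiv_eq_zero]
          rw [hk1]; simp; positivity
      linarith
  have hlim : Tendsto (fun k => ∫ p, inner ℝ (gradient u p) (gradient (F k) p) ∂(wvol a)) atTop
      (𝓝 (∫ p, {p : Space n | δ < |yCoord p|}.indicator
        (fun p => inner ℝ (gradient u p) (gradient ψ p)) p ∂(wvol a))) := by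
    refine tendsto_integral_of_dominated_convergence
      ((tsupport ψ).indicator fun p => ‖gradient u p‖ * (C + 2 * C * C₁)) ?_ ?_ ?_ ?_
    · exact fun k => ((measurable_gradient u).inner (measurable_gradient _)).aestronglyMeasurable
    · exact (integrable_indicator_iff (isClosed_tsupport ψ).measurableSet).2 (hn.mul_const _)
    · refine fun k => Eventually.of_forall fun p => ?_
      by_cases hp : p ∈ tsupport ψ
      · rw [indicator_of_mem hp]
        exact (norm_inner_le_norm _ _).trans (by gcongr; exact hbound k p)
      · rw [indicator_of_notMem hp,
          gradient_eq_zero_of_notMem_tsupport fun h => hp (hFs k h)]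
        simp
    · refine Eventually.of_forall fun p => ?_
      rcases lt_trichotomy (|yCoord p|) δ with hp | hp | hp
      · have : p ∉ {p : Space n | δ < |yCoord p|} := by simp [hp.le]
        rw [indicator_of_notMem this]
        refine tendsto_const_nhds.congr fun k => ?_
        rw [(hloc k p hp).gradient_eq, gradient_fun_const, inner_zero_right]
      · have : p ∉ {p : Space n | δ < |yCoord p|} := by simp [hp.le]
        rw [indicator_of_notMem this]
        refine tendsto_const_nhds.congr fun k => ?_
        have hp0 : yCoord p ≠ 0 := abs_pos.1 (hδ.trans_eq hp.symm)
        rw [hF, gradient_mul (hdcut k p) (hdψ p hp0), h0 p hp,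
          slabCut_eq_zero (Nat.cast_nonneg k) (hp.le.trans (le_abs_self δ))]
        simp
      · have hp' : p ∈ {p : Space n | δ < |yCoord p|} := hp
        rw [indicator_of_mem hp']
        have hpos : 0 < yCoord p ^ 2 - δ ^ 2 := by
          rw [← sq_abs (yCoord p)]; nlinarith
        obtain ⟨N, hN⟩ := exists_nat_gt (1 / (yCoord p ^ 2 - δ ^ 2))
        refine tendsto_const_nhds.congr' ?_
        filter_upwards [eventually_ge_atTop N] with k hk
        have hk1 : 1 < (k : ℝ) * (yCoord p ^ 2 - δ ^ 2) := by
          rw [← div_lt_iff₀ hpos]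
          exact hN.trans_le (by exact_mod_cast hk)
        have hop : IsOpen {q : Space n | 1 < (k : ℝ) * (yCoord q ^ 2 - δ ^ 2)} :=
          isOpen_lt continuous_const
            (continuous_const.mul ((continuous_yCoord.pow 2).sub continuous_const))
        have : F k =ᶠ[𝓝 p] ψ := by
          filter_upwards [hop.mem_nhds hk1] with q hq
          simp only [hF]
          rw [slabCut_eq_one (le_of_lt hq), one_mul]
        rw [this.gradient_eq]
  rw [integral_indicator hS] at hlim
  refine tendsto_nhds_unique hlim (tendsto_const_nhds.congr fun k => ?_)
  exact (hz k).symm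

end

/-! ### Good slices and extensions of traces. -/

section

variable {n : ℕ}

/-- Otherwise |y|^a g(y) > 1/y on all of (0, η), and 1/y is not integrable at 0. -/
lemma exists_small_slice {a : ℝ} {g : ℝ → ENNReal}
    (hfin : ∫⁻ y : ℝ, ENNReal.ofReal (|y| ^ a) * g y ≠ ⊤) {η : ℝ} (hη : 0 < η) :
    ∃ δ ∈ Ioo 0 η, ENNReal.ofReal (δ ^ (a + 1)) * g δ ≤ 1 := by
  by_contra! h
  have h1 : ∫⁻ y in Ioo 0 η, ENNReal.ofReal y⁻¹ ≠ ⊤ := by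
    refine ne_top_of_le_ne_top hfin ?_
    rw [← lintegral_indicator measurableSet_Ioo]
    refine lintegral_mono fun y => ?_
    by_cases hy : y ∈ Ioo 0 η
    · rw [indicator_of_mem hy]
      have hy0 := hy.1
      calc ENNReal.ofReal y⁻¹ = ENNReal.ofReal y⁻¹ * 1 := (mul_one _).symm
        _ ≤ ENNReal.ofReal y⁻¹ * (ENNReal.ofReal (y ^ (a + 1)) * g y) := by
            gcongr; exact (h y hy).le
        _ = ENNReal.ofReal (|y| ^ a) * g y := by
            rw [← mul_assoc, ← ENNReal.ofReal_mul (by positivity), abs_of_pos hy0,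
              Real.rpow_add_one hy0.ne']
            congr 2; field_simp
    · rw [indicator_of_notMem hy]; exact zero_le
  have h2 : IntegrableOn (fun y : ℝ => y⁻¹) (Ioo 0 η) := by
    refine ⟨measurable_inv.aestronglyMeasurable, ?_⟩
    rw [hasFiniteIntegral_iff_ofReal ((ae_restrict_iff' measurableSet_Ioo).2
      (Eventually.of_forall fun y hy => by simpa using hy.1.le))]
    exact lt_top_iff_ne_top.2 h1
  have h3 := (intervalIntegrable_iff_integrableOn_Ioo_of_le hη.le).2 h2
  rw [intervalIntegrable_inv_iff] at h3
  rcases h3 with h3 | h3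
  · exact hη.ne h3
  · exact h3 left_mem_uIcc

lemma measurableSet_slab (δ : ℝ) : MeasurableSet {p : Space n | |yCoord p| ≤ δ} :=
  (isClosed_le continuous_yCoord.abs continuous_const).measurableSet

/-- There are arbitrarily thin slabs on which the trace of a function of finite energy on the
boundary of the slab has controlled energy. -/
lemma exists_trace_energy_le {a : ℝ} (ha : -1 < a) {φ : Space n → ℝ}
    (hφ : Integrable (fun p => ‖gradient φ p‖ ^ 2) (wvol a)) {η : ℝ} (hη : 0 < η) :
    ∃ δ ∈ Ioo 0 η, ∫⁻ p in {p : Space n | |yCoord p| ≤ δ},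
      ENNReal.ofReal (‖gradient φ (setY δ p)‖ ^ 2) ∂(wvol a) ≤ ENNReal.ofReal (2 / (a + 1)) := by
  have hm : Measurable fun p : Space n => ENNReal.ofReal (‖gradient φ p‖ ^ 2) :=
    ((measurable_gradient φ).norm.pow_const 2).ennreal_ofReal
  have hfin : ∫⁻ y : ℝ, ENNReal.ofReal (|y| ^ a) *
      ∫⁻ x : Fin n → ℝ, ENNReal.ofReal (‖gradient φ (mkPt y x)‖ ^ 2) ≠ ⊤ := by
    rw [← lintegral_wvol_eq_slices a hm]
    have := hφ.2
    rw [hasFiniteIntegral_iff_ofReal (Eventually.of_forall fun p => by positivity)] at this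
    exact this.ne
  obtain ⟨δ, hδ, hle⟩ := exists_small_slice hfin hη
  refine ⟨δ, hδ, ?_⟩
  have hm2 : Measurable ({p : Space n | |yCoord p| ≤ δ}.indicator
      fun p => ENNReal.ofReal (‖gradient φ (setY δ p)‖ ^ 2)) :=
    (hm.comp (contDiff_setY δ (k := 0)).continuous.measurable).indicator (measurableSet_slab δ)
  rw [← lintegral_indicator (measurableSet_slab δ), lintegral_wvol_eq_slices a hm2]
  set G := ∫⁻ x : Fin n → ℝ, ENNReal.ofReal (‖gradient φ (mkPt δ x)‖ ^ 2) with hG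
  have h1 : ∀ y : ℝ, ENNReal.ofReal (|y| ^ a) *
      ∫⁻ x : Fin n → ℝ, {p : Space n | |yCoord p| ≤ δ}.indicator
        (fun p => ENNReal.ofReal (‖gradient φ (setY δ p)‖ ^ 2)) (mkPt y x) =
      (Icc (-δ) δ).indicator (fun y => ENNReal.ofReal (|y| ^ a) * G) y := by
    intro y
    by_cases hy : y ∈ Icc (-δ) δ
    · rw [indicator_of_mem hy]
      congr 1
      refine lintegral_congr fun x => ?_
      rw [indicator_of_mem (by simpa using abs_le.2 hy), setY_mkPt]
    · rw [indicator_of_notMem hy]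
      have : ∀ x : Fin n → ℝ, {p : Space n | |yCoord p| ≤ δ}.indicator
        (fun p => ENNReal.ofReal (‖gradient φ (setY δ p)‖ ^ 2)) (mkPt y x) = 0 := fun x =>
        indicator_of_notMem (fun h => hy (abs_le.1 (by simpa using h))) _
      simp only [this, lintegral_zero, mul_zero]
  simp_rw [h1]
  -- The inner integral no longer depends on y, so the slab costs ∫ |y|^a dy = 2δ^(a+1)/(a+1) times
  -- the slice energy, and δ was selected to make δ^(a+1) times that energy at most 1.
  rw [lintegral_indicator measurableSet_Icc, setLIntegral_congr Ioo_ae_eq_Icc.symm,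
    lintegral_mul_const _ (by fun_prop), lintegral_abs_rpow ha hδ.1.le]
  calc _ = ENNReal.ofReal (2 / (a + 1)) * (ENNReal.ofReal (δ ^ (a + 1)) * G) := by
        rw [← mul_assoc, ← ENNReal.ofReal_mul (by have : 0 < a + 1 := by linarith
                                                  positivity)]
        congr 2; ring
    _ ≤ ENNReal.ofReal (2 / (a + 1)) * 1 := by gcongr
    _ = _ := mul_one _

/-- Functions that are admissible in the Dirichlet form: continuous, compactly supported in `B(R)`,
`C¹` off `{y = 0}`, even, and of finite energy. -/
structure IsTest (a R : ℝ) (φ : Space n → ℝ) : Prop where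
  continuous : Continuous φ
  contDiffOn : ContDiffOn ℝ 1 φ {p | yCoord p ≠ 0}
  hasCompactSupport : HasCompactSupport φ
  tsupport_subset : tsupport φ ⊆ Metric.ball 0 R
  energy : Integrable (fun p => ‖gradient φ p‖ ^ 2) (wvol a)
  even : ∀ p, φ (reflect p) = φ p

lemma IsTest.differentiableAt {a R : ℝ} {φ : Space n → ℝ} (hφ : IsTest a R φ) {p : Space n}
    (hp : yCoord p ≠ 0) : DifferentiableAt ℝ φ p :=
  (hφ.contDiffOn.differentiableOn one_ne_zero).differentiableAt (isOpen_off_thin.mem_nhds hp)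

lemma setY_neg (δ : ℝ) (p : Space n) : setY (-δ) p = reflect (setY δ p) := by
  ext i
  by_cases hi : i = Fin.last n
  · subst hi
    simp [setY, reflect, yCoord]; ring
  · simp [setY, reflect, hi]

/-- The extension of the trace of `φ` on `{y = δ}`, independent of `y` near `{y = 0}`. -/
def traceExt (η δ : ℝ) (φ : Space n → ℝ) (p : Space n) : ℝ :=
  φ (setY δ p) * (1 - slabCut (1 / (3 * η ^ 2)) η p)

lemma contDiff_traceExt {η δ : ℝ} (hδ : δ ≠ 0) {φ : Space n → ℝ}
    (hφ : ContDiffOn ℝ 1 φ {p | yCoord p ≠ 0}) : ContDiff ℝ 1 (traceExt η δ φ) := by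
  refine ContDiff.mul ?_ (contDiff_const.sub ((contDiff_slabCut _ _).of_le (by simp)))
  rw [contDiff_iff_contDiffAt]
  intro p
  exact (hφ.contDiffAt (isOpen_off_thin.mem_nhds (by simpa using hδ))).comp p
    (contDiff_setY δ).contDiffAt

lemma support_traceExt {η δ ρ : ℝ} (hη : 0 < η) (hδ : δ ∈ Ioo 0 η) {φ : Space n → ℝ}
    (hφ : tsupport φ ⊆ Metric.closedBall 0 ρ) {p : Space n} (hp : traceExt η δ φ p ≠ 0) :
    setY δ p ∈ tsupport φ ∧ p ∈ Metric.closedBall 0 (ρ + 3 * η) := by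
  have h1 : φ (setY δ p) ≠ 0 := left_ne_zero_of_mul hp
  -- The factor 1/(3η²) in `traceExt` is chosen so that the slab cutoff equals 1 as soon as y² ≥
  -- 4η².
  have h2 : |yCoord p| ≤ 2 * η := by
    by_contra! h
    refine right_ne_zero_of_mul hp ?_
    rw [slabCut_eq_one, sub_self]
    rw [← sq_abs (yCoord p), div_mul_eq_mul_div, one_mul, le_div_iff₀ (by positivity)]
    nlinarith
  have h3 : setY δ p ∈ tsupport φ := subset_tsupport _ h1
  refine ⟨h3, ?_⟩
  rw [mem_closedBall_zero_iff]
  have h4 := mem_closedBall_zero_iff.1 (hφ h3)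
  have h5 := norm_setY_sub δ p
  have h6 : |δ - yCoord p| ≤ 3 * η := by
    have := abs_sub δ (yCoord p)
    rw [abs_of_pos hδ.1] at this
    linarith [hδ.2]
  have h7 := norm_sub_le (setY δ p) (setY δ p - p)
  rw [sub_sub_cancel] at h7
  linarith

lemma tsupport_traceExt {η δ ρ : ℝ} (hη : 0 < η) (hδ : δ ∈ Ioo 0 η) {φ : Space n → ℝ}
    (hφ : tsupport φ ⊆ Metric.closedBall 0 ρ) :
    tsupport (traceExt η δ φ) ⊆ Metric.closedBall 0 (ρ + 3 * η) :=
  closure_minimal (fun _ hp => (support_traceExt hη hδ hφ hp).2) Metric.isClosed_closedBall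

lemma hasCompactSupport_traceExt {η δ ρ : ℝ} (hη : 0 < η) (hδ : δ ∈ Ioo 0 η) {φ : Space n → ℝ}
    (hφ : tsupport φ ⊆ Metric.closedBall 0 ρ) : HasCompactSupport (traceExt η δ φ) :=
  (isCompact_closedBall _ _).of_isClosed_subset (isClosed_tsupport _) (tsupport_traceExt hη hδ hφ)

/-- The slabs decrease to the null set {y = 0}, so the integral over them tends to zero. -/
lemma LocEnergy.exists_slab_energy_le {a R : ℝ} (hR : 0 < R) {u : Space n → ℝ}
    (hu : LocEnergy a R u) {K : Set (Space n)} (hK : IsClosed K) (hKR : K ⊆ Metric.ball 0 R)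
    {ε : ℝ} (hε : 0 < ε) : ∃ δ₀ > 0, ∀ δ ≤ δ₀,
      ∫ p in K ∩ {p | |yCoord p| ≤ δ}, ‖gradient u p‖ ^ 2 ∂(wvol a) ≤ ε := by
  have hi := hu.integrableOn hR hK hKR
  set s : ℕ → Set (Space n) := fun k => K ∩ {p | |yCoord p| ≤ 1 / ((k : ℝ) + 1)} with hs
  have hsm : ∀ k, MeasurableSet (s k) := fun k => hK.measurableSet.inter (measurableSet_slab _)
  have hanti : Antitone s := by
    intro k l hkl p hp
    exact ⟨hp.1, le_trans (show |yCoord p| ≤ _ from hp.2) (one_div_le_one_div_of_le (by positivity)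
      (by have : (k : ℝ) ≤ l := by exact_mod_cast hkl
          linarith))⟩
  have h1 := tendsto_setIntegral_of_antitone hsm hanti
    ⟨0, hi.mono_set inter_subset_left⟩
  have h2 : ∫ p in ⋂ k, s k, ‖gradient u p‖ ^ 2 ∂(wvol a) = 0 := by
    refine setIntegral_measure_zero _ (measure_mono_null (fun p hp => ?_)
      (ae_iff.1 (ae_wvol_yCoord_ne_zero a)))
    simp only [ne_eq, not_not, mem_ofPred_eq]
    have h3 : |yCoord p| ≤ 0 := by
      refine ge_of_tendsto' (tendsto_one_div_add_atTop_nhds_zero_nat (𝕜 := ℝ)) fun k => ?_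
      exact (mem_iInter.1 hp k).2
    exact abs_nonpos_iff.1 h3
  rw [h2] at h1
  obtain ⟨k, hk⟩ := (h1.eventually (gt_mem_nhds hε)).exists
  refine ⟨1 / ((k : ℝ) + 1), by positivity, fun δ hδ => le_trans ?_ hk.le⟩
  refine setIntegral_mono_set (hi.mono_set inter_subset_left)
    (Eventually.of_forall fun p => by positivity) (Eventually.of_forall fun p hp => ?_)
  exact ⟨hp.1, le_trans (show |yCoord p| ≤ δ from hp.2) hδ⟩

end

/-! ### The variational inequality for test functions of finite energy. -/

section

variable {n : ℕ} {a R : ℝ} {u : Space n → ℝ}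

lemma IsTest.of_contDiff (ha : -1 < a) {φ : Space n → ℝ} (h1 : ContDiff ℝ 1 φ)
    (h2 : HasCompactSupport φ) (h3 : tsupport φ ⊆ Metric.ball 0 R)
    (h4 : ∀ p, φ (reflect p) = φ p) : IsTest a R φ :=
  ⟨h1.continuous, h1.contDiffOn, h2, h3, integrable_sq_gradient_of_contDiff ha h1 h2, h4⟩

lemma traceExt_eq_comp_setY {η δ : ℝ} {φ : Space n → ℝ} {p : Space n} (h : |yCoord p| ≤ |η|) :
    traceExt η δ φ p = φ (setY δ p) := by
  rw [traceExt, slabCut_eq_zero (by positivity) h, sub_zero, mul_one]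

/-- In the Dirichlet form, a test function may be replaced by the extension of its trace on a
suitable hyperplane `{y = δ}`. -/
lemma IsSolution.exists_traceExt_pairing_approx (hu : IsSolution a R u) (ha : -1 < a) (hR : 0 < R)
    {φ : Space n → ℝ} (hφ : IsTest a R φ) {ρ η : ℝ} (hρ : tsupport φ ⊆ Metric.closedBall 0 ρ)
    (hη : 0 < η) (hρη : ρ + 3 * η < R) {ε δ₀ : ℝ} (hε : 0 < ε) (hδ₀ : 0 < δ₀) :
    ∃ δ ∈ Ioo 0 η, δ < δ₀ ∧ |pairing a u φ - pairing a u (traceExt η δ φ)| ≤ ε := by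
  set K : Set (Space n) := Metric.closedBall 0 (ρ + 3 * η) with hK
  have hKR : K ⊆ Metric.ball 0 R := Metric.closedBall_subset_ball hρη
  set E := ∫ p, ‖gradient φ p‖ ^ 2 ∂(wvol a) with hE
  have hE0 : 0 ≤ E := integral_nonneg fun p => by positivity
  have ha1 : 0 < a + 1 := by linarith
  -- Bound for the energy of φ - T in the slab, independent of δ: the 4 is the square of the bound 2
  -- on the differential of the projection, and 2/(a + 1) comes from the choice of the slice.
  set M := 2 * E + 2 * (4 * (2 / (a + 1))) with hM
  have hM0 : 0 ≤ M := by positivity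
  set t := ε / (M + 1) with ht
  have ht0 : 0 < t := by positivity
  -- With this smallness of the energy of u, Young's inequality with parameter t splits the error
  -- into two halves of ε.
  obtain ⟨δ₁, hδ₁, hslab⟩ := hu.locEnergy.exists_slab_energy_le hR
    Metric.isClosed_closedBall hKR (ε := t * ε) (by positivity)
  obtain ⟨δ, hδ, htr⟩ := exists_trace_energy_le ha hφ.energy
    (lt_min hη (lt_min hδ₀ hδ₁))
  have hδη : δ ∈ Ioo 0 η := ⟨hδ.1, hδ.2.trans_le (min_le_left _ _)⟩
  refine ⟨δ, hδη, hδ.2.trans_le ((min_le_right _ _).trans (min_le_left _ _)), ?_⟩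
  have hδδ₁ : δ ≤ δ₁ := hδ.2.le.trans ((min_le_right _ _).trans (min_le_right _ _))
  set T := traceExt η δ φ with hT
  have hTC : ContDiff ℝ 1 T := contDiff_traceExt hδ.1.ne' hφ.contDiffOn
  have hTK : tsupport T ⊆ K := tsupport_traceExt hη hδη hρ
  have hTc : HasCompactSupport T := hasCompactSupport_traceExt hη hδη hρ
  have hTE := integrable_sq_gradient_of_contDiff ha hTC hTc
  have hφK : tsupport φ ⊆ K := hρ.trans (Metric.closedBall_subset_closedBall (by linarith))
  have i1 := hu.locEnergy.integrable_inner hR hφ.tsupport_subset hφ.energy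
  have i2 := hu.locEnergy.integrable_inner hR (hTK.trans hKR) hTE
  have hTd : ∀ p, DifferentiableAt ℝ T p := hTC.differentiable one_ne_zero
  set f : Space n → ℝ := fun p => inner ℝ (gradient u p) (gradient φ p - gradient T p) with hf
  have if' : Integrable f (wvol a) := by
    simp only [hf, inner_sub_right]
    exact i1.sub i2
  set S : Set (Space n) := {p | δ < |yCoord p|} with hS
  have hSm : MeasurableSet S := (isOpen_lt continuous_const continuous_yCoord.abs).measurableSet
  have hSc : Sᶜ = {p : Space n | |yCoord p| ≤ δ} := by ext p; simp [hS]
  -- φ - T vanishes on {|y| = δ}, so by `setIntegral_inner_eq_zero` the region outside the slab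
  -- contributes nothing.
  have e0 : pairing a u φ - pairing a u T = ∫ p in Sᶜ, f p ∂(wvol a) := by
    rw [pairing, pairing, ← integral_sub i1 i2]
    simp_rw [← inner_sub_right]
    rw [← integral_add_compl hSm if']
    have e1 : ∫ p in S, f p ∂(wvol a) =
        ∫ p in S, inner ℝ (gradient u p) (gradient (fun q => φ q - T q) p) ∂(wvol a) := by
      refine setIntegral_congr_fun hSm fun p hp => ?_
      have hp0 : yCoord p ≠ 0 := abs_pos.1 (hδ.1.trans hp)
      simp only [hf]
      rw [gradient_sub (hφ.differentiableAt hp0) (hTd p)]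
    have hsub : tsupport (fun q => φ q - T q) ⊆ K :=
      (tsupport_sub φ T).trans (union_subset hφK hTK)
    rw [e1, hu.setIntegral_inner_eq_zero ha hR hδ.1 (hφ.contDiffOn.sub hTC.contDiffOn)
      ((isCompact_closedBall _ _).of_isClosed_subset (isClosed_tsupport _) hsub)
      (hsub.trans hKR), zero_add]
    intro p hp
    rw [hT, traceExt_eq_comp_setY (by rw [hp, abs_of_pos hη]; exact hδη.2.le), sub_eq_zero]
    -- On {y = -δ} the extension carries the values of φ on {y = δ}; evenness of φ makes the two
    -- traces agree.
    rcases (abs_eq hδ.1.le).1 hp with h | h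
    · rw [setY_eq_self h]
    · rw [← hφ.even (setY δ p), ← setY_neg, setY_eq_self h]
  have e2 : ∫ p in Sᶜ, f p ∂(wvol a) = ∫ p in K ∩ Sᶜ, f p ∂(wvol a) := by
    rw [← Measure.restrict_restrict (s := K) (t := Sᶜ) Metric.isClosed_closedBall.measurableSet]
    refine (setIntegral_eq_integral_of_forall_compl_eq_zero fun p hp => ?_).symm
    simp only [hf]
    rw [gradient_eq_zero_of_notMem_tsupport fun h => hp (hφK h),
      gradient_eq_zero_of_notMem_tsupport fun h => hp (hTK h)]
    simp
  have hgT : ∀ p ∈ Sᶜ, ‖gradient T p‖ ≤ 2 * ‖gradient φ (setY δ p)‖ := by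
    intro p hp
    rw [hSc] at hp
    have hloc : T =ᶠ[𝓝 p] fun q => φ (setY δ q) := by
      have : |yCoord p| < η := lt_of_le_of_lt hp hδη.2
      filter_upwards [(isOpen_lt continuous_yCoord.abs continuous_const).mem_nhds this] with q hq
      exact traceExt_eq_comp_setY (by rw [abs_of_pos hη]; exact le_of_lt hq)
    rw [hloc.gradient_eq]
    exact norm_gradient_comp_setY_le (hφ.differentiableAt (by simpa using hδ.1.ne'))
  have hTslab : ∫ p in Sᶜ, ‖gradient T p‖ ^ 2 ∂(wvol a) ≤ 4 * (2 / (a + 1)) := by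
    rw [integral_eq_lintegral_of_nonneg_ae (Eventually.of_forall fun p => by positivity)
      ((measurable_gradient T).norm.pow_const 2).aestronglyMeasurable]
    refine ENNReal.toReal_le_of_le_ofReal (by positivity) ?_
    calc _ ≤ ∫⁻ p in Sᶜ, ENNReal.ofReal 4 * ENNReal.ofReal (‖gradient φ (setY δ p)‖ ^ 2)
            ∂(wvol a) := by
          refine setLIntegral_mono' hSm.compl fun p hp => ?_
          rw [← ENNReal.ofReal_mul (by norm_num)]
          refine ENNReal.ofReal_le_ofReal ?_
          have := hgT p hp
          nlinarith [norm_nonneg (gradient T p)]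
      _ ≤ ENNReal.ofReal 4 * ENNReal.ofReal (2 / (a + 1)) := by
          rw [lintegral_const_mul' _ _ (by simp), hSc]
          gcongr
      _ = _ := by rw [← ENNReal.ofReal_mul (by norm_num)]
  have hsq : ∀ p, ‖gradient φ p - gradient T p‖ ^ 2 ≤
      2 * ‖gradient φ p‖ ^ 2 + 2 * ‖gradient T p‖ ^ 2 := by
    intro p
    have h1 := norm_sub_le (gradient φ p) (gradient T p)
    have h2 := norm_nonneg (gradient φ p - gradient T p)
    nlinarith [sq_nonneg (‖gradient φ p‖ - ‖gradient T p‖)]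
  have hdiff : Integrable (fun p => ‖gradient φ p - gradient T p‖ ^ 2) (wvol a) := by
    refine ((hφ.energy.const_mul 2).add (hTE.const_mul 2)).mono'
      (((measurable_gradient φ).sub (measurable_gradient T)).norm.pow_const 2).aestronglyMeasurable
      (Eventually.of_forall fun p => ?_)
    rw [Real.norm_eq_abs, abs_of_nonneg (by positivity)]
    exact hsq p
  have hdM : ∫ p in K ∩ Sᶜ, ‖gradient φ p - gradient T p‖ ^ 2 ∂(wvol a) ≤ M := by
    calc _ ≤ ∫ p in Sᶜ, ‖gradient φ p - gradient T p‖ ^ 2 ∂(wvol a) :=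
          setIntegral_mono_set hdiff.integrableOn (Eventually.of_forall fun p => by positivity)
            (Eventually.of_forall fun p hp => hp.2)
      _ ≤ ∫ p in Sᶜ, (2 * ‖gradient φ p‖ ^ 2 + 2 * ‖gradient T p‖ ^ 2) ∂(wvol a) :=
          setIntegral_mono hdiff.integrableOn
            ((hφ.energy.const_mul 2).add (hTE.const_mul 2)).integrableOn hsq
      _ = 2 * ∫ p in Sᶜ, ‖gradient φ p‖ ^ 2 ∂(wvol a) +
          2 * ∫ p in Sᶜ, ‖gradient T p‖ ^ 2 ∂(wvol a) := by
          rw [integral_add (hφ.energy.const_mul 2).integrableOn (hTE.const_mul 2).integrableOn,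
            integral_const_mul, integral_const_mul]
      _ ≤ M := by
          have := setIntegral_le_integral (s := Sᶜ) hφ.energy
            (Eventually.of_forall fun p => by positivity)
          rw [hM]
          gcongr
  have hi := hu.locEnergy.integrableOn hR Metric.isClosed_closedBall hKR
  have hKS := hslab δ hδδ₁
  rw [← hSc, ← hK] at hKS
  have hfin := abs_integral_inner_le (μ := (wvol a).restrict (K ∩ Sᶜ)) (F := gradient u)
    (G := fun p => gradient φ p - gradient T p) (hi.mono_set inter_subset_left)
    hdiff.integrableOn ht0
  rw [e0, e2]
  refine hfin.trans ?_
  have e3 : 1 / (2 * t) * ∫ p in K ∩ Sᶜ, ‖gradient u p‖ ^ 2 ∂(wvol a) ≤ ε / 2 := by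
    calc _ ≤ 1 / (2 * t) * (t * ε) := by gcongr
      _ = ε / 2 := by field_simp
  have e4 : t / 2 * ∫ p in K ∩ Sᶜ, ‖gradient φ p - gradient T p‖ ^ 2 ∂(wvol a) ≤ ε / 2 := by
    calc _ ≤ t / 2 * (M + 1) := by gcongr; linarith
      _ = ε / 2 := by rw [ht]; field_simp
  linarith

lemma IsTest.pairing_add {φ ψ : Space n → ℝ} (hR : 0 < R) (hu : LocEnergy a R u)
    (hφ : IsTest a R φ) (hψ : IsTest a R ψ) :
    pairing a u (fun p => φ p + ψ p) = pairing a u φ + pairing a u ψ := by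
  rw [pairing, pairing, pairing, ← integral_add
    (hu.integrable_inner hR hφ.tsupport_subset hφ.energy)
    (hu.integrable_inner hR hψ.tsupport_subset hψ.energy)]
  refine integral_congr_ae ?_
  filter_upwards [ae_wvol_yCoord_ne_zero a] with p hp
  rw [gradient_add (hφ.differentiableAt hp) (hψ.differentiableAt hp), inner_add_right]

lemma pairing_const_mul (c : ℝ) (φ : Space n → ℝ) :
    pairing a u (fun p => c * φ p) = c * pairing a u φ := by
  rw [pairing, pairing, ← integral_const_mul]
  congr 1; ext p
  rw [gradient_const_mul, inner_smul_right]

lemma IsTest.const_mul {φ : Space n → ℝ} (hφ : IsTest a R φ) (c : ℝ) :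
    IsTest a R fun p => c * φ p where
  continuous := hφ.continuous.const_mul c
  contDiffOn := contDiffOn_const.mul hφ.contDiffOn
  hasCompactSupport := hφ.hasCompactSupport.mul_left
  tsupport_subset := (tsupport_mul_subset_right (f := fun _ => c)).trans hφ.tsupport_subset
  energy := by
    simp_rw [gradient_const_mul, norm_smul, mul_pow]
    exact hφ.energy.const_mul _
  even p := by rw [hφ.even]

lemma exists_bump (hR : 0 < R) {ρ : ℝ} (hρ : ρ < R) : ∃ b : Space n → ℝ, ContDiff ℝ ∞ b ∧
    HasCompactSupport b ∧ tsupport b ⊆ Metric.ball 0 R ∧ (∀ p, 0 ≤ b p) ∧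
    ∀ p ∈ Metric.closedBall 0 ρ, b p = 1 := by
  obtain ⟨r, hr, hrR⟩ := exists_between (max_lt hR hρ)
  obtain ⟨s, hs, hsR⟩ := exists_between hrR
  have hr0 : 0 < r := (le_max_left _ _).trans_lt hr
  let b : ContDiffBump (0 : Space n) := ⟨r, s, hr0, hs⟩
  refine ⟨b, b.contDiff, b.hasCompactSupport, ?_, fun p => b.nonneg, fun p hp => ?_⟩
  · rw [b.tsupport_eq]; exact Metric.closedBall_subset_ball hsR
  · exact b.one_of_mem_closedBall
      (Metric.closedBall_subset_closedBall ((le_max_right _ _).trans hr.le) hp)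

lemma IsTest.exists_closedBall {φ : Space n → ℝ} (hφ : IsTest a R φ) (hR : 0 < R) :
    ∃ ρ ∈ Ioo 0 R, tsupport φ ⊆ Metric.closedBall 0 ρ := by
  obtain ⟨ρ, hρ, h⟩ := exists_pos_lt_subset_ball hR (isClosed_tsupport φ) hφ.tsupport_subset
  exact ⟨ρ, hρ, h.trans Metric.ball_subset_closedBall⟩

/-- The variational inequality for test functions that are nonnegative on `{y = 0}`. -/
lemma IsSolution.pairing_nonneg (hu : IsSolution a R u) (ha : -1 < a) (hR : 0 < R)
    {φ : Space n → ℝ} (hφ : IsTest a R φ) (h0 : ∀ p, yCoord p = 0 → 0 ≤ φ p) :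
    0 ≤ pairing a u φ := by
  obtain ⟨ρ, hρ, hρs⟩ := hφ.exists_closedBall hR
  set η := (R - ρ) / 6 with hη
  have hη0 : 0 < η := by rw [hη]; linarith [hρ.2]
  have hρη : ρ + 3 * η < R := by rw [hη]; linarith [hρ.2]
  obtain ⟨b, hb1, hb2, hb3, hb4, hb5⟩ := exists_bump (n := n) hR hρη
  have hB : 0 ≤ pairing a u b :=
    hu.pairing_nonneg_of_contDiff ha hR (hb1.of_le (by simp)) hb2 hb3 hb4
  refine le_of_forall_pos_le_add fun ε hε => ?_
  -- Uniform continuity makes the extended trace at least -ε', so adding ε' b makes it nonnegative.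
  -- The total cost is ε' for the approximation plus ε' times the pairing with b, that is ε.
  set ε' := ε / (pairing a u b + 1) with hε'
  have hε'0 : 0 < ε' := by positivity
  have huc := hφ.hasCompactSupport.uniformContinuous_of_continuous hφ.continuous
  obtain ⟨δ₀, hδ₀, hδε⟩ := Metric.uniformContinuous_iff.1 huc ε' hε'0
  obtain ⟨δ, hδ, hδδ₀, happ⟩ :=
    hu.exists_traceExt_pairing_approx ha hR hφ hρs hη0 hρη hε'0 hδ₀
  have hTC : ContDiff ℝ 1 (traceExt η δ φ) := contDiff_traceExt hδ.1.ne' hφ.contDiffOn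
  have hTK := tsupport_traceExt hη0 hδ hρs
  have hTc := hasCompactSupport_traceExt hη0 hδ hρs
  have hKR : Metric.closedBall (0 : Space n) (ρ + 3 * η) ⊆ Metric.ball 0 R :=
    Metric.closedBall_subset_ball hρη
  have hTlow : ∀ p, -ε' ≤ traceExt η δ φ p := by
    intro p
    have h1 : -ε' ≤ φ (setY δ p) := by
      have h2 : dist (setY δ p) (setY 0 p) < δ₀ := by
        rw [dist_setY_setY, sub_zero, abs_of_pos hδ.1]; exact hδδ₀
      have h3 := hδε h2
      rw [Real.dist_eq] at h3
      have h4 := h0 (setY 0 p) (by simp)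
      linarith [(abs_lt.1 h3).1]
    have h5 := slabCut_nonneg (1 / (3 * η ^ 2)) η p
    have h6 := slabCut_le_one (1 / (3 * η ^ 2)) η p
    rw [traceExt]
    nlinarith
  have hpos := hu.pairing_nonneg_of_contDiff ha hR
    (T := fun p => traceExt η δ φ p + ε' * b p)
    (hTC.add (contDiff_const.mul (hb1.of_le (by simp)))) (hTc.add hb2.mul_left)
    ((tsupport_add _ _).trans (union_subset (hTK.trans hKR)
      ((tsupport_mul_subset_right (f := fun _ => ε')).trans hb3))) (fun p => by
        by_cases hp : p ∈ Metric.closedBall (0 : Space n) (ρ + 3 * η)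
        · rw [hb5 p hp]; linarith [hTlow p]
        · rw [image_eq_zero_of_notMem_tsupport fun h => hp (hTK h), zero_add]
          exact mul_nonneg hε'0.le (hb4 p))
  have hsum : pairing a u (fun p => traceExt η δ φ p + ε' * b p) =
      pairing a u (traceExt η δ φ) + ε' * pairing a u b := by
    rw [← pairing_const_mul, pairing, pairing, pairing, ← integral_add
      (hu.locEnergy.integrable_inner hR (hTK.trans hKR)
        (integrable_sq_gradient_of_contDiff ha hTC hTc))
      (hu.locEnergy.integrable_inner hR
        ((tsupport_mul_subset_right (f := fun _ => ε')).trans hb3)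
        (integrable_sq_gradient_of_contDiff ha (contDiff_const.mul (hb1.of_le (by simp)))
          hb2.mul_left))]
    congr 1; ext p
    rw [gradient_add (hTC.differentiable one_ne_zero p)
      ((contDiff_const.mul (hb1.of_le (by simp : (1 : WithTop ℕ∞) ≤ ∞))).differentiable
        one_ne_zero p), inner_add_right]
  rw [hsum] at hpos
  have h7 := (abs_le.1 happ).1
  have h8 : ε' * (pairing a u b + 1) = ε := by rw [hε']; field_simp
  nlinarith

lemma norm_reflect (p : Space n) : ‖reflect p‖ = ‖p‖ := by
  rw [EuclideanSpace.norm_eq, EuclideanSpace.norm_eq]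
  congr 1
  refine Finset.sum_congr rfl fun i _ => ?_
  by_cases hi : i = Fin.last n <;> simp [reflect, hi]

lemma reflect_smul (c : ℝ) (p : Space n) : reflect (c • p) = c • reflect p := by
  ext i; by_cases hi : i = Fin.last n <;> simp [reflect, hi]

/-- By the variational inequality the pairing with u is a positive functional of the trace on {y =
0}; positivity is applied to c b + φ and c b - φ. -/
lemma IsTest.abs_pairing_le {φ : Space n → ℝ} (hu : IsSolution a R u) (ha : -1 < a) (hR : 0 < R)
    (hφ : IsTest a R φ) {b : Space n → ℝ} (hb : IsTest a R b) {c : ℝ}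
    (h : ∀ p, yCoord p = 0 → |φ p| ≤ c * b p) : |pairing a u φ| ≤ c * pairing a u b := by
  have key : ∀ s : ℝ, |s| = 1 → 0 ≤ c * pairing a u b + s * pairing a u φ := by
    intro s hs
    rw [← pairing_const_mul, ← pairing_const_mul,
      ← IsTest.pairing_add hR hu.locEnergy (hb.const_mul c) (hφ.const_mul s)]
    have ht : IsTest a R fun p => c * b p + s * φ p :=
      { continuous := (hb.continuous.const_mul c).add (hφ.continuous.const_mul s)
        contDiffOn := (hb.const_mul c).contDiffOn.add (hφ.const_mul s).contDiffOn
        hasCompactSupport := (hb.const_mul c).hasCompactSupport.add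
          (hφ.const_mul s).hasCompactSupport
        tsupport_subset := (tsupport_add _ _).trans
          (union_subset (hb.const_mul c).tsupport_subset (hφ.const_mul s).tsupport_subset)
        energy := by
          refine (((hb.const_mul c).energy.const_mul 2).add
            ((hφ.const_mul s).energy.const_mul 2)).mono'
            ((measurable_gradient _).norm.pow_const 2).aestronglyMeasurable ?_
          filter_upwards [ae_wvol_yCoord_ne_zero a] with p hp
          rw [gradient_add ((hb.const_mul c).differentiableAt hp)
            ((hφ.const_mul s).differentiableAt hp), Real.norm_eq_abs, abs_of_nonneg (by positivity)]
          simp only [Pi.add_apply]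
          have h1 := norm_add_le (gradient (fun q => c * b q) p) (gradient (fun q => s * φ q) p)
          nlinarith [sq_nonneg (‖gradient (fun q => c * b q) p‖ -
            ‖gradient (fun q => s * φ q) p‖), norm_nonneg (gradient (fun q => c * b q) p +
            gradient (fun q => s * φ q) p)]
        even := fun p => by rw [hb.even, hφ.even] }
    refine hu.pairing_nonneg ha hR ht fun p hp => ?_
    have h1 := h p hp
    have h2 : |s * φ p| = |φ p| := by rw [abs_mul, hs, one_mul]
    linarith [neg_abs_le (s * φ p)]
  rw [abs_le]
  constructor
  · linarith [key 1 (by simp)]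
  · linarith [key (-1) (by simp)]

end

/-! ### Regular functions, radial cutoffs, and complementarity. -/

section

variable {n : ℕ} {a R : ℝ} {u : Space n → ℝ}

/-- Even functions on `B(R)` that are continuous, `C¹` off `{y = 0}`, and locally of finite
energy. -/
structure IsRegular (a R : ℝ) (v : Space n → ℝ) : Prop where
  continuousOn : ContinuousOn v (Metric.ball 0 R)
  contDiffOn : ContDiffOn ℝ 1 v {p | p ∈ Metric.ball 0 R ∧ yCoord p ≠ 0}
  energy : LocEnergy a R v
  even : ∀ p ∈ Metric.ball (0 : Space n) R, v (reflect p) = v p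

lemma IsSolution.isRegular (hu : IsSolution a R u) : IsRegular a R u :=
  ⟨hu.continuousOn, hu.contDiffOn.of_le one_le_two, hu.locEnergy, hu.even⟩

lemma isOpen_ball_off_thin : IsOpen {p : Space n | p ∈ Metric.ball 0 R ∧ yCoord p ≠ 0} :=
  Metric.isOpen_ball.inter isOpen_off_thin

namespace IsRegular

variable {v w : Space n → ℝ}

lemma differentiableAt (hv : IsRegular a R v) {p : Space n} (hp : p ∈ Metric.ball 0 R)
    (hy : yCoord p ≠ 0) : DifferentiableAt ℝ v p :=
  (hv.contDiffOn.differentiableOn one_ne_zero).differentiableAt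
    (isOpen_ball_off_thin.mem_nhds ⟨hp, hy⟩)

lemma exists_bound (hv : IsRegular a R v) {r : ℝ} (hr : r < R) :
    ∃ C, 0 ≤ C ∧ ∀ p ∈ Metric.closedBall (0 : Space n) r, |v p| ≤ C := by
  obtain ⟨C, hC⟩ := (isCompact_closedBall (0 : Space n) r).exists_bound_of_continuousOn
    (hv.continuousOn.mono (Metric.closedBall_subset_ball hr))
  exact ⟨max C 0, le_max_right _ _, fun p hp => (hC p hp).trans (le_max_left _ _)⟩

lemma of_contDiff (ha : -1 < a) (h : ContDiff ℝ 1 v) (he : ∀ p, v (reflect p) = v p) :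
    IsRegular a R v where
  continuousOn := h.continuous.continuousOn
  contDiffOn := h.contDiffOn
  energy r _ := by
    have hc : Continuous fun p => ‖gradient v p‖ ^ 2 := by
      simp_rw [norm_gradient]
      exact (h.continuous_fderiv one_ne_zero).norm.pow 2
    obtain ⟨C, hC⟩ := (isCompact_closedBall (0 : Space n) r).exists_bound_of_continuousOn
      hc.continuousOn
    exact Measure.integrableOn_of_bounded (M := C) (wvol_slab_inter_ball_lt_top ha r).ne
      hc.aestronglyMeasurable ((ae_restrict_iff' measurableSet_ball).2
        (Eventually.of_forall fun p hp => hC p (Metric.ball_subset_closedBall hp)))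
  even p _ := he p

lemma mul (hv : IsRegular a R v) (hw : IsRegular a R w) : IsRegular a R fun p => v p * w p where
  continuousOn := hv.continuousOn.mul hw.continuousOn
  contDiffOn := hv.contDiffOn.mul hw.contDiffOn
  energy r hr := by
    obtain ⟨C₁, hC₁, h1⟩ := hv.exists_bound hr
    obtain ⟨C₂, hC₂, h2⟩ := hw.exists_bound hr
    refine (((hw.energy r hr).const_mul (2 * C₁ ^ 2)).add
      ((hv.energy r hr).const_mul (2 * C₂ ^ 2))).mono'
      ((measurable_gradient _).norm.pow_const 2).aestronglyMeasurable ?_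
    refine (ae_restrict_iff' measurableSet_ball).2 ?_
    filter_upwards [ae_wvol_yCoord_ne_zero a] with p hy hp
    have hpR := Metric.ball_subset_ball hr.le hp
    have hpc := Metric.ball_subset_closedBall hp
    rw [gradient_mul (hv.differentiableAt hpR hy) (hw.differentiableAt hpR hy), Real.norm_eq_abs,
      abs_of_nonneg (by positivity)]
    simp only [Pi.add_apply]
    have e1 := norm_add_le (v p • gradient w p) (w p • gradient v p)
    rw [norm_smul, norm_smul, Real.norm_eq_abs, Real.norm_eq_abs] at e1
    have e2 : |v p| * ‖gradient w p‖ ≤ C₁ * ‖gradient w p‖ := by gcongr; exact h1 p hpc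
    have e3 : |w p| * ‖gradient v p‖ ≤ C₂ * ‖gradient v p‖ := by gcongr; exact h2 p hpc
    have e4 : ‖v p • gradient w p + w p • gradient v p‖ ^ 2 ≤
        (C₁ * ‖gradient w p‖ + C₂ * ‖gradient v p‖) ^ 2 := by gcongr; linarith
    nlinarith [sq_nonneg (C₁ * ‖gradient w p‖ - C₂ * ‖gradient v p‖)]
  even p hp := by rw [hv.even p hp, hw.even p hp]

lemma comp {g : ℝ → ℝ} (hg : ContDiff ℝ 1 g) (hv : IsRegular a R v) :
    IsRegular a R fun p => g (v p) where
  continuousOn := hg.continuous.comp_continuousOn hv.continuousOn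
  contDiffOn := hg.comp_contDiffOn hv.contDiffOn
  energy r hr := by
    obtain ⟨C₁, hC₁, h1⟩ := hv.exists_bound hr
    obtain ⟨C, hC⟩ := (isCompact_Icc (a := -C₁) (b := C₁)).exists_bound_of_continuousOn
      (hg.continuous_deriv le_rfl).continuousOn
    refine ((hv.energy r hr).const_mul (C ^ 2)).mono'
      ((measurable_gradient _).norm.pow_const 2).aestronglyMeasurable ?_
    refine (ae_restrict_iff' measurableSet_ball).2 ?_
    filter_upwards [ae_wvol_yCoord_ne_zero a] with p hy hp
    have hpR := Metric.ball_subset_ball hr.le hp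
    have h2 := (hg.differentiable one_ne_zero (v p)).hasDerivAt.comp_hasFDerivAt p
      (hv.differentiableAt hpR hy).hasFDerivAt
    have h3 : fderiv ℝ (fun q => g (v q)) p = _ := h2.fderiv
    rw [norm_gradient, h3, norm_smul, ← norm_gradient, norm_pow, norm_mul, norm_norm, norm_norm,
      mul_pow]
    gcongr
    exact hC _ (abs_le.1 (h1 p (Metric.ball_subset_closedBall hp)))
  even p hp := by rw [hv.even p hp]

lemma mono {R' : ℝ} (hv : IsRegular a R v) (h : R' ≤ R) : IsRegular a R' v where
  continuousOn := hv.continuousOn.mono (Metric.ball_subset_ball h)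
  contDiffOn := hv.contDiffOn.mono fun _ hp => ⟨Metric.ball_subset_ball h hp.1, hp.2⟩
  energy r hr := hv.energy r (hr.trans_le h)
  even p hp := hv.even p (Metric.ball_subset_ball h hp)

lemma const_mul (c : ℝ) (hv : IsRegular a R v) : IsRegular a R fun p => c * v p :=
  hv.comp (contDiff_const.mul contDiff_id)

lemma add (hv : IsRegular a R v) (hw : IsRegular a R w) : IsRegular a R fun p => v p + w p where
  continuousOn := hv.continuousOn.add hw.continuousOn
  contDiffOn := hv.contDiffOn.add hw.contDiffOn
  energy r hr := by
    refine (((hv.energy r hr).const_mul 2).add ((hw.energy r hr).const_mul 2)).mono'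
      ((measurable_gradient _).norm.pow_const 2).aestronglyMeasurable ?_
    refine (ae_restrict_iff' measurableSet_ball).2 ?_
    filter_upwards [ae_wvol_yCoord_ne_zero a] with p hy hp
    have hpR := Metric.ball_subset_ball hr.le hp
    rw [gradient_add (hv.differentiableAt hpR hy) (hw.differentiableAt hpR hy), Real.norm_eq_abs,
      abs_of_nonneg (by positivity)]
    simp only [Pi.add_apply]
    have e1 := norm_add_le (gradient v p) (gradient w p)
    have e4 : ‖gradient v p + gradient w p‖ ^ 2 ≤ (‖gradient v p‖ + ‖gradient w p‖) ^ 2 := by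
      gcongr
    nlinarith [sq_nonneg (‖gradient v p‖ - ‖gradient w p‖)]
  even p hp := by rw [hv.even p hp, hw.even p hp]

lemma sub (hv : IsRegular a R v) (hw : IsRegular a R w) : IsRegular a R fun p => v p - w p := by
  simpa [sub_eq_add_neg] using hv.add (hw.const_mul (-1))

lemma comp_smul (hv : IsRegular a R v) {c : ℝ} (hc : 0 < c) {R' : ℝ} (hR' : c * R' ≤ R) :
    IsRegular a R' fun p => v (c • p) := by
  have hmap : ∀ p ∈ Metric.ball (0 : Space n) R', c • p ∈ Metric.ball (0 : Space n) R := by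
    intro p hp
    rw [mem_ball_zero_iff] at hp ⊢
    rw [norm_smul, Real.norm_eq_abs, abs_of_pos hc]
    exact (mul_lt_mul_of_pos_left hp hc).trans_le hR'
  have hsm : ContDiff ℝ 1 fun p : Space n => c • p := contDiff_const_smul c
  refine ⟨hv.continuousOn.comp hsm.continuous.continuousOn hmap,
    hv.contDiffOn.comp hsm.contDiffOn fun p hp => ⟨hmap p hp.1, ?_⟩, fun r hr => ?_, fun p hp => ?_⟩
  · rw [yCoord_smul]; exact mul_ne_zero hc.ne' hp.2
  · have h1 := hv.energy (c * r) ((mul_lt_mul_of_pos_left hr hc).trans_le hR')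
    rw [← integrable_indicator_iff measurableSet_ball] at h1 ⊢
    have h2 := ((integrable_comp_smul_wvol_iff a hc _).2 h1).const_mul (c ^ 2)
    refine h2.congr (Eventually.of_forall fun p => ?_)
    have h3 : c • p ∈ Metric.ball (0 : Space n) (c * r) ↔ p ∈ Metric.ball (0 : Space n) r := by
      rw [mem_ball_zero_iff, mem_ball_zero_iff, norm_smul, Real.norm_eq_abs, abs_of_pos hc,
        mul_lt_mul_iff_right₀ hc]
    by_cases hp : p ∈ Metric.ball (0 : Space n) r
    · simp only [indicator_of_mem (h3.2 hp), indicator_of_mem hp]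
      rw [gradient_comp_smul, norm_smul, mul_pow, Real.norm_eq_abs, sq_abs]
    · simp only [indicator_of_notMem (fun h => hp (h3.1 h)), indicator_of_notMem hp, mul_zero]
  · rw [← reflect_smul, hv.even _ (hmap p hp)]

lemma isTest (hR : 0 < R) (hv : IsRegular a R v) (hc : HasCompactSupport v)
    (hs : tsupport v ⊆ Metric.ball 0 R) : IsTest a R v where
  continuous := by
    rw [continuous_iff_continuousAt]
    intro p
    by_cases hp : p ∈ tsupport v
    · exact hv.continuousOn.continuousAt (Metric.isOpen_ball.mem_nhds (hs hp))
    · exact (continuousAt_const (y := (0 : ℝ))).congr (notMem_tsupport_iff_eventuallyEq.1 hp).symm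
  contDiffOn := by
    intro p hp
    by_cases hp' : p ∈ tsupport v
    · exact (hv.contDiffOn.contDiffAt
        (isOpen_ball_off_thin.mem_nhds ⟨hs hp', hp⟩)).contDiffWithinAt
    · exact (contDiffAt_const.congr_of_eventuallyEq
        (notMem_tsupport_iff_eventuallyEq.1 hp')).contDiffWithinAt
  hasCompactSupport := hc
  tsupport_subset := hs
  energy := by
    refine (integrableOn_iff_integrable_of_support_subset fun p hp => ?_).1
      (hv.energy.integrableOn hR (isClosed_tsupport v) hs)
    by_contra h
    exact hp (by simp [gradient_eq_zero_of_notMem_tsupport h])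
  even p := by
    by_cases hp : p ∈ Metric.ball (0 : Space n) R
    · exact hv.even p hp
    · have hp' : reflect p ∉ Metric.ball (0 : Space n) R := by
        rwa [mem_ball_zero_iff, norm_reflect, ← mem_ball_zero_iff]
      rw [image_eq_zero_of_notMem_tsupport fun h => hp (hs h),
        image_eq_zero_of_notMem_tsupport fun h => hp' (hs h)]

end IsRegular

/-- Smooth even cutoff functions supported in `B(R)`. -/
structure IsCutoff (R : ℝ) (χ : Space n → ℝ) : Prop where
  contDiff : ContDiff ℝ ∞ χ
  hasCompactSupport : HasCompactSupport χ
  tsupport_subset : tsupport χ ⊆ Metric.ball 0 R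
  even : ∀ p, χ (reflect p) = χ p

lemma IsCutoff.isTest_mul {χ v : Space n → ℝ} (ha : -1 < a) (hR : 0 < R) (hχ : IsCutoff R χ)
    (hv : IsRegular a R v) : IsTest a R fun p => χ p * v p :=
  ((IsRegular.of_contDiff ha (hχ.contDiff.of_le (by simp)) hχ.even).mul hv).isTest hR
    hχ.hasCompactSupport.mul_right ((tsupport_mul_subset_left).trans hχ.tsupport_subset)

lemma IsCutoff.isTest {χ : Space n → ℝ} (ha : -1 < a) (hχ : IsCutoff R χ) : IsTest a R χ :=
  IsTest.of_contDiff ha (hχ.contDiff.of_le (by simp)) hχ.hasCompactSupport hχ.tsupport_subset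
    hχ.even

/-- Profiles of radial cutoff functions: smooth, constant near `0`, and vanishing near `R`. -/
structure IsProfile (R : ℝ) (c : ℝ → ℝ) : Prop where
  contDiff : ContDiff ℝ ∞ c
  const_near_zero : ∃ s > 0, ∀ r ≤ s, c r = c 0
  zero_near_R : ∃ ρ < R, ∀ r, ρ ≤ r → c r = 0

namespace IsProfile

variable {c : ℝ → ℝ}

lemma deriv_eq_zero (hc : IsProfile R c) : ∃ s > 0, ∀ r < s, deriv c r = 0 := by
  obtain ⟨s, hs, h⟩ := hc.const_near_zero
  refine ⟨s, hs, fun r hr => ?_⟩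
  have : c =ᶠ[𝓝 r] fun _ => c 0 := by
    filter_upwards [Iio_mem_nhds hr] with t ht using h t (le_of_lt ht)
  rw [this.deriv_eq, deriv_const]

lemma contDiff_radial (hc : IsProfile R c) : ContDiff ℝ ∞ fun p : Space n => c ‖p‖ := by
  obtain ⟨s, hs, h⟩ := hc.const_near_zero
  rw [contDiff_iff_contDiffAt]
  intro p
  rcases eq_or_ne p 0 with rfl | hp
  · refine (contDiffAt_const (c := c 0)).congr_of_eventuallyEq ?_
    filter_upwards [Metric.ball_mem_nhds (0 : Space n) hs] with q hq
    exact h _ (mem_ball_zero_iff.1 hq).le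
  · exact hc.contDiff.contDiffAt.comp p (contDiffAt_norm ℝ hp)

lemma gradient_radial (hc : IsProfile R c) (p : Space n) :
    gradient (fun q : Space n => c ‖q‖) p = (deriv c ‖p‖ / ‖p‖) • p := by
  rcases eq_or_ne p 0 with rfl | hp
  · obtain ⟨s, hs, h⟩ := hc.const_near_zero
    have : (fun q : Space n => c ‖q‖) =ᶠ[𝓝 0] fun _ => c 0 := by
      filter_upwards [Metric.ball_mem_nhds (0 : Space n) hs] with q hq
      exact h _ (mem_ball_zero_iff.1 hq).le
    rw [this.gradient_eq, gradient_fun_const, smul_zero]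
  · have hp0 : ‖p‖ ≠ 0 := norm_ne_zero_iff.2 hp
    have h1 : HasGradientAt (fun q : Space n => ‖q‖) (‖p‖⁻¹ • p) p := by
      have h2 := ((hasStrictFDerivAt_norm_sq p).hasFDerivAt.sqrt (by positivity))
      rw [hasGradientAt_iff_hasFDerivAt]
      have h3 : (fun q : Space n => √(‖q‖ ^ 2)) = fun q => ‖q‖ := by
        ext q; exact Real.sqrt_sq (norm_nonneg q)
      rw [h3, Real.sqrt_sq (norm_nonneg p)] at h2
      have h6 : (InnerProductSpace.toDual ℝ (Space n)) (‖p‖⁻¹ • p) =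
          (1 / (2 * ‖p‖)) • 2 • (innerSL ℝ) p := by
        ext v
        simp only [InnerProductSpace.toDual_apply_apply, inner_smul_left, conj_trivial,
          FunLike.coe_smul, Pi.smul_apply, smul_eq_mul, nsmul_eq_mul]
        field_simp
        rw [mul_comm]; rfl
      rw [h6]; exact h2
    have h4 := (hc.contDiff.differentiable (by simp) ‖p‖).hasDerivAt.comp_hasFDerivAt p
      h1.hasFDerivAt
    have h5 : HasGradientAt (fun q : Space n => c ‖q‖) ((deriv c ‖p‖ / ‖p‖) • p) p := by
      rw [hasGradientAt_iff_hasFDerivAt]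
      have h6 : (InnerProductSpace.toDual ℝ (Space n)) ((deriv c ‖p‖ / ‖p‖) • p) =
          deriv c ‖p‖ • (InnerProductSpace.toDual ℝ (Space n)) (‖p‖⁻¹ • p) := by
        rw [← map_smul, smul_smul, div_eq_mul_inv]
      rw [h6]; exact h4
    exact h5.gradient

lemma tsupport_radial (hc : IsProfile R c) :
    ∃ ρ < R, tsupport (fun p : Space n => c ‖p‖) ⊆ Metric.closedBall 0 ρ := by
  obtain ⟨ρ, hρ, h⟩ := hc.zero_near_R
  refine ⟨ρ, hρ, closure_minimal (fun p hp => ?_) Metric.isClosed_closedBall⟩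
  rw [mem_closedBall_zero_iff]
  by_contra! h'
  exact hp (h _ h'.le)

lemma isCutoff (hc : IsProfile R c) : IsCutoff R fun p : Space n => c ‖p‖ := by
  obtain ⟨ρ, hρ, h⟩ := hc.tsupport_radial (n := n)
  exact ⟨hc.contDiff_radial,
    (isCompact_closedBall _ _).of_isClosed_subset (isClosed_tsupport _) h,
    h.trans (Metric.closedBall_subset_ball hρ), fun p => by rw [norm_reflect]⟩

end IsProfile

lemma exists_isProfile (hR : 0 < R) {ρ : ℝ} (hρ : ρ < R) : ∃ c : ℝ → ℝ, IsProfile R c ∧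
    (∀ r, 0 ≤ c r) ∧ (∀ r, c r ≤ 1) ∧ ∀ r ≤ ρ, c r = 1 := by
  obtain ⟨r, hr, hrR⟩ := exists_between (max_lt hR hρ)
  obtain ⟨s, hs, hsR⟩ := exists_between hrR
  have hr0 : 0 < r := (le_max_left _ _).trans_lt hr
  have hone : ∀ t ≤ r, Real.smoothTransition ((s - t) / (s - r)) = 1 := fun t ht =>
    Real.smoothTransition.one_of_one_le (by rw [one_le_div (by linarith)]; linarith)
  refine ⟨fun t => Real.smoothTransition ((s - t) / (s - r)), ⟨?_, ?_, s, hsR, fun t ht => ?_⟩,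
    fun t => Real.smoothTransition.nonneg _, fun t => Real.smoothTransition.le_one _,
    fun t ht => hone t (ht.trans ((le_max_right _ _).trans hr.le))⟩
  · exact Real.smoothTransition.contDiff.comp ((contDiff_const.sub contDiff_id).div_const _)
  · exact ⟨r, hr0, fun t ht => by rw [hone t ht, hone 0 hr0.le]⟩
  · exact Real.smoothTransition.zero_of_nonpos
      (div_nonpos_of_nonpos_of_nonneg (by linarith) (by linarith))

namespace IsSolution

/-- The function `u` itself does not see the contact set: `∫ ⟨∇u, ∇(χ g(u))⟩ |y|^a = 0` if `g`
vanishes below a positive level. -/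
lemma pairing_cutoff_comp_eq_zero (hu : IsSolution a R u) (ha : -1 < a) (hR : 0 < R)
    {χ : Space n → ℝ} (hχ : IsCutoff R χ) {g : ℝ → ℝ} (hg : ContDiff ℝ 1 g) {ε : ℝ} (hε : 0 < ε)
    (hgε : ∀ t ≤ ε, g t = 0) : pairing a u (fun p => χ p * g (u p)) = 0 := by
  have hφ := hχ.isTest_mul ha hR (hu.isRegular.comp hg)
  set φ : Space n → ℝ := fun p => χ p * g (u p) with hφdef
  obtain ⟨ρ, hρ, hρs⟩ := (hχ.isTest ha).exists_closedBall hR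
  have hφs : tsupport φ ⊆ Metric.closedBall 0 ρ := tsupport_mul_subset_left.trans hρs
  set η := (R - ρ) / 6 with hη
  have hη0 : 0 < η := by rw [hη]; linarith [hρ.2]
  have hρη : ρ + 3 * η < R := by rw [hη]; linarith [hρ.2]
  have hKR : Metric.closedBall (0 : Space n) (ρ + 3 * η) ⊆ Metric.ball 0 R :=
    Metric.closedBall_subset_ball hρη
  have hρK : Metric.closedBall (0 : Space n) ρ ⊆ Metric.closedBall 0 (ρ + 3 * η) :=
    Metric.closedBall_subset_closedBall (by linarith)
  have huc := (isCompact_closedBall (0 : Space n) (ρ + 3 * η)).uniformContinuousOn_of_continuous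
    (hu.continuousOn.mono hKR)
  obtain ⟨δ₀, hδ₀, hδε⟩ := Metric.uniformContinuousOn_iff.1 huc ε hε
  refine abs_eq_zero.1 (le_antisymm (le_of_forall_pos_le_add fun ε' hε' => ?_) (abs_nonneg _))
  obtain ⟨δ, hδ, hδδ₀, happ⟩ :=
    hu.exists_traceExt_pairing_approx ha hR hφ hφs hη0 hρη hε' hδ₀
  have hC : IsClosed (Metric.closedBall (0 : Space n) ρ ∩ u ⁻¹' Ici ε) :=
    (hu.continuousOn.mono (hρK.trans hKR)).preimage_isClosed_of_isClosed
      Metric.isClosed_closedBall isClosed_Ici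
  have hsetY : Continuous (setY δ : Space n → Space n) := (contDiff_setY δ (k := 0)).continuous
  -- Where the extended trace lives, u ≥ ε on {y = δ}. Since δ < δ₀, uniform continuity gives u > 0
  -- at the points of {y = 0} in its support, so the variational equality applies.
  have hT0 : pairing a u (traceExt η δ φ) = 0 := by
    refine hu.pairing_eq_zero_of_contDiff ha hR (contDiff_traceExt hδ.1.ne' hφ.contDiffOn)
      (hasCompactSupport_traceExt hη0 hδ hφs) fun p hp => ?_
    have h1 := tsupport_traceExt hη0 hδ hφs hp
    refine ⟨hKR h1, fun hy => ?_⟩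
    have h2 : setY δ p ∈ Metric.closedBall (0 : Space n) ρ ∩ u ⁻¹' Ici ε := by
      have : tsupport (traceExt η δ φ) ⊆
          setY δ ⁻¹' (Metric.closedBall (0 : Space n) ρ ∩ u ⁻¹' Ici ε) := by
        refine closure_minimal (fun q hq => ?_) (hC.preimage hsetY)
        have hq1 := (support_traceExt hη0 hδ hφs hq).1
        refine ⟨hφs hq1, ?_⟩
        by_contra h
        refine left_ne_zero_of_mul hq ?_
        simp only [hφdef]
        rw [hgε _ (le_of_lt (not_le.1 h)), mul_zero]
      exact this hp
    have h3 : dist (setY δ p) p < δ₀ := by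
      rw [dist_eq_norm, norm_setY_sub, hy, sub_zero, abs_of_pos hδ.1]; exact hδδ₀
    have h4 := hδε _ (hρK h2.1) _ h1 h3
    have h5 : ε ≤ u (setY δ p) := h2.2
    rw [Real.dist_eq] at h4
    linarith [(abs_lt.1 h4).2]
  rw [hT0, sub_zero] at happ
  linarith

/-- `∫ ⟨∇u, ∇(χ u)⟩ |y|^a = 0` for every cutoff function `χ`. -/
lemma pairing_cutoff_self (hu : IsSolution a R u) (ha : -1 < a) (hR : 0 < R)
    {χ : Space n → ℝ} (hχ : IsCutoff R χ) : pairing a u (fun p => χ p * u p) = 0 := by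
  obtain ⟨ρ, hρ, hρs⟩ := (hχ.isTest ha).exists_closedBall hR
  obtain ⟨c, hc, hc0, -, hc1⟩ := exists_isProfile hR hρ.2
  have hb := hc.isCutoff (n := n)
  obtain ⟨M, hM⟩ := hχ.hasCompactSupport.isCompact.exists_bound_of_continuousOn
    hχ.contDiff.continuous.continuousOn
  have hM' : ∀ p, |χ p| ≤ max M 0 := fun p => by
    by_cases hp : p ∈ tsupport χ
    · exact (hM p hp).trans (le_max_left _ _)
    · rw [image_eq_zero_of_notMem_tsupport hp, abs_zero]; exact le_max_right _ _
  set B := pairing a u (fun p : Space n => c ‖p‖) with hB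
  have hBnn : 0 ≤ B := hu.pairing_nonneg ha hR (hb.isTest ha) fun p _ => hc0 _
  refine abs_eq_zero.1 (le_antisymm (le_of_forall_pos_le_add fun ε hε => ?_) (abs_nonneg _))
  set ε' := ε / (2 * max M 0 * B + 1) with hε'
  have hε'0 : 0 < ε' := by positivity
  -- g vanishes below ε' and is the identity above 2ε'. The part χ g(u) is annihilated by the
  -- previous lemma. The rest is at most 2ε'|χ| on {y = 0}, where u ≥ 0, and is handled by
  -- `abs_pairing_le`.
  set g : ℝ → ℝ := fun t => t * Real.smoothTransition (t / ε' - 1) with hg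
  have hgC : ContDiff ℝ 1 g :=
    contDiff_id.mul (Real.smoothTransition.contDiff.comp
      ((contDiff_id.div_const _).sub contDiff_const))
  have h1 := hu.pairing_cutoff_comp_eq_zero ha hR hχ hgC hε'0 fun t ht => by
    simp only [hg]
    rw [Real.smoothTransition.zero_of_nonpos, mul_zero]
    rw [sub_nonpos, div_le_one hε'0]; exact ht
  have hgC2 : ContDiff ℝ 1 fun t => t - g t := contDiff_id.sub hgC
  have t1 := hχ.isTest_mul ha hR (hu.isRegular.comp hgC)
  have t2 := hχ.isTest_mul ha hR (hu.isRegular.comp hgC2)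
  have h2 : pairing a u (fun p => χ p * u p) =
      pairing a u (fun p => χ p * (u p - g (u p))) := by
    have := IsTest.pairing_add hR hu.locEnergy t1 t2
    rw [h1, zero_add] at this
    rw [← this]
    congr 1; ext p; ring
  rw [h2, zero_add]
  refine (IsTest.abs_pairing_le hu ha hR t2 (hb.isTest ha) (c := 2 * max M 0 * ε')
    fun p hp => ?_).trans ?_
  · by_cases hps : p ∈ tsupport χ
    · rw [hc1 _ (mem_closedBall_zero_iff.1 (hρs hps)), mul_one, abs_mul]
      have hup := hu.nonneg p (hχ.tsupport_subset hps) hp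
      have h3 : |u p - g (u p)| ≤ 2 * ε' := by
        have s0 := Real.smoothTransition.nonneg (u p / ε' - 1)
        have s1 := Real.smoothTransition.le_one (u p / ε' - 1)
        have e1 : u p - g (u p) = u p * (1 - Real.smoothTransition (u p / ε' - 1)) := by
          simp only [hg]; ring
        rw [e1, abs_of_nonneg (mul_nonneg hup (by linarith))]
        rcases le_or_gt (u p) (2 * ε') with h | h
        · nlinarith
        · rw [Real.smoothTransition.one_of_one_le]
          · simp; positivity
          · rw [le_sub_iff_add_le, le_div_iff₀ hε'0]; linarith
      calc |χ p| * |u p - g (u p)| ≤ max M 0 * (2 * ε') :=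
            mul_le_mul (hM' p) h3 (abs_nonneg _) (le_max_right _ _)
        _ = _ := by ring
    · rw [image_eq_zero_of_notMem_tsupport hps, zero_mul, abs_zero]
      exact mul_nonneg (by positivity) (hc0 _)
  · have : ε' * (2 * max M 0 * B + 1) = ε := by rw [hε']; field_simp
    nlinarith

end IsSolution

end

/-! ### Averages along rays. -/

section

variable {n : ℕ} {a R : ℝ} {u : Space n → ℝ}

instance : SFinite (wvol a : Measure (Space n)) := by
  unfold wvol; infer_instance

/-- Cauchy–Schwarz, read off from the nonnegativity of the integral of (F - mean)². -/
lemma sq_intervalIntegral_le {F : ℝ → ℝ} {s t : ℝ} (hF : ContinuousOn F (uIcc s t)) :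
    (∫ τ in s..t, F τ) ^ 2 ≤ |t - s| * ∫ τ in uIoc s t, F τ ^ 2 := by
  have h1 : (∫ τ in s..t, F τ) ^ 2 = (∫ τ in uIoc s t, F τ) ^ 2 := by
    rw [← sq_abs, intervalIntegral.abs_intervalIntegral_eq, sq_abs]
  have i1 : IntegrableOn F (uIoc s t) :=
    (hF.integrableOn_compact isCompact_uIcc).mono_set uIoc_subset_uIcc
  have i2 : IntegrableOn (fun τ => F τ ^ 2) (uIoc s t) :=
    ((hF.pow 2).integrableOn_compact isCompact_uIcc).mono_set uIoc_subset_uIcc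
  rw [h1]
  rcases eq_or_ne s t with rfl | hst
  · simp
  have hl : 0 < |t - s| := abs_pos.2 (sub_ne_zero.2 hst.symm)
  set I := ∫ τ in uIoc s t, F τ
  have hv : volume.real (uIoc s t) = |t - s| := by
    rw [uIoc, Real.volume_real_Ioc_of_le min_le_max, max_sub_min_eq_abs]
  have h2 : 0 ≤ ∫ τ in uIoc s t, (F τ - I / |t - s|) ^ 2 :=
    integral_nonneg fun τ => by positivity
  have h3 : ∫ τ in uIoc s t, (F τ - I / |t - s|) ^ 2 =
      (∫ τ in uIoc s t, F τ ^ 2) - 2 * (I / |t - s|) * I + |t - s| * (I / |t - s|) ^ 2 := by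
    have e : ∀ τ, (F τ - I / |t - s|) ^ 2 =
        F τ ^ 2 - 2 * (I / |t - s|) * F τ + (I / |t - s|) ^ 2 := fun τ => by ring
    have hfin : volume (uIoc s t) ≠ ⊤ := by simp [uIoc]
    have i3 : IntegrableOn (fun τ => F τ ^ 2 - 2 * (I / |t - s|) * F τ) (uIoc s t) :=
      i2.sub (i1.const_mul _)
    simp_rw [e]
    rw [integral_add i3 (integrableOn_const hfin), integral_sub i2 (i1.const_mul _), integral_const_mul, setIntegral_const, hv, smul_eq_mul]
  rw [h3] at h2
  have h4 : 2 * (I / |t - s|) * I - |t - s| * (I / |t - s|) ^ 2 = I ^ 2 / |t - s| := by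
    field_simp; ring
  have h5 : I ^ 2 / |t - s| ≤ ∫ τ in uIoc s t, F τ ^ 2 := by linarith
  rw [div_le_iff₀ hl] at h5
  linarith

/-- An `L²` bound for averages of a one-parameter family of functions. -/
lemma lintegral_sq_intervalIntegral_le {B : Set (Space n)} {f : Space n → ℝ}
    {F : ℝ → Space n → ℝ} (hF : Measurable (Function.uncurry F)) {l K : ℝ}
    (h1 : ∀ᵐ p ∂((wvol a).restrict B), f p = (∫ τ in (1 : ℝ)..l, F τ p) ∧
      ContinuousOn (fun τ => F τ p) (uIcc 1 l))
    (h2 : ∀ τ ∈ uIcc 1 l, ∫⁻ p in B, ENNReal.ofReal (F τ p ^ 2) ∂(wvol a) ≤ ENNReal.ofReal K) :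
    ∫⁻ p in B, ENNReal.ofReal (f p ^ 2) ∂(wvol a) ≤ ENNReal.ofReal ((l - 1) ^ 2 * K) := by
  calc _ ≤ ∫⁻ p in B, (ENNReal.ofReal |l - 1| *
        ∫⁻ τ in uIoc 1 l, ENNReal.ofReal (F τ p ^ 2)) ∂(wvol a) := by
        refine lintegral_mono_ae ?_
        filter_upwards [h1] with p hp
        have i2 : IntegrableOn (fun τ => F τ p ^ 2) (uIoc 1 l) :=
          ((hp.2.pow 2).integrableOn_compact isCompact_uIcc).mono_set uIoc_subset_uIcc
        rw [← ofReal_integral_eq_lintegral_ofReal i2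
          (Eventually.of_forall fun τ => by positivity), ← ENNReal.ofReal_mul (abs_nonneg _), hp.1]
        exact ENNReal.ofReal_le_ofReal (sq_intervalIntegral_le hp.2)
    _ = ENNReal.ofReal |l - 1| * ∫⁻ τ in uIoc 1 l, ∫⁻ p in B, ENNReal.ofReal (F τ p ^ 2)
          ∂(wvol a) := by
        rw [lintegral_const_mul' _ _ (by simp), lintegral_lintegral_swap]
        exact ((hF.comp measurable_swap).pow_const 2).ennreal_ofReal.aemeasurable
    _ ≤ ENNReal.ofReal |l - 1| * ∫⁻ τ in uIoc 1 l, ENNReal.ofReal K := by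
        gcongr 1
        exact setLIntegral_mono' measurableSet_uIoc fun τ hτ => h2 τ (uIoc_subset_uIcc hτ)
    _ = _ := by
        have hv : volume (uIoc 1 l) = ENNReal.ofReal |l - 1| := by
          rw [uIoc, Real.volume_Ioc, max_sub_min_eq_abs]
        rw [setLIntegral_const, hv, mul_comm (ENNReal.ofReal K), ← mul_assoc,
          ← ENNReal.ofReal_mul (abs_nonneg _), abs_mul_abs_self,
          ← ENNReal.ofReal_mul (mul_self_nonneg _), sq]

/-- The derivative of `u` along the dilations, `Z u = ⟨p, ∇u⟩`. -/
def rad (u : Space n → ℝ) (p : Space n) : ℝ := inner ℝ (gradient u p) p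

lemma measurable_rad (u : Space n → ℝ) : Measurable (rad u) :=
  (measurable_gradient u).inner measurable_id

lemma rad_sq_le (u : Space n → ℝ) (p : Space n) : rad u p ^ 2 ≤ ‖gradient u p‖ ^ 2 * ‖p‖ ^ 2 := by
  rw [← mul_pow, ← sq_abs]
  gcongr
  exact abs_real_inner_le_norm _ _

/-- A ray from the origin through a point with y ≠ 0 never meets {y = 0} again away from the origin,
so regularity off {y = 0} is enough along it. -/
lemma IsRegular.hasDerivAt_ray {v : Space n → ℝ} (hv : IsRegular a R v) {p : Space n} {t : ℝ}
    (h1 : t • p ∈ Metric.ball (0 : Space n) R) (h2 : yCoord p ≠ 0) (ht : t ≠ 0) :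
    HasDerivAt (fun s : ℝ => v (s • p)) (inner ℝ (gradient v (t • p)) p) t := by
  have hd := (hv.differentiableAt h1 (by rw [yCoord_smul]; exact mul_ne_zero ht h2)).hasFDerivAt
  have := hd.comp_hasDerivAt t ((hasDerivAt_id t).smul_const p)
  rw [inner_gradient_left]
  simp only [one_smul] at this
  exact this

lemma IsRegular.continuousOn_ray {v : Space n → ℝ} (hv : IsRegular a R v) {p : Space n}
    {s : Set ℝ} (h1 : ∀ t ∈ s, t • p ∈ Metric.ball (0 : Space n) R ∧ t ≠ 0) (h2 : yCoord p ≠ 0) :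
    ContinuousOn (fun t : ℝ => inner ℝ (gradient v (t • p)) p) s := by
  refine ContinuousOn.inner ?_ continuousOn_const
  refine (continuousOn_gradient isOpen_ball_off_thin hv.contDiffOn).comp
    (continuous_id.smul continuous_const).continuousOn fun t ht => ⟨(h1 t ht).1, ?_⟩
  simp only [yCoord_smul]; exact mul_ne_zero (h1 t ht).2 h2

end

/-! ### Dilations of solutions and Caccioppoli's inequality. -/

section

variable {n : ℕ} {a R : ℝ} {u : Space n → ℝ}

lemma IsTest.mono {R' : ℝ} {φ : Space n → ℝ} (h : IsTest a R' φ) (hR : R' ≤ R) : IsTest a R φ :=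
  ⟨h.continuous, h.contDiffOn, h.hasCompactSupport,
    h.tsupport_subset.trans (Metric.ball_subset_ball hR), h.energy, h.even⟩

lemma IsCutoff.mono {R' : ℝ} {χ : Space n → ℝ} (h : IsCutoff R' χ) (hR : R' ≤ R) : IsCutoff R χ :=
  ⟨h.contDiff, h.hasCompactSupport, h.tsupport_subset.trans (Metric.ball_subset_ball hR), h.even⟩

lemma tsupport_comp_smul_subset {χ : Space n → ℝ} {R' c : ℝ} (hc : 0 < c)
    (h : tsupport χ ⊆ Metric.ball 0 R) (hR : R ≤ c * R') :
    tsupport (fun p => χ (c • p)) ⊆ Metric.ball 0 R' := by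
  intro p hp
  have h1 : c • p ∈ tsupport χ := by
    have : tsupport (fun p => χ (c • p)) ⊆ (fun p => c • p) ⁻¹' tsupport χ :=
      closure_minimal (fun q hq => subset_closure hq)
        ((isClosed_tsupport χ).preimage (continuous_const_smul c))
    exact this hp
  have h2 := mem_ball_zero_iff.1 (h h1)
  rw [norm_smul, Real.norm_eq_abs, abs_of_pos hc] at h2
  rw [mem_ball_zero_iff]
  exact lt_of_mul_lt_mul_left (h2.trans_le hR) hc.le

lemma IsCutoff.comp_smul {χ : Space n → ℝ} (h : IsCutoff R χ) {c R' : ℝ} (hc : 0 < c)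
    (hR : R ≤ c * R') : IsCutoff R' fun p => χ (c • p) where
  contDiff := h.contDiff.comp (contDiff_const_smul c)
  hasCompactSupport := h.hasCompactSupport.comp_homeomorph (Homeomorph.smulOfNeZero c hc.ne')
  tsupport_subset := tsupport_comp_smul_subset hc h.tsupport_subset hR
  even p := by rw [← reflect_smul, h.even]

lemma IsCutoff.mul {χ η : Space n → ℝ} (h : IsCutoff R χ) (h' : IsCutoff R η) :
    IsCutoff R fun p => χ p * η p where
  contDiff := h.contDiff.mul h'.contDiff
  hasCompactSupport := h.hasCompactSupport.mul_right
  tsupport_subset := tsupport_mul_subset_left.trans h.tsupport_subset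
  even p := by rw [h.even, h'.even]

lemma IsTest.pairing_sub_left {v w φ : Space n → ℝ} (hR : 0 < R) (hv : IsRegular a R v)
    (hw : IsRegular a R w) (hφ : IsTest a R φ) :
    pairing a (fun p => v p - w p) φ = pairing a v φ - pairing a w φ := by
  rw [pairing, pairing, pairing, ← integral_sub
    (hv.energy.integrable_inner hR hφ.tsupport_subset hφ.energy)
    (hw.energy.integrable_inner hR hφ.tsupport_subset hφ.energy)]
  refine integral_congr_ae ?_
  filter_upwards [ae_wvol_yCoord_ne_zero a] with p hp
  by_cases hpR : p ∈ tsupport φ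
  · have := hφ.tsupport_subset hpR
    rw [gradient_sub (hv.differentiableAt this hp) (hw.differentiableAt this hp), inner_sub_left]
  · rw [gradient_eq_zero_of_notMem_tsupport hpR]; simp

/-- Each of the two gradients contributes a factor l and the measure contributes l^(-(n+1+a)). -/
lemma pairing_comp_smul {l : ℝ} (hl : 0 < l) (v φ : Space n → ℝ) :
    pairing a (fun p => v (l • p)) φ =
      l ^ (-((n : ℝ) + a - 1)) * pairing a v (fun p => φ (l⁻¹ • p)) := by
  have h1 : ∀ p : Space n, inner ℝ (gradient (fun p => v (l • p)) p) (gradient φ p) =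
      l ^ 2 * (fun q => inner ℝ (gradient v q) (gradient (fun p => φ (l⁻¹ • p)) q)) (l • p) := by
    intro p
    simp only
    rw [gradient_comp_smul, gradient_comp_smul, smul_smul, inv_mul_cancel₀ hl.ne', one_smul,
      inner_smul_left, inner_smul_right, conj_trivial]
    field_simp
  rw [pairing, pairing]
  rw [integral_congr_ae (Eventually.of_forall h1), integral_const_mul,
    integral_comp_smul_wvol a hl
      (fun q : Space n => inner ℝ (gradient v q) (gradient (fun p => φ (l⁻¹ • p)) q)), ← mul_assoc, ← Real.rpow_natCast,
    ← Real.rpow_add hl]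
  congr 2
  push_cast; ring

namespace IsSolution

/-- The dilated function is still nonnegative on {y = 0}, hence an admissible direction for the
variational inequality. -/
lemma pairing_cutoff_dilation_nonneg (hu : IsSolution a R u) (ha : -1 < a) {R' l : ℝ}
    (hR' : 0 < R') (hR : R' ≤ R) (hl : 0 < l) (hlR : l * R' ≤ R) {χ : Space n → ℝ}
    (hχ : IsCutoff R' χ) (h0 : ∀ p, 0 ≤ χ p) : 0 ≤ pairing a u fun p => χ p * u (l • p) := by
  refine hu.pairing_nonneg ha (hR'.trans_le hR)
    ((hχ.isTest_mul ha hR' (hu.isRegular.comp_smul hl hlR)).mono hR) fun p hp => ?_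
  by_cases hps : p ∈ tsupport χ
  · refine mul_nonneg (h0 p) (hu.nonneg _ ?_ (by rw [yCoord_smul, hp, mul_zero]))
    have := mem_ball_zero_iff.1 (hχ.tsupport_subset hps)
    rw [mem_ball_zero_iff, norm_smul, Real.norm_eq_abs, abs_of_pos hl]
    exact (mul_lt_mul_of_pos_left this hl).trans_le hlR
  · rw [image_eq_zero_of_notMem_tsupport hps, zero_mul]

/-- Complementarity: the term χ u pairs to zero with u. -/
lemma pairing_cutoff_dilation_sub (hu : IsSolution a R u) (ha : -1 < a) {R' l : ℝ}
    (hR' : 0 < R') (hR : R' ≤ R) (hl : 0 < l) (hlR : l * R' ≤ R) {χ : Space n → ℝ}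
    (hχ : IsCutoff R' χ) :
    pairing a u (fun p => χ p * (u (l • p) - u p)) = pairing a u fun p => χ p * u (l • p) := by
  have h1 := hu.pairing_cutoff_self ha (hR'.trans_le hR) (hχ.mono hR)
  have t1 := (hχ.isTest_mul ha hR' (hu.isRegular.comp_smul hl hlR)).mono hR
  have t2 := (hχ.isTest_mul ha hR' (hu.isRegular.mono hR)).mono hR
  have := IsTest.pairing_add (hR'.trans_le hR) hu.locEnergy t1 (t2.const_mul (-1))
  rw [pairing_const_mul, h1, mul_zero, add_zero] at this
  rw [← this]
  congr 1; ext p; ring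

/-- The differences `u(l·) - u` are, weakly, subsolutions where they are positive and supersolutions
where they are negative. -/
lemma pairing_dilation_sub_le_zero (hu : IsSolution a R u) (ha : -1 < a) {R' l : ℝ}
    (hR' : 0 < R') (hR : R' ≤ R) (hl : 0 < l) (hlR : l * R' ≤ R) {χ : Space n → ℝ}
    (hχ : IsCutoff R' χ) (h0 : ∀ p, 0 ≤ χ p) :
    pairing a (fun p => u (l • p) - u p) (fun p => χ p * (u (l • p) - u p)) ≤ 0 := by
  have r1 := hu.isRegular.comp_smul hl hlR
  have r2 := hu.isRegular.mono hR
  rw [IsTest.pairing_sub_left hR' r1 r2 (hχ.isTest_mul ha hR' (r1.sub r2)), pairing_comp_smul hl]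
  have h2 : 0 ≤ pairing a u (fun p => χ p * (u (l • p) - u p)) := by
    rw [hu.pairing_cutoff_dilation_sub ha hR' hR hl hlR hχ]
    exact hu.pairing_cutoff_dilation_nonneg ha hR' hR hl hlR hχ h0
  -- The form of u(l·) has been rescaled to the form of u, with everything else dilated by l⁻¹. Then
  -- u(l·) - u becomes u - u(l⁻¹·), and the same positivity applied to l⁻¹ gives the opposite sign.
  have hχ' : IsCutoff (l * R') fun p => χ (l⁻¹ • p) :=
    hχ.comp_smul (inv_pos.2 hl) (by rw [inv_mul_cancel_left₀ hl.ne'])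
  have hlR' : 0 < l * R' := mul_pos hl hR'
  have hlR2 : l⁻¹ * (l * R') ≤ R := by rwa [inv_mul_cancel_left₀ hl.ne']
  have h3 := hu.pairing_cutoff_dilation_nonneg ha hlR' hlR (inv_pos.2 hl) hlR2 hχ'
    fun p => h0 _
  have h4 : pairing a u (fun p => χ (l⁻¹ • p) * (u (l • l⁻¹ • p) - u (l⁻¹ • p))) =
      - pairing a u (fun p => χ (l⁻¹ • p) * u (l⁻¹ • p)) := by
    rw [← hu.pairing_cutoff_dilation_sub ha hlR' hlR (inv_pos.2 hl) hlR2 hχ', ← neg_one_mul,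
      ← pairing_const_mul]
    congr 1; ext p
    rw [smul_smul, mul_inv_cancel₀ hl.ne', one_smul]; ring
  rw [h4]
  have h5 : 0 ≤ l ^ (-((n : ℝ) + a - 1)) := by positivity
  nlinarith [mul_nonneg h5 h3]

end IsSolution

lemma IsRegular.integrableOn_sq {v : Space n → ℝ} (ha : -1 < a) (hv : IsRegular a R v) {r : ℝ}
    (hr : r < R) : IntegrableOn (fun p => v p ^ 2) (Metric.ball 0 r) (wvol a) := by
  obtain ⟨C, -, hC⟩ := hv.exists_bound hr
  refine IntegrableOn.of_bound (wvol_slab_inter_ball_lt_top ha r)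
    (((hv.continuousOn.mono (Metric.ball_subset_ball hr.le)).pow 2).aestronglyMeasurable
      measurableSet_ball) (C ^ 2) ((ae_restrict_iff' measurableSet_ball).2 (Eventually.of_forall
      fun p hp => ?_))
  rw [norm_pow]
  gcongr
  exact hC p (Metric.ball_subset_closedBall hp)

/-- Caccioppoli's inequality. -/
lemma IsRegular.caccioppoli {v η : Space n → ℝ} (ha : -1 < a) (hR : 0 < R) (hv : IsRegular a R v)
    (hη : IsCutoff R η) {r C : ℝ} (hr : r < R) (hηr : tsupport η ⊆ Metric.ball 0 r)
    (hC : ∀ p, ‖gradient η p‖ ≤ C) (h : pairing a v (fun p => η p * η p * v p) ≤ 0) :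
    ∫ p in Metric.ball 0 r, η p ^ 2 * ‖gradient v p‖ ^ 2 ∂(wvol a) ≤
      4 * C ^ 2 * ∫ p in Metric.ball 0 r, v p ^ 2 ∂(wvol a) := by
  have ht := (hη.mul hη).isTest_mul ha hR hv
  have i1 := hv.energy.integrable_inner hR ht.tsupport_subset ht.energy
  have i2 := hv.integrableOn_sq ha hr
  have i3 := hv.energy r hr
  have hs : tsupport (fun p => η p * η p * v p) ⊆ Metric.ball 0 r :=
    (tsupport_mul_subset_left (f := fun p => η p * η p)).trans
      ((tsupport_mul_subset_left (f := η)).trans hηr)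
  have e1 : pairing a v (fun p => η p * η p * v p) =
      ∫ p in Metric.ball 0 r, inner ℝ (gradient v p) (gradient (fun p => η p * η p * v p) p)
        ∂(wvol a) := by
    refine (setIntegral_eq_integral_of_forall_compl_eq_zero fun p hp => ?_).symm
    rw [gradient_eq_zero_of_notMem_tsupport fun h => hp (hs h), inner_zero_right]
  obtain ⟨M, hM⟩ := hη.hasCompactSupport.exists_bound_of_continuous hη.contDiff.continuous
  have i4 : IntegrableOn (fun p => η p ^ 2 * ‖gradient v p‖ ^ 2) (Metric.ball 0 r) (wvol a) :=
    Integrable.bdd_mul i3 (hη.contDiff.continuous.pow 2).aestronglyMeasurable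
      (c := M ^ 2) (Eventually.of_forall fun p => by rw [norm_pow]; gcongr; exact hM p)
  -- Pointwise, 2⟨∇v, ∇(η²v)⟩ + 4C²v² - η²|∇v|² is at least (|η||∇v| - 2C|v|)².
  have key : ∫ p in Metric.ball 0 r, η p ^ 2 * ‖gradient v p‖ ^ 2 ∂(wvol a) ≤
      ∫ p in Metric.ball 0 r, (2 * inner ℝ (gradient v p)
        (gradient (fun p => η p * η p * v p) p) + 4 * C ^ 2 * v p ^ 2) ∂(wvol a) := by
    refine integral_mono_ae i4 ((i1.integrableOn.const_mul 2).add (i2.const_mul _)) ?_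
    refine (ae_restrict_iff' measurableSet_ball).2 ?_
    filter_upwards [ae_wvol_yCoord_ne_zero a] with p hy hp
    have hd := hη.contDiff.differentiable (by simp) p
    have hvd := hv.differentiableAt (Metric.ball_subset_ball hr.le hp) hy
    have hdd : DifferentiableAt ℝ (fun p => η p * η p) p := hd.mul hd
    rw [gradient_mul hdd hvd, gradient_mul hd hd, inner_add_right, inner_smul_right,
      inner_smul_right, inner_add_right, inner_smul_right, real_inner_self_eq_norm_sq]
    have h1 := real_inner_le_norm (gradient v p) (gradient η p)
    have h2 := neg_le_of_abs_le (abs_real_inner_le_norm (gradient v p) (gradient η p))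
    have h3 : |inner ℝ (gradient v p) (gradient η p)| ≤ ‖gradient v p‖ * C :=
      (abs_real_inner_le_norm _ _).trans (by gcongr; exact hC p)
    set s := inner ℝ (gradient v p) (gradient η p)
    set g := ‖gradient v p‖
    have h4 : -(2 * |η p| * |v p| * (g * C)) ≤ 2 * η p * v p * s := by
      have : |2 * η p * v p * s| ≤ 2 * |η p| * |v p| * (g * C) := by
        rw [abs_mul, abs_mul, abs_mul, abs_two]; gcongr
      exact neg_le_of_abs_le this
    have h5 : 0 ≤ (|η p| * g - 2 * C * |v p|) ^ 2 := sq_nonneg _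
    have h6 : |η p| ^ 2 = η p ^ 2 := sq_abs _
    have h7 : |v p| ^ 2 = v p ^ 2 := sq_abs _
    nlinarith
  rw [integral_add (i1.integrableOn.const_mul 2) (i2.const_mul _), integral_const_mul, integral_const_mul,
    ← e1] at key
  linarith

end

/-! ### Second order estimates along dilations. -/

section

variable {n : ℕ} {a R : ℝ} {u : Space n → ℝ}

lemma integrable_sq_of_lintegral_le {μ : Measure (Space n)} {f : Space n → ℝ}
    (hf : AEStronglyMeasurable f μ) {K : ℝ} (hK : 0 ≤ K)
    (h : ∫⁻ p, ENNReal.ofReal (f p ^ 2) ∂μ ≤ ENNReal.ofReal K) :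
    Integrable (fun p => f p ^ 2) μ ∧ ∫ p, f p ^ 2 ∂μ ≤ K := by
  have h1 : Integrable (fun p => f p ^ 2) μ := by
    refine ⟨hf.pow 2, ?_⟩
    rw [hasFiniteIntegral_iff_ofReal (Eventually.of_forall fun p => sq_nonneg _)]
    exact h.trans_lt ENNReal.ofReal_lt_top
  refine ⟨h1, ?_⟩
  rw [← ofReal_integral_eq_lintegral_ofReal h1 (Eventually.of_forall fun p => sq_nonneg _)] at h
  exact (ENNReal.ofReal_le_ofReal_iff hK).1 h

lemma lintegral_sq_le_of_integral_le {μ : Measure (Space n)} {f : Space n → ℝ}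
    (hf : Integrable (fun p => f p ^ 2) μ) {K : ℝ} (h : ∫ p, f p ^ 2 ∂μ ≤ K) :
    ∫⁻ p, ENNReal.ofReal (f p ^ 2) ∂μ ≤ ENNReal.ofReal K := by
  rw [← ofReal_integral_eq_lintegral_ofReal hf (Eventually.of_forall fun p => sq_nonneg _)]
  exact ENNReal.ofReal_le_ofReal h

/-- Change of variables p ↦ l p; since l > 1/2, the Jacobian l^(-(n+1+a)) is at most 2^(n+1+a). -/
lemma IsRegular.exists_lintegral_gradient_dilation_le {v : Space n → ℝ} (ha : -1 < a)
    (hv : IsRegular a R v) {r ε : ℝ} (hr0 : 0 ≤ r) (hε : ε < 1 / 2) (hr : (1 + ε) * r < R) :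
    ∃ K, 0 ≤ K ∧ ∀ l, |l - 1| ≤ ε → ∫⁻ p in Metric.ball (0 : Space n) r,
      ENNReal.ofReal (‖gradient v (l • p)‖ ^ 2) ∂(wvol a) ≤ ENNReal.ofReal K := by
  set I := ∫ p in Metric.ball (0 : Space n) ((1 + ε) * r), ‖gradient v p‖ ^ 2 ∂(wvol a) with hI
  have hI0 : 0 ≤ I := integral_nonneg fun p => by positivity
  refine ⟨2 ^ ((n : ℝ) + 1 + a) * I, by positivity, fun l hl => ?_⟩
  obtain ⟨l1, l2⟩ := abs_le.1 hl
  have hl0 : 0 < l := by linarith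
  have h1 : ∫⁻ p in Metric.ball (0 : Space n) r, ENNReal.ofReal (‖gradient v (l • p)‖ ^ 2)
      ∂(wvol a) ≤ ∫⁻ p, (Metric.ball (0 : Space n) ((1 + ε) * r)).indicator
        (fun q => ENNReal.ofReal (‖gradient v q‖ ^ 2)) (l • p) ∂(wvol a) := by
    rw [← lintegral_indicator measurableSet_ball]
    refine lintegral_mono fun p => ?_
    by_cases hp : p ∈ Metric.ball (0 : Space n) r
    · have : l • p ∈ Metric.ball (0 : Space n) ((1 + ε) * r) := by
        rw [mem_ball_zero_iff] at hp ⊢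
        rw [norm_smul, Real.norm_eq_abs, abs_of_pos hl0]
        calc l * ‖p‖ < l * r := mul_lt_mul_of_pos_left hp hl0
          _ ≤ _ := mul_le_mul_of_nonneg_right (by linarith) hr0
      rw [indicator_of_mem hp, indicator_of_mem this]
    · rw [indicator_of_notMem hp]; exact zero_le
  refine h1.trans ?_
  rw [lintegral_comp_smul_wvol a hl0, lintegral_indicator measurableSet_ball,
    ENNReal.ofReal_mul (by positivity)]
  gcongr
  · rw [Real.rpow_neg hl0.le, ← Real.inv_rpow hl0.le]
    refine Real.rpow_le_rpow (by positivity) ?_ ?_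
    · rw [inv_le_comm₀ hl0 two_pos]; linarith
    · have : (0 : ℝ) ≤ n := n.cast_nonneg
      linarith
  · exact lintegral_sq_le_of_integral_le (hv.energy _ hr) le_rfl

lemma lintegral_inner_sq_le {r K : ℝ} {G : Space n → Space n} {μ : Measure (Space n)}
    (h : ∫⁻ p in Metric.ball (0 : Space n) r, ENNReal.ofReal (‖G p‖ ^ 2) ∂μ ≤ ENNReal.ofReal K) :
    ∫⁻ p in Metric.ball (0 : Space n) r, ENNReal.ofReal (inner ℝ (G p) p ^ 2) ∂μ ≤
      ENNReal.ofReal (r ^ 2 * K) := by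
  rw [ENNReal.ofReal_mul (by positivity)]
  refine le_trans ?_ (mul_le_mul_right h _)
  rw [← lintegral_const_mul' _ _ (by simp)]
  refine setLIntegral_mono' measurableSet_ball fun p hp => ?_
  rw [← ENNReal.ofReal_mul (by positivity)]
  refine ENNReal.ofReal_le_ofReal ?_
  have h1 := abs_real_inner_le_norm (G p) p
  have h2 := mem_ball_zero_iff.1 hp
  rw [← sq_abs, ← mul_pow]
  gcongr
  nlinarith [norm_nonneg (G p)]

lemma smul_mem_ball {r ε τ : ℝ} (hr0 : 0 ≤ r) (hε : ε < 1 / 2) (hr : (1 + ε) * r ≤ R)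
    (hτ : |τ - 1| ≤ ε) {p : Space n} (hp : p ∈ Metric.ball (0 : Space n) r) :
    τ • p ∈ Metric.ball (0 : Space n) R := by
  obtain ⟨l1, l2⟩ := abs_le.1 hτ
  rw [mem_ball_zero_iff] at hp ⊢
  rw [norm_smul, Real.norm_eq_abs, abs_of_pos (by linarith)]
  calc τ * ‖p‖ < τ * r := mul_lt_mul_of_pos_left hp (by linarith)
    _ ≤ (1 + ε) * r := mul_le_mul_of_nonneg_right (by linarith) hr0
    _ ≤ R := hr

lemma abs_sub_one_le_of_mem_uIcc {l τ : ℝ} (h : τ ∈ uIcc 1 l) : |τ - 1| ≤ |l - 1| := by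
  simpa [uIcc_comm] using abs_sub_left_of_mem_uIcc h

lemma IsRegular.dilation_sub_eq_integral {v : Space n → ℝ} (hv : IsRegular a R v) {r ε l : ℝ}
    (hr0 : 0 ≤ r) (hε : ε < 1 / 2) (hr : (1 + ε) * r ≤ R) (hl : |l - 1| ≤ ε) {p : Space n}
    (hp : p ∈ Metric.ball (0 : Space n) r) (hy : yCoord p ≠ 0) :
    v (l • p) - v p = (∫ τ in (1 : ℝ)..l, inner ℝ (gradient v (τ • p)) p) ∧
      ContinuousOn (fun τ : ℝ => inner ℝ (gradient v (τ • p)) p) (uIcc 1 l) := by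
  have h1 : ∀ τ ∈ uIcc 1 l, τ • p ∈ Metric.ball (0 : Space n) R ∧ τ ≠ 0 := fun τ hτ => by
    have h2 := (abs_sub_one_le_of_mem_uIcc hτ).trans hl
    refine ⟨smul_mem_ball hr0 hε hr h2 hp, ?_⟩
    rintro rfl
    norm_num at h2; linarith
  have hc := hv.continuousOn_ray h1 hy
  refine ⟨?_, hc⟩
  rw [intervalIntegral.integral_eq_sub_of_hasDerivAt
    (fun τ hτ => hv.hasDerivAt_ray (h1 τ hτ).1 hy (h1 τ hτ).2) hc.intervalIntegrable, one_smul]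

/-- The increment is the integral of the derivative along the ray, over a parameter interval of
length |l - 1|; Cauchy–Schwarz in that parameter produces the factor (l - 1)². -/
lemma IsRegular.exists_lintegral_dilation_sub_le {v : Space n → ℝ} (ha : -1 < a)
    (hv : IsRegular a R v) {r ε : ℝ} (hr0 : 0 ≤ r) (hε : ε < 1 / 2) (hr : (1 + ε) * r < R) :
    ∃ K, 0 ≤ K ∧ ∀ l, |l - 1| ≤ ε → ∫⁻ p in Metric.ball (0 : Space n) r,
      ENNReal.ofReal ((v (l • p) - v p) ^ 2) ∂(wvol a) ≤ ENNReal.ofReal ((l - 1) ^ 2 * K) := by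
  obtain ⟨K, hK, h⟩ := hv.exists_lintegral_gradient_dilation_le ha hr0 hε hr
  refine ⟨r ^ 2 * K, by positivity, fun l hl => ?_⟩
  refine lintegral_sq_intervalIntegral_le (F := fun τ p => inner ℝ (gradient v (τ • p)) p)
    (((measurable_gradient v).comp (measurable_fst.smul measurable_snd)).inner measurable_snd)
    ?_ fun τ hτ => ?_
  · refine (ae_restrict_iff' measurableSet_ball).2 ?_
    filter_upwards [ae_wvol_yCoord_ne_zero a] with p hy hp
    exact hv.dilation_sub_eq_integral hr0 hε hr.le hl hp hy
  · exact lintegral_inner_sq_le (h τ ((abs_sub_one_le_of_mem_uIcc hτ).trans hl))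

/-- A second order estimate for solutions, in terms of differences along dilations. -/
lemma IsSolution.exists_lintegral_gradient_sub_le (hu : IsSolution a R u) (ha : -1 < a)
    {r ε : ℝ} (hr0 : 0 < r) (hε0 : 0 < ε) (hε : ε < 1 / 2) (hr : (1 + ε) * r < R) :
    ∃ K, 0 ≤ K ∧ ∀ l, |l - 1| ≤ ε → ∫⁻ p in Metric.ball (0 : Space n) r,
      ENNReal.ofReal (‖gradient (fun q => u (l • q) - u q) p‖ ^ 2) ∂(wvol a) ≤
        ENNReal.ofReal ((l - 1) ^ 2 * K) := by
  -- The choice (1 + ε)R' < R makes u(l·) regular on B(R') for every l with |l - 1| ≤ ε.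
  obtain ⟨R', hrR', hR'⟩ := exists_between ((lt_div_iff₀' (by linarith : 0 < 1 + ε)).2 hr)
  rw [lt_div_iff₀' (by linarith)] at hR'
  have hR'0 : 0 < R' := hr0.trans hrR'
  have hR'R : R' ≤ R := by nlinarith
  obtain ⟨c, hc, hc0, hc1, hcr⟩ := exists_isProfile hR'0 hrR'
  obtain ⟨ρ, hρ, hρs⟩ := hc.tsupport_radial (n := n)
  obtain ⟨r₂, hr₂, hr₂R⟩ := exists_between (max_lt hρ hrR')
  have hρr₂ : ρ < r₂ := (le_max_left _ _).trans_lt hr₂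
  have hrr₂ : r < r₂ := (le_max_right _ _).trans_lt hr₂
  have hη := hc.isCutoff (n := n)
  obtain ⟨C, hC⟩ := (hη.hasCompactSupport.fderiv ℝ).exists_bound_of_continuous
    (hη.contDiff.continuous_fderiv (by simp))
  simp_rw [← norm_gradient] at hC
  have hr₂' : (1 + ε) * r₂ < R := lt_of_lt_of_le (by nlinarith) hR'.le
  obtain ⟨K, hK, hD⟩ :=
    hu.isRegular.exists_lintegral_dilation_sub_le ha (hr0.trans hrr₂).le hε hr₂'
  refine ⟨4 * C ^ 2 * K, by positivity, fun l hl => ?_⟩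
  obtain ⟨l1, l2⟩ := abs_le.1 hl
  have hl0 : 0 < l := by linarith
  have hlR : l * R' ≤ R := by nlinarith
  have hv := (hu.isRegular.comp_smul hl0 hlR).sub (hu.isRegular.mono hR'R)
  have h1 := hv.caccioppoli ha hR'0 hη hr₂R (hρs.trans (Metric.closedBall_subset_ball hρr₂)) hC
    (hu.pairing_dilation_sub_le_zero ha hR'0 hR'R hl0 hlR (hη.mul hη)
      fun p => mul_self_nonneg _)
  have h2 := (integrable_sq_of_lintegral_le
    ((hv.continuousOn.mono (Metric.ball_subset_ball hr₂R.le)).aestronglyMeasurable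
      measurableSet_ball) (by positivity) (hD l hl)).2
  have h3 := hv.energy _ hr₂R
  have h4 : IntegrableOn (fun p : Space n => c ‖p‖ ^ 2 *
      ‖gradient (fun q => u (l • q) - u q) p‖ ^ 2) (Metric.ball 0 r₂) (wvol a) :=
    Integrable.bdd_mul h3 (hη.contDiff.continuous.pow 2).aestronglyMeasurable
      (c := 1) (Eventually.of_forall fun p => by
        rw [norm_pow, Real.norm_eq_abs, abs_of_nonneg (hc0 _)]
        exact pow_le_one₀ (hc0 _) (hc1 _))
  refine lintegral_sq_le_of_integral_le (h3.mono_set (Metric.ball_subset_ball hrr₂.le)) ?_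
  calc _ = ∫ p in Metric.ball (0 : Space n) r, c ‖p‖ ^ 2 *
          ‖gradient (fun q => u (l • q) - u q) p‖ ^ 2 ∂(wvol a) := by
        refine setIntegral_congr_fun measurableSet_ball fun p hp => ?_
        rw [hcr _ (mem_ball_zero_iff.1 hp).le, one_pow, one_mul]
    _ ≤ _ := setIntegral_mono_set h4 (Eventually.of_forall fun p => by positivity)
        (Metric.ball_subset_ball hrr₂.le).eventuallyLE
    _ ≤ _ := h1
    _ ≤ 4 * C ^ 2 * ((l - 1) ^ 2 * K) := by gcongr
    _ = _ := by ring

/-- Differences along dilations are approximated, to second order, by the radial derivative. -/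
lemma IsSolution.exists_lintegral_taylor_le (hu : IsSolution a R u) (ha : -1 < a)
    {r ε : ℝ} (hr0 : 0 < r) (hε0 : 0 < ε) (hε : ε < 1 / 2) (hr : (1 + ε) * r < R) :
    ∃ K, 0 ≤ K ∧ ∀ l, |l - 1| ≤ ε → ∫⁻ p in Metric.ball (0 : Space n) r,
      ENNReal.ofReal ((u (l • p) - u p - (l - 1) * rad u p) ^ 2) ∂(wvol a) ≤
        ENNReal.ofReal ((l - 1) ^ 4 * K) := by
  obtain ⟨K₁, hK₁, h1⟩ := hu.exists_lintegral_gradient_sub_le ha hr0 hε0 hε hr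
  obtain ⟨K₂, hK₂, h2⟩ := hu.isRegular.exists_lintegral_gradient_dilation_le ha hr0.le hε hr
  refine ⟨r ^ 2 * (2 * K₁ + 2 * K₂), by positivity, fun l hl => ?_⟩
  have e : (l - 1) ^ 4 * (r ^ 2 * (2 * K₁ + 2 * K₂)) =
      (l - 1) ^ 2 * (r ^ 2 * ((l - 1) ^ 2 * (2 * K₁ + 2 * K₂))) := by ring
  rw [e]
  refine lintegral_sq_intervalIntegral_le
    (F := fun τ p => inner ℝ (gradient u (τ • p) - gradient u p) p)
    ((((measurable_gradient u).comp (measurable_fst.smul measurable_snd)).sub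
      ((measurable_gradient u).comp measurable_snd)).inner measurable_snd)
    ?_ fun τ hτ => ?_
  · refine (ae_restrict_iff' measurableSet_ball).2 ?_
    filter_upwards [ae_wvol_yCoord_ne_zero a] with p hy hp
    obtain ⟨e1, e2⟩ := hu.isRegular.dilation_sub_eq_integral hr0.le hε hr.le hl hp hy
    simp only [inner_sub_left]
    refine ⟨?_, e2.sub continuousOn_const⟩
    rw [intervalIntegral.integral_sub e2.intervalIntegrable intervalIntegrable_const, ← e1,
      intervalIntegral.integral_const, smul_eq_mul, rad]
  · have hτl := abs_sub_one_le_of_mem_uIcc hτ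
    have hτε := hτl.trans hl
    obtain ⟨l1, l2⟩ := abs_le.1 hτε
    refine lintegral_inner_sq_le ?_
    have hR' : τ * r ≤ R := by nlinarith
    have hd : ∀ᵐ p ∂((wvol a).restrict (Metric.ball (0 : Space n) r)),
        ENNReal.ofReal (‖gradient u (τ • p) - gradient u p‖ ^ 2) ≤
          ENNReal.ofReal 2 * ENNReal.ofReal (‖gradient (fun q => u (τ • q) - u q) p‖ ^ 2) +
          ENNReal.ofReal (2 * (τ - 1) ^ 2) * ENNReal.ofReal (‖gradient u (τ • p)‖ ^ 2) := by
      refine (ae_restrict_iff' measurableSet_ball).2 ?_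
      filter_upwards [ae_wvol_yCoord_ne_zero a] with p hy hp
      have hpR : p ∈ Metric.ball (0 : Space n) R :=
        Metric.ball_subset_ball (by nlinarith) hp
      have := gradient_sub
        (((hu.isRegular.comp_smul (by linarith) hR').differentiableAt hp hy))
        (hu.isRegular.differentiableAt hpR hy)
      rw [gradient_comp_smul] at this
      rw [this, ← ENNReal.ofReal_mul (by norm_num), ← ENNReal.ofReal_mul (by positivity),
        ← ENNReal.ofReal_add (by positivity) (by positivity)]
      refine ENNReal.ofReal_le_ofReal ?_
      set x := gradient u (τ • p)
      set y := gradient u p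
      -- τ x is the gradient of u(τ·), so the first term is covered by the second order estimate,
      -- and the second has the factor τ - 1 explicitly.
      have h3 : x - y = (τ • x - y) - (τ - 1) • x := by module
      have h4 := norm_sub_le (τ • x - y) ((τ - 1) • x)
      rw [← h3, norm_smul, Real.norm_eq_abs] at h4
      have h5 : ‖x - y‖ ^ 2 ≤ (‖τ • x - y‖ + |τ - 1| * ‖x‖) ^ 2 := by gcongr
      have h6 : |τ - 1| ^ 2 = (τ - 1) ^ 2 := sq_abs _
      nlinarith [sq_nonneg (‖τ • x - y‖ - |τ - 1| * ‖x‖)]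
    have hsq : (τ - 1) ^ 2 ≤ (l - 1) ^ 2 := sq_le_sq.2 hτl
    calc _ ≤ _ := lintegral_mono_ae hd
      _ ≤ ENNReal.ofReal 2 * ENNReal.ofReal ((τ - 1) ^ 2 * K₁) +
          ENNReal.ofReal (2 * (τ - 1) ^ 2) * ENNReal.ofReal K₂ := by
        rw [lintegral_add_left ((((measurable_gradient _).norm.pow_const 2).ennreal_ofReal).const_mul
          _), lintegral_const_mul' _ _ ENNReal.ofReal_ne_top,
          lintegral_const_mul' _ _ ENNReal.ofReal_ne_top]
        gcongr
        · exact h1 τ hτε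
        · exact h2 τ hτε
      _ = ENNReal.ofReal ((τ - 1) ^ 2 * (2 * K₁ + 2 * K₂)) := by
        rw [← ENNReal.ofReal_mul (by norm_num), ← ENNReal.ofReal_mul (by positivity),
          ← ENNReal.ofReal_add (by positivity) (by positivity)]
        congr 1; ring
      _ ≤ _ := by gcongr

end

/-! ### The Rellich identity. -/

section

variable {n : ℕ} {a R : ℝ} {u : Space n → ℝ}

namespace IsProfile

variable {c : ℝ → ℝ}

lemma exists_support (hc : IsProfile R c) (hR : 0 < R) :
    ∃ ρ ∈ Ioo 0 R, ∀ r, ρ ≤ r → c r = 0 ∧ deriv c r = 0 := by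
  obtain ⟨ρ, hρ, h⟩ := hc.zero_near_R
  obtain ⟨ρ', h1, h2⟩ := exists_between (max_lt hρ hR)
  refine ⟨ρ', ⟨(le_max_right _ _).trans_lt h1, h2⟩, fun r hr => ?_⟩
  have h3 : ρ < r := ((le_max_left _ _).trans_lt h1).trans_le hr
  refine ⟨h r h3.le, ?_⟩
  have : c =ᶠ[𝓝 r] fun _ => 0 := by
    filter_upwards [Ioi_mem_nhds h3] with t ht using h t (le_of_lt ht)
  rw [this.deriv_eq, deriv_const]

lemma exists_bound (hc : IsProfile R c) (hR : 0 < R) : ∃ M, 0 ≤ M ∧ ∀ r,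
    |c r| ≤ M ∧ |deriv c r| ≤ M ∧ |deriv c r / r| ≤ M := by
  obtain ⟨ρ, hρ, h⟩ := hc.exists_support hR
  obtain ⟨s, hs, h'⟩ := hc.deriv_eq_zero
  obtain ⟨s', hs', h''⟩ := hc.const_near_zero
  obtain ⟨M₁, hM₁⟩ := (isCompact_Icc (a := 0) (b := ρ)).exists_bound_of_continuousOn
    hc.contDiff.continuous.continuousOn
  obtain ⟨M₂, hM₂⟩ := (isCompact_Icc (a := 0) (b := ρ)).exists_bound_of_continuousOn
    (hc.contDiff.continuous_deriv (by simp)).continuousOn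
  have hM₁0 : 0 ≤ M₁ := (norm_nonneg _).trans (hM₁ 0 ⟨le_rfl, hρ.1.le⟩)
  have hM₂0 : 0 ≤ M₂ := (norm_nonneg _).trans (hM₂ 0 ⟨le_rfl, hρ.1.le⟩)
  have h2 : ∀ r, |deriv c r| ≤ M₂ := fun r => by
    rcases lt_or_ge r 0 with h0 | h0
    · rw [h' r (h0.trans hs), abs_zero]; exact hM₂0
    · rcases le_or_gt r ρ with h1 | h1
      · exact hM₂ r ⟨h0, h1⟩
      · rw [(h r h1.le).2, abs_zero]; exact hM₂0
  refine ⟨M₁ + M₂ + M₂ / s, by positivity, fun r => ⟨?_, ?_, ?_⟩⟩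
  · have h3 : |c r| ≤ M₁ := by
      rcases lt_or_ge r 0 with h0 | h0
      · rw [h'' r (h0.trans hs').le]; exact hM₁ 0 ⟨le_rfl, hρ.1.le⟩
      · rcases le_or_gt r ρ with h1 | h1
        · exact hM₁ r ⟨h0, h1⟩
        · rw [(h r h1.le).1, abs_zero]; exact hM₁0
    have : 0 ≤ M₂ / s := by positivity
    linarith
  · have : 0 ≤ M₂ / s := by positivity
    linarith [h2 r]
  · have h3 : |deriv c r / r| ≤ M₂ / s := by
      rcases lt_or_ge r s with h0 | h0
      · rw [h' r h0, zero_div, abs_zero]; positivity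
      · rw [abs_div, abs_of_pos (hs.trans_le h0)]
        gcongr
        exact h2 r
    linarith

end IsProfile

/-- Differentiation under the integral sign. For m > ρ/r the function c(m‖·‖) is supported in B(r),
which is what localises the dominating function. -/
lemma hasDerivAt_integral_radial_dilation {f : Space n → ℝ} {μ : Measure (Space n)}
    (hR : 0 < R) (hf : AEStronglyMeasurable f μ)
    (hi : ∀ r < R, IntegrableOn f (Metric.ball 0 r) μ) {c : ℝ → ℝ} (hc : IsProfile R c) :
    HasDerivAt (fun m : ℝ => ∫ p, c (m * ‖p‖) * f p ∂μ)
      (∫ p, ‖p‖ * deriv c ‖p‖ * f p ∂μ) 1 := by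
  obtain ⟨ρ, hρ, h⟩ := hc.exists_support hR
  obtain ⟨M, hM0, hM⟩ := hc.exists_bound hR
  obtain ⟨r, hρr, hrR⟩ := exists_between hρ.2
  have hr0 : 0 < r := hρ.1.trans hρr
  have hs : Ioi (ρ / r) ∈ 𝓝 (1 : ℝ) := Ioi_mem_nhds ((div_lt_one hr0).2 hρr)
  have hout : ∀ m ∈ Ioi (ρ / r), ∀ p ∉ Metric.ball (0 : Space n) r, ρ ≤ m * ‖p‖ := by
    intro m hm p hp
    have hp' : r ≤ ‖p‖ := by simpa using hp
    have h1 := (div_lt_iff₀ hr0).1 hm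
    have h2 : 0 ≤ m := (div_nonneg hρ.1.le hr0.le).trans (le_of_lt hm)
    nlinarith
  have h1mem : (1 : ℝ) ∈ Ioi (ρ / r) := (div_lt_one hr0).2 hρr
  have hcc := hc.contDiff.continuous
  have hcd := hc.contDiff.continuous_deriv (by simp)
  have hb := hasDerivAt_integral_of_dominated_loc_of_deriv_le (μ := μ)
    (F := fun m p => c (m * ‖p‖) * f p)
    (F' := fun m p => ‖p‖ * deriv c (m * ‖p‖) * f p) (x₀ := 1)
    (bound := (Metric.ball (0 : Space n) r).indicator fun p => r * M * |f p|) hs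
    (Eventually.of_forall fun m =>
      (hcc.comp (continuous_const.mul continuous_norm)).aestronglyMeasurable.mul hf)
    ?_ ?_ ?_ ?_ ?_
  · simpa using hb.2
  · have : IntegrableOn (fun p => c (1 * ‖p‖) * f p) (Metric.ball 0 r) μ :=
      Integrable.bdd_mul (hi r hrR)
        (hcc.comp (continuous_const.mul continuous_norm)).aestronglyMeasurable
        (c := M) (Eventually.of_forall fun p => (hM _).1)
    refine (integrableOn_iff_integrable_of_support_subset fun p hp => ?_).1 this
    by_contra hp'
    exact hp (by simp only; rw [(h _ (hout 1 h1mem p hp')).1, zero_mul])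
  · exact (continuous_norm.mul
      (hcd.comp (continuous_const.mul continuous_norm))).aestronglyMeasurable.mul hf
  · refine Eventually.of_forall fun p m hm => ?_
    by_cases hp : p ∈ Metric.ball (0 : Space n) r
    · rw [indicator_of_mem hp, norm_mul, norm_mul, norm_norm]
      gcongr
      · exact (mem_ball_zero_iff.1 hp).le
      · exact (hM _).2.1
      · exact le_rfl
    · rw [indicator_of_notMem hp, (h _ (hout m hm p hp)).2, mul_zero, zero_mul, norm_zero]
  · rw [integrable_indicator_iff measurableSet_ball]
    exact ((hi r hrR).abs).const_mul _
  · refine Eventually.of_forall fun p m hm => ?_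
    have h2 : HasDerivAt (fun m => c (m * ‖p‖)) (deriv c (m * ‖p‖) * ‖p‖) m :=
      HasDerivAt.comp m (hc.contDiff.differentiable (by simp) _).hasDerivAt
        (by simpa using (hasDerivAt_id m).mul_const ‖p‖)
    have h3 := h2.mul_const (f p)
    rwa [mul_comm (deriv c _)] at h3

namespace IsSolution

/-- A change of variables moves the dilation from u to the smooth profile, so differentiating in l
requires no second derivatives of u. -/
lemma hasDerivAt_dilated_energy (hu : IsSolution a R u) (hR : 0 < R) {c : ℝ → ℝ}
    (hc : IsProfile R c) :
    HasDerivAt (fun l : ℝ => ∫ p, c ‖p‖ * ‖gradient (fun q => u (l • q)) p‖ ^ 2 ∂(wvol a))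
      (-((n : ℝ) + a - 1) * (∫ p, c ‖p‖ * ‖gradient u p‖ ^ 2 ∂(wvol a)) -
        ∫ p, ‖p‖ * deriv c ‖p‖ * ‖gradient u p‖ ^ 2 ∂(wvol a)) 1 := by
  have h1 := hasDerivAt_integral_radial_dilation (μ := wvol a) (f := fun p => ‖gradient u p‖ ^ 2) hR
    ((measurable_gradient u).norm.pow_const 2).aestronglyMeasurable
    (fun r hr => hu.locEnergy r hr) hc
  have h2 : HasDerivAt (fun l : ℝ => l⁻¹) (-1) 1 := by
    simpa using hasDerivAt_inv (one_ne_zero (α := ℝ))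
  have h3 := HasDerivAt.comp (1 : ℝ) (h₂ := fun m : ℝ => ∫ p, c (m * ‖p‖) * ‖gradient u p‖ ^ 2
    ∂(wvol a)) (h := fun l : ℝ => l⁻¹) (by rw [inv_one]; exact h1) h2
  have h4 := (Real.hasDerivAt_rpow_const (p := -((n : ℝ) + a - 1)) (Or.inl one_ne_zero)).mul h3
  have h5 : (fun l : ℝ => ∫ p, c ‖p‖ * ‖gradient (fun q => u (l • q)) p‖ ^ 2 ∂(wvol a)) =ᶠ[𝓝 1]
      (fun l : ℝ => l ^ (-((n : ℝ) + a - 1))) * ((fun m : ℝ => ∫ p, c (m * ‖p‖) *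
        ‖gradient u p‖ ^ 2 ∂(wvol a)) ∘ fun l : ℝ => l⁻¹) := by
    filter_upwards [Ioi_mem_nhds one_pos] with l hl
    have hl : 0 < l := hl
    simp only [Pi.mul_apply, Function.comp]
    have h6 : ∀ p : Space n, c ‖p‖ * ‖gradient (fun q => u (l • q)) p‖ ^ 2 =
        l ^ 2 * (fun q => c (l⁻¹ * ‖q‖) * ‖gradient u q‖ ^ 2) (l • p) := by
      intro p
      simp only
      rw [gradient_comp_smul, norm_smul, norm_smul, Real.norm_eq_abs, abs_of_pos hl,
        inv_mul_cancel_left₀ hl.ne']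
      ring
    rw [integral_congr_ae (Eventually.of_forall h6), integral_const_mul,
      integral_comp_smul_wvol a hl (fun q => c (l⁻¹ * ‖q‖) * ‖gradient u q‖ ^ 2), ← mul_assoc,
      ← Real.rpow_natCast, ← Real.rpow_add hl]
    congr 2
    push_cast; ring
  refine (h4.congr_of_eventuallyEq h5).congr_deriv ?_
  simp [Function.comp]
  ring

/-- A Rellich identity. -/
lemma rellich (hu : IsSolution a R u) (ha : -1 < a) (hR : 0 < R) {c : ℝ → ℝ}
    (hc : IsProfile R c) (hc0 : ∀ r, 0 ≤ c r) :
    2 * ∫ p, deriv c ‖p‖ / ‖p‖ * rad u p ^ 2 ∂(wvol a) =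
      ((n : ℝ) + a - 1) * (∫ p, c ‖p‖ * ‖gradient u p‖ ^ 2 ∂(wvol a)) +
        ∫ p, ‖p‖ * deriv c ‖p‖ * ‖gradient u p‖ ^ 2 ∂(wvol a) := by
  obtain ⟨ρ, hρ, h⟩ := hc.exists_support hR
  obtain ⟨M, hM0, hM⟩ := hc.exists_bound hR
  obtain ⟨r, hρr, hrR⟩ := exists_between hρ.2
  obtain ⟨R', hrR', hR'R⟩ := exists_between hrR
  have hr0 : 0 < r := hρ.1.trans hρr
  have hR'0 : 0 < R' := hr0.trans hrR'
  -- A slightly smaller radius leaves room for u(l·) to be defined on the support of the cutoff.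
  have hcR' : IsProfile R' c := ⟨hc.contDiff, hc.const_near_zero, ρ, hρr.trans hrR',
    fun t ht => (h t ht).1⟩
  set ε := min (1 / 4) ((R - R') / (2 * R)) with hε
  have hε0 : 0 < ε := lt_min (by norm_num) (div_pos (by linarith) (by linarith))
  have hε2 : ε < 1 / 2 := (min_le_left _ _).trans_lt (by norm_num)
  have hεR : (1 + ε) * R' < R := by
    have h1 : ε ≤ (R - R') / (2 * R) := min_le_right _ _
    rw [le_div_iff₀ (by linarith)] at h1
    nlinarith
  have hεr : (1 + ε) * r < R := lt_trans (by nlinarith) hεR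
  obtain ⟨K, hK, hT⟩ := hu.exists_lintegral_taylor_le ha hr0 hε0 hε2 hεr
  set B := Metric.ball (0 : Space n) r with hB
  have hBm : MeasurableSet B := measurableSet_ball
  have hout : ∀ p ∉ B, ρ ≤ ‖p‖ := fun p hp => by
    have : r ≤ ‖p‖ := by simpa [hB] using hp
    linarith
  set e : ℝ → ℝ := fun l => ∫ p, c ‖p‖ * ‖gradient (fun q => u (l • q)) p‖ ^ 2 ∂(wvol a) with he
  set J := ∫ p, deriv c ‖p‖ / ‖p‖ * rad u p ^ 2 ∂(wvol a) with hJ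
  have iE := hu.locEnergy r hrR
  have iZ : IntegrableOn (fun p => rad u p ^ 2) B (wvol a) := by
    refine (iE.mul_const (r ^ 2)).mono' ((measurable_rad u).pow_const 2).aestronglyMeasurable
      ((ae_restrict_iff' hBm).2 (Eventually.of_forall fun p hp => ?_))
    rw [Real.norm_eq_abs, abs_of_nonneg (sq_nonneg _)]
    refine (rad_sq_le u p).trans ?_
    gcongr
    exact (mem_ball_zero_iff.1 hp).le
  set Z := ∫ p in B, rad u p ^ 2 ∂(wvol a) with hZ
  have hkm : Measurable fun p : Space n => deriv c ‖p‖ / ‖p‖ :=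
    ((hc.contDiff.continuous_deriv (by simp)).measurable.comp measurable_norm).div measurable_norm
  have iJ : IntegrableOn (fun p => deriv c ‖p‖ / ‖p‖ * rad u p ^ 2) B (wvol a) :=
    Integrable.bdd_mul iZ hkm.aestronglyMeasurable (c := M)
      (Eventually.of_forall fun p => (hM _).2.2)
  have hJB : J = ∫ p in B, deriv c ‖p‖ / ‖p‖ * rad u p ^ 2 ∂(wvol a) :=
    (setIntegral_eq_integral_of_forall_compl_eq_zero fun p hp => by
      rw [(h _ (hout p hp)).2, zero_div, zero_mul]).symm
  have heB : ∀ l, e l = ∫ p in B, c ‖p‖ * ‖gradient (fun q => u (l • q)) p‖ ^ 2 ∂(wvol a) :=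
    fun l => (setIntegral_eq_integral_of_forall_compl_eq_zero fun p hp => by
      rw [(h _ (hout p hp)).1, zero_mul]).symm
  -- The pairing of u with c(u(l·) - u) is nonnegative. Its part with c is estimated by ⟨∇u, ∇u_l⟩ -
  -- |∇u|² ≤ (|∇u_l|² - |∇u|²)/2, where u_l = u(l·). Its part with ∇c is (l - 1)J up to the Taylor
  -- error.
  have key : ∀ l, |l - 1| ≤ ε → l ≠ 1 →
      0 ≤ 1 / 2 * (e l - e 1) + (l - 1) * J + (l - 1) ^ 2 * (M * (K + Z) / 2) := by
    intro l hl hl1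
    obtain ⟨l1, l2⟩ := abs_le.1 hl
    have hl0 : 0 < l := by linarith
    have hlR : l * R' ≤ R := by nlinarith
    have hχ := hcR'.isCutoff (n := n)
    have hv1 := hu.isRegular.comp_smul hl0 hlR
    have hv := hv1.sub (hu.isRegular.mono hR'R.le)
    have hpos := hu.pairing_cutoff_dilation_nonneg ha hR'0 hR'R.le hl0 hlR hχ fun p => hc0 _
    rw [← hu.pairing_cutoff_dilation_sub ha hR'0 hR'R.le hl0 hlR hχ] at hpos
    have ht := (hχ.isTest_mul ha hR'0 hv).mono hR'R.le
    have i0 := hu.locEnergy.integrable_inner hR ht.tsupport_subset ht.energy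
    have hpB : pairing a u (fun p => c ‖p‖ * (u (l • p) - u p)) = ∫ p in B,
        inner ℝ (gradient u p) (gradient (fun p => c ‖p‖ * (u (l • p) - u p)) p) ∂(wvol a) := by
      refine (setIntegral_eq_integral_of_forall_compl_eq_zero fun p hp => ?_).symm
      suffices hz : p ∉ tsupport fun p : Space n => c ‖p‖ * (u (l • p) - u p) by
        rw [gradient_eq_zero_of_notMem_tsupport hz, inner_zero_right]
      intro hp'
      have : tsupport (fun p : Space n => c ‖p‖ * (u (l • p) - u p)) ⊆ Metric.closedBall 0 ρ := by
        refine closure_minimal (fun q hq => ?_) Metric.isClosed_closedBall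
        rw [mem_closedBall_zero_iff]
        by_contra! hq'
        exact hq (by simp only; rw [(h _ hq'.le).1, zero_mul])
      have := mem_closedBall_zero_iff.1 (this hp')
      exact hp (mem_ball_zero_iff.2 (by linarith))
    have i1 : IntegrableOn (fun p => c ‖p‖ * ‖gradient (fun q => u (l • q)) p‖ ^ 2) B (wvol a) :=
      Integrable.bdd_mul (hv1.energy r hrR') hχ.contDiff.continuous.aestronglyMeasurable (c := M)
        (Eventually.of_forall fun p => (hM _).1)
    have i2 : IntegrableOn (fun p => c ‖p‖ * ‖gradient u p‖ ^ 2) B (wvol a) :=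
      Integrable.bdd_mul iE hχ.contDiff.continuous.aestronglyMeasurable (c := M)
        (Eventually.of_forall fun p => (hM _).1)
    obtain ⟨i3, hK3⟩ := integrable_sq_of_lintegral_le
      (((hv.continuousOn.mono (Metric.ball_subset_ball hrR'.le)).aestronglyMeasurable
        hBm).sub ((measurable_rad u).aestronglyMeasurable.const_mul (l - 1)))
      (by positivity) (hT l hl)
    simp only [Pi.sub_apply] at i3 hK3
    have hl2 : 0 < (l - 1) ^ 2 := by
      have := sub_ne_zero.2 hl1; positivity
    have hle : ∀ᵐ p ∂((wvol a).restrict B),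
        inner ℝ (gradient u p) (gradient (fun p => c ‖p‖ * (u (l • p) - u p)) p) ≤
        1 / 2 * (c ‖p‖ * ‖gradient (fun q => u (l • q)) p‖ ^ 2) -
          1 / 2 * (c ‖p‖ * ‖gradient u p‖ ^ 2) +
          (l - 1) * (deriv c ‖p‖ / ‖p‖ * rad u p ^ 2) +
          M / (2 * (l - 1) ^ 2) * (u (l • p) - u p - (l - 1) * rad u p) ^ 2 +
          M * (l - 1) ^ 2 / 2 * rad u p ^ 2 := by
      refine (ae_restrict_iff' hBm).2 ?_
      filter_upwards [ae_wvol_yCoord_ne_zero a] with p hy hp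
      have hpR' := Metric.ball_subset_ball hrR'.le hp
      have hpR := Metric.ball_subset_ball hR'R.le hpR'
      have d1 := hv1.differentiableAt hpR' hy
      have d2 := hu.isRegular.differentiableAt hpR hy
      have d3 := hv.differentiableAt hpR' hy
      rw [gradient_mul (hχ.contDiff.differentiable (by simp) p) d3, gradient_sub d1 d2,
        hc.gradient_radial, inner_add_right, inner_smul_right, inner_smul_right, inner_smul_right,
        inner_sub_right, real_inner_self_eq_norm_sq]
      have hr : inner ℝ (gradient u p) p = rad u p := rfl
      rw [hr]
      have e1 := norm_sub_sq_real (gradient u p) (gradient (fun q => u (l • q)) p)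
      have e2 := sq_nonneg ‖gradient u p - gradient (fun q => u (l • q)) p‖
      have e3 : c ‖p‖ * (inner ℝ (gradient u p) (gradient (fun q => u (l • q)) p) -
          ‖gradient u p‖ ^ 2) ≤ 1 / 2 * (c ‖p‖ * ‖gradient (fun q => u (l • q)) p‖ ^ 2) -
          1 / 2 * (c ‖p‖ * ‖gradient u p‖ ^ 2) := by
        have := hc0 ‖p‖
        nlinarith
      have e4 := (hM ‖p‖).2.2
      set k := deriv c ‖p‖ / ‖p‖
      set z := rad u p
      set D := u (l • p) - u p
      have e5 : D * (k * z) = (l - 1) * (k * z ^ 2) + k * ((D - (l - 1) * z) * z) := by ring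
      have e6 : k * ((D - (l - 1) * z) * z) ≤ M * |(D - (l - 1) * z) * z| :=
        (le_abs_self _).trans (by rw [abs_mul]; gcongr)
      -- The weight (l - 1)² in Young's inequality is dictated by the Taylor error: its square
      -- integrates to O((l - 1)⁴), so both terms become O((l - 1)²).
      have e7 : |(D - (l - 1) * z) * z| ≤ 1 / (2 * (l - 1) ^ 2) * (D - (l - 1) * z) ^ 2 +
          (l - 1) ^ 2 / 2 * z ^ 2 := by
        have h8 : 0 ≤ (|D - (l - 1) * z| - (l - 1) ^ 2 * |z|) ^ 2 / (2 * (l - 1) ^ 2) := by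
          positivity
        have h9 : (|D - (l - 1) * z| - (l - 1) ^ 2 * |z|) ^ 2 / (2 * (l - 1) ^ 2) =
            1 / (2 * (l - 1) ^ 2) * |D - (l - 1) * z| ^ 2 + (l - 1) ^ 2 / 2 * |z| ^ 2 -
            |D - (l - 1) * z| * |z| := by
          field_simp; ring
        rw [h9, sq_abs, sq_abs] at h8
        rw [abs_mul]; linarith
      have e8 : M * |(D - (l - 1) * z) * z| ≤ M / (2 * (l - 1) ^ 2) * (D - (l - 1) * z) ^ 2 +
          M * (l - 1) ^ 2 / 2 * z ^ 2 := by
        refine (mul_le_mul_of_nonneg_left e7 hM0).trans (le_of_eq ?_)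
        ring
      linarith
    rw [hpB] at hpos
    have hint := hpos.trans (integral_mono_ae i0.integrableOn (((((i1.const_mul _).sub
      (i2.const_mul _)).add (iJ.const_mul _)).add (i3.const_mul _)).add (iZ.const_mul _)) hle)
    rw [integral_add' ((((i1.const_mul _).sub
      (i2.const_mul _)).add (iJ.const_mul _)).add (i3.const_mul _)) (iZ.const_mul _),
      integral_add' (((i1.const_mul _).sub
      (i2.const_mul _)).add (iJ.const_mul _)) (i3.const_mul _),
      integral_add' ((i1.const_mul _).sub (i2.const_mul _)) (iJ.const_mul _),
      integral_sub' (i1.const_mul _) (i2.const_mul _)] at hint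
    simp only [integral_const_mul] at hint
    rw [← heB, ← hJB, ← hZ] at hint
    have he1 : ∫ p in B, c ‖p‖ * ‖gradient u p‖ ^ 2 ∂(wvol a) = e 1 := by
      rw [heB]; simp only [one_smul]
    rw [he1] at hint
    have h10 : M / (2 * (l - 1) ^ 2) * ∫ p in B, (u (l • p) - u p - (l - 1) * rad u p) ^ 2
        ∂(wvol a) ≤ M / (2 * (l - 1) ^ 2) * ((l - 1) ^ 4 * K) := by gcongr
    have h11 : M / (2 * (l - 1) ^ 2) * ((l - 1) ^ 4 * K) = (l - 1) ^ 2 * (M * K / 2) := by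
      field_simp
    rw [h11] at h10
    linarith
  have hd1 := hu.hasDerivAt_dilated_energy hR hc
  have hd := ((hd1.sub_const (e 1)).const_mul (1 / 2)).add
    (((((hasDerivAt_id (1 : ℝ)).sub_const 1).mul_const J)).add
      ((((hasDerivAt_id (1 : ℝ)).sub_const 1).pow 2).mul_const (M * (K + Z) / 2)))
  -- The upper bound vanishes at l = 1 and is nonnegative on both sides of it. An inequality valid
  -- on both sides forces the derivative to vanish, which gives an equality.
  have hmin : IsLocalMin ((fun l => 1 / 2 * (e l - e 1)) + ((fun l : ℝ => (id l - 1) * J) +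
      fun l : ℝ => ((fun l : ℝ => id l - 1) ^ 2) l * (M * (K + Z) / 2))) 1 := by
    filter_upwards [Metric.closedBall_mem_nhds (1 : ℝ) hε0] with l hl
    rw [Metric.mem_closedBall, Real.dist_eq] at hl
    rcases eq_or_ne l 1 with rfl | hl1
    · exact le_rfl
    · have := key l hl hl1
      simp only [Pi.add_apply, Pi.pow_apply, id]
      simp only [sub_self]
      linarith
  have h0 := hmin.hasDerivAt_eq_zero hd
  simp at h0
  linarith

end IsSolution

end

/-! ### Polar coordinates for the weighted measure. -/

section

variable {n : ℕ} {a R : ℝ} {u : Space n → ℝ}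

/-- The weighted surface measure `|y|^a dσ` on the unit sphere. -/
def sph (a : ℝ) : Measure (Metric.sphere (0 : Space n) 1) :=
  (volume : Measure (Space n)).toSphere.withDensity fun ζ => ENNReal.ofReal (weight a (ζ : Space n))

instance : SFinite (sph a : Measure (Metric.sphere (0 : Space n) 1)) := by
  unfold sph; infer_instance

/-- The integral of `F(r ·)` over the unit sphere, with respect to the weighted surface measure. -/
def sphInt (a : ℝ) (F : Space n → ℝ) (r : ℝ) : ℝ :=
  ∫ ζ : Metric.sphere (0 : Space n) 1, F (r • (ζ : Space n)) ∂(sph a)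

lemma measurable_smul_sphere :
    Measurable fun z : Metric.sphere (0 : Space n) 1 × ℝ => z.2 • (z.1 : Space n) :=
  measurable_snd.smul (measurable_subtype_coe.comp measurable_fst)

lemma lintegral_polar {G : Space n → ENNReal} (hG : Measurable G) :
    ∫⁻ p, G p = ∫⁻ ζ : Metric.sphere (0 : Space n) 1, (∫⁻ r in Ioi (0 : ℝ),
      ENNReal.ofReal (r ^ n) * G (r • (ζ : Space n))) ∂(volume : Measure (Space n)).toSphere := by
  have hH : Measurable fun z : Metric.sphere (0 : Space n) 1 × Ioi (0 : ℝ) =>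
      G ((z.2 : ℝ) • (z.1 : Space n)) :=
    hG.comp ((measurable_subtype_coe.comp measurable_snd).smul
      (measurable_subtype_coe.comp measurable_fst))
  calc ∫⁻ p, G p = ∫⁻ p : ({0}ᶜ : Set (Space n)), G p ∂(volume.comap Subtype.val) := by
        rw [lintegral_subtype_comap (measurableSet_singleton _).compl, restrict_compl_singleton]
    _ = ∫⁻ z : Metric.sphere (0 : Space n) 1 × Ioi (0 : ℝ), G ((z.2 : ℝ) • (z.1 : Space n))
          ∂((volume : Measure (Space n)).toSphere.prod (Measure.volumeIoiPow n)) := by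
        have h1 := (volume : Measure (Space n)).measurePreserving_homeomorphUnitSphereProd
        rw [finrank_euclideanSpace, Fintype.card_fin, Nat.add_sub_cancel] at h1
        rw [← h1.lintegral_comp hH]
        refine lintegral_congr fun p => ?_
        congr 1
        have hp : ‖(p : Space n)‖ ≠ 0 := norm_ne_zero_iff.2 p.2
        simp [smul_smul, hp]
    _ = _ := by
        rw [lintegral_prod _ hH.aemeasurable]
        refine lintegral_congr fun ζ => ?_
        have hHζ : Measurable fun r : Ioi (0 : ℝ) => G ((r : ℝ) • (ζ : Space n)) :=
          hH.comp measurable_prodMk_left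
        refine (lintegral_withDensity_eq_lintegral_mul _
          ((measurable_subtype_coe.pow_const n).ennreal_ofReal) hHζ).trans ?_
        exact lintegral_subtype_comap measurableSet_Ioi fun r : ℝ =>
          ENNReal.ofReal (r ^ n) * G (r • (ζ : Space n))

lemma lintegral_wvol_polar (a : ℝ) {F : Space n → ENNReal} (hF : Measurable F) :
    ∫⁻ p, F p ∂(wvol a) = ∫⁻ z : Metric.sphere (0 : Space n) 1 × ℝ,
      ENNReal.ofReal (z.2 ^ ((n : ℝ) + a)) * F (z.2 • (z.1 : Space n))
        ∂((sph a).prod (volume.restrict (Ioi 0))) := by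
  have hK : Measurable fun z : Metric.sphere (0 : Space n) 1 × ℝ =>
      ENNReal.ofReal (z.2 ^ ((n : ℝ) + a)) * F (z.2 • (z.1 : Space n)) :=
    ((measurable_snd.pow_const _).ennreal_ofReal).mul (hF.comp measurable_smul_sphere)
  have hw : Measurable fun ζ : Metric.sphere (0 : Space n) 1 =>
      ENNReal.ofReal (weight a (ζ : Space n)) :=
    ((measurable_weight a).comp measurable_subtype_coe).ennreal_ofReal
  have hG : Measurable fun p : Space n => ENNReal.ofReal (weight a p) * F p :=
    (measurable_weight a).ennreal_ofReal.mul hF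
  rw [lintegral_wvol, lintegral_polar hG,
    lintegral_prod _ hK.aemeasurable, sph,
    lintegral_withDensity_eq_lintegral_mul _ hw (Measurable.lintegral_prod_right' hK)]
  refine lintegral_congr fun ζ => ?_
  rw [Pi.mul_apply, ← lintegral_const_mul' _ _ ENNReal.ofReal_ne_top]
  refine setLIntegral_congr_fun measurableSet_Ioi fun r hr => ?_
  have hr : 0 < r := hr
  simp only
  rw [weight_smul a hr, Real.rpow_add hr, Real.rpow_natCast,
    ENNReal.ofReal_mul (by positivity), ENNReal.ofReal_mul (by positivity)]
  ring

/-- Lebesgue measure gives r^n, homogeneity of the weight gives r^a, and the angular part of the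
weight is absorbed in `sph`. In the form of a push-forward, polar coordinates transfer null sets and
integrability as well as integrals. -/
lemma map_smul_sphere (a : ℝ) : Measure.map
    (fun z : Metric.sphere (0 : Space n) 1 × ℝ => z.2 • (z.1 : Space n))
      (((sph a).prod (volume.restrict (Ioi 0))).withDensity
        fun z => ENNReal.ofReal (z.2 ^ ((n : ℝ) + a))) = wvol a := by
  ext s hs
  have hm := measurable_smul_sphere (n := n) hs
  rw [Measure.map_apply measurable_smul_sphere hs, withDensity_apply _ hm,
    ← lintegral_indicator_one (μ := wvol a) hs,
    lintegral_wvol_polar a (measurable_one.indicator hs), ← lintegral_indicator hm]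
  refine lintegral_congr fun z => ?_
  by_cases h : z.2 • (z.1 : Space n) ∈ s
  · rw [indicator_of_mem (by exact h), indicator_of_mem h]; simp
  · rw [indicator_of_notMem (by exact h), indicator_of_notMem h]; simp

lemma integrable_polar {F : Space n → ℝ} (hF : Integrable F (wvol a)) :
    Integrable (fun z : Metric.sphere (0 : Space n) 1 × ℝ =>
      z.2 ^ ((n : ℝ) + a) * F (z.2 • (z.1 : Space n)))
      ((sph a).prod (volume.restrict (Ioi 0))) := by
  have hm : Measurable fun z : Metric.sphere (0 : Space n) 1 × ℝ =>
      ENNReal.ofReal (z.2 ^ ((n : ℝ) + a)) := (measurable_snd.pow_const _).ennreal_ofReal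
  have hF1 := hF.1
  rw [← map_smul_sphere, integrable_map_measure (by rw [map_smul_sphere]; exact hF1)
    measurable_smul_sphere.aemeasurable, integrable_withDensity_iff_integrable_smul' hm
    (Eventually.of_forall fun z => ENNReal.ofReal_lt_top)] at hF
  refine hF.congr ?_
  have h1 : ∀ᵐ z ∂((sph a).prod (volume.restrict (Ioi 0)) :
      Measure (Metric.sphere (0 : Space n) 1 × ℝ)), z.2 ∈ Ioi (0 : ℝ) :=
    Measure.quasiMeasurePreserving_snd.ae (ae_restrict_mem measurableSet_Ioi)
  filter_upwards [h1] with z hz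
  have hz : 0 < z.2 := hz
  rw [ENNReal.toReal_ofReal (by positivity), smul_eq_mul]
  rfl

lemma integral_wvol_polar {F : Space n → ℝ} (hF : Integrable F (wvol a)) :
    ∫ p, F p ∂(wvol a) = ∫ r in Ioi (0 : ℝ), r ^ ((n : ℝ) + a) * sphInt a F r := by
  have hm : Measurable fun z : Metric.sphere (0 : Space n) 1 × ℝ =>
      ENNReal.ofReal (z.2 ^ ((n : ℝ) + a)) := (measurable_snd.pow_const _).ennreal_ofReal
  have hi := integrable_polar hF
  have h1 : ∀ᵐ z ∂((sph a).prod (volume.restrict (Ioi 0)) :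
      Measure (Metric.sphere (0 : Space n) 1 × ℝ)), z.2 ∈ Ioi (0 : ℝ) :=
    Measure.quasiMeasurePreserving_snd.ae (ae_restrict_mem measurableSet_Ioi)
  calc ∫ p, F p ∂(wvol a) = ∫ z : Metric.sphere (0 : Space n) 1 × ℝ,
        z.2 ^ ((n : ℝ) + a) * F (z.2 • (z.1 : Space n))
        ∂((sph a).prod (volume.restrict (Ioi 0))) := by
        rw [← map_smul_sphere, integral_map measurable_smul_sphere.aemeasurable
          (by rw [map_smul_sphere]; exact hF.1), integral_withDensity_eq_integral_toReal_smul hm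
          (Eventually.of_forall fun z => ENNReal.ofReal_lt_top)]
        refine integral_congr_ae ?_
        filter_upwards [h1] with z hz
        have hz : 0 < z.2 := hz
        rw [ENNReal.toReal_ofReal (by positivity), smul_eq_mul]
    _ = _ := by
        rw [integral_prod_symm _ hi]
        simp only [integral_const_mul, sphInt]

lemma integrableOn_sphInt {F : Space n → ℝ} (hF : Integrable F (wvol a)) :
    IntegrableOn (fun r => r ^ ((n : ℝ) + a) * sphInt a F r) (Ioi 0) := by
  have := (integrable_polar hF).integral_prod_right
  simpa only [integral_const_mul, sphInt, IntegrableOn] using this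

lemma ae_integrable_sphere {F : Space n → ℝ} (hF : Integrable F (wvol a)) :
    ∀ᵐ r : ℝ, 0 < r → Integrable
      (fun ζ : Metric.sphere (0 : Space n) 1 => F (r • (ζ : Space n))) (sph a) := by
  have := (integrable_polar hF).prod_left_ae
  rw [ae_restrict_iff' measurableSet_Ioi] at this
  filter_upwards [this] with r hr hr0
  have h := (hr hr0).const_mul (r ^ ((n : ℝ) + a))⁻¹
  have hne : r ^ ((n : ℝ) + a) ≠ 0 := (Real.rpow_pos_of_pos hr0 _).ne'
  simpa only [inv_mul_cancel_left₀ hne] using h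

lemma smul_sphere_mem_ball {r ρ : ℝ} (hr : 0 < r) (ζ : Metric.sphere (0 : Space n) 1) :
    r • (ζ : Space n) ∈ Metric.ball (0 : Space n) ρ ↔ r < ρ := by
  rw [mem_ball_zero_iff, norm_smul, norm_eq_of_mem_sphere ζ, mul_one, Real.norm_eq_abs,
    abs_of_pos hr]

lemma norm_smul_sphere {r : ℝ} (hr : 0 ≤ r) (ζ : Metric.sphere (0 : Space n) 1) :
    ‖r • (ζ : Space n)‖ = r := by
  rw [norm_smul, norm_eq_of_mem_sphere ζ, mul_one, Real.norm_eq_abs, abs_of_nonneg hr]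

lemma sphInt_indicator {F : Space n → ℝ} {r ρ : ℝ} (hr : 0 < r) :
    sphInt a ((Metric.ball (0 : Space n) ρ).indicator F) r = (Iio ρ).indicator (sphInt a F) r := by
  by_cases h : r < ρ
  · rw [indicator_of_mem (by exact h), sphInt, sphInt]
    congr 1; ext ζ
    rw [indicator_of_mem ((smul_sphere_mem_ball hr ζ).2 h)]
  · rw [indicator_of_notMem (by exact h), sphInt]
    refine integral_eq_zero_of_ae (Eventually.of_forall fun ζ => ?_)
    simp only [Pi.zero_apply]
    rw [indicator_of_notMem fun h' => h ((smul_sphere_mem_ball hr ζ).1 h')]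

lemma integrableOn_sphInt_Ioo {F : Space n → ℝ} {ρ : ℝ}
    (hF : IntegrableOn F (Metric.ball 0 ρ) (wvol a)) :
    IntegrableOn (fun r => r ^ ((n : ℝ) + a) * sphInt a F r) (Ioo 0 ρ) := by
  rw [← integrable_indicator_iff measurableSet_ball] at hF
  refine ((integrableOn_sphInt hF).mono_set Ioo_subset_Ioi_self).congr_fun (fun r hr => ?_)
    measurableSet_Ioo
  simp only
  rw [sphInt_indicator hr.1, indicator_of_mem (by exact hr.2)]

lemma ae_integrable_sphere_Ioo {F : Space n → ℝ} {ρ : ℝ}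
    (hF : IntegrableOn F (Metric.ball 0 ρ) (wvol a)) :
    ∀ᵐ r : ℝ, r ∈ Ioo 0 ρ → Integrable
      (fun ζ : Metric.sphere (0 : Space n) 1 => F (r • (ζ : Space n))) (sph a) := by
  rw [← integrable_indicator_iff measurableSet_ball] at hF
  filter_upwards [ae_integrable_sphere hF] with r hr hr0
  refine (hr hr0.1).congr (Eventually.of_forall fun ζ => ?_)
  simp only
  rw [indicator_of_mem ((smul_sphere_mem_ball hr0.1 ζ).2 hr0.2)]

lemma setIntegral_ball_polar {F : Space n → ℝ} {ρ : ℝ} (hρ : 0 ≤ ρ)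
    (hF : IntegrableOn F (Metric.ball 0 ρ) (wvol a)) :
    ∫ p in Metric.ball 0 ρ, F p ∂(wvol a) =
      ∫ r in (0 : ℝ)..ρ, r ^ ((n : ℝ) + a) * sphInt a F r := by
  rw [← integrable_indicator_iff measurableSet_ball] at hF
  rw [← integral_indicator measurableSet_ball, integral_wvol_polar hF,
    intervalIntegral.integral_of_le hρ, integral_Ioc_eq_integral_Ioo]
  rw [← integral_indicator measurableSet_Ioi, ← integral_indicator measurableSet_Ioo]
  congr 1; ext r
  by_cases h : 0 < r
  · rw [indicator_of_mem (by exact h), sphInt_indicator h]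
    by_cases h' : r < ρ
    · rw [indicator_of_mem (by exact h'), indicator_of_mem (by exact ⟨h, h'⟩)]
    · rw [indicator_of_notMem (by exact h'), indicator_of_notMem (by exact fun h'' => h' h''.2),
        mul_zero]
  · rw [indicator_of_notMem (by exact h), indicator_of_notMem (by exact fun h'' => h h''.1)]

lemma integral_radial_mul_polar {F : Space n → ℝ} {k : ℝ → ℝ}
    (hF : Integrable (fun p => k ‖p‖ * F p) (wvol a)) :
    ∫ p, k ‖p‖ * F p ∂(wvol a) =
      ∫ r in Ioi (0 : ℝ), k r * (r ^ ((n : ℝ) + a) * sphInt a F r) := by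
  rw [integral_wvol_polar hF]
  refine setIntegral_congr_fun measurableSet_Ioi fun r hr => ?_
  have h : ∀ ζ : Metric.sphere (0 : Space n) 1, k ‖r • (ζ : Space n)‖ * F (r • (ζ : Space n)) =
      k r * F (r • (ζ : Space n)) := fun ζ => by rw [norm_smul_sphere (le_of_lt hr)]
  simp only [sphInt]
  simp_rw [h]
  rw [integral_const_mul, mul_left_comm]

/-- {y = 0} is a null cone, so by Fubini its trace on the unit sphere is null. -/
lemma ae_sph_yCoord_ne_zero (a : ℝ) :
    ∀ᵐ ζ : Metric.sphere (0 : Space n) 1 ∂(sph a), yCoord (ζ : Space n) ≠ 0 := by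
  have h0 := ae_wvol_yCoord_ne_zero (n := n) a
  rw [← map_smul_sphere] at h0
  have h1 := ae_of_ae_map measurable_smul_sphere.aemeasurable h0
  rw [ae_withDensity_iff ((measurable_snd.pow_const _).ennreal_ofReal)] at h1
  have h2 : ∀ᵐ z ∂((sph a).prod (volume.restrict (Ioi 0)) :
      Measure (Metric.sphere (0 : Space n) 1 × ℝ)), z.2 ∈ Ioi (0 : ℝ) :=
    Measure.quasiMeasurePreserving_snd.ae (ae_restrict_mem measurableSet_Ioi)
  have h3 : ∀ᵐ z ∂((sph a).prod (volume.restrict (Ioi 0)) :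
      Measure (Metric.sphere (0 : Space n) 1 × ℝ)), yCoord (z.1 : Space n) ≠ 0 := by
    filter_upwards [h1, h2] with z hz hz0 hy
    have hz0 : 0 < z.2 := hz0
    refine hz ?_ (by rw [yCoord_smul, hy, mul_zero])
    simpa using Real.rpow_pos_of_pos hz0 _
  have : (volume.restrict (Ioi (0 : ℝ))) ≠ 0 := by
    rw [Ne, Measure.restrict_eq_zero]; simp
  have : (ae (volume.restrict (Ioi (0 : ℝ)))).NeBot := ae_neBot.2 this
  filter_upwards [Measure.ae_ae_of_ae_prod h3] with ζ hζ using eventually_const.1 hζ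

/-- The constant 1 is integrable on the unit ball, hence by Fubini on almost every sphere inside it;
one such sphere is enough. -/
lemma sph_univ_lt_top (ha : -1 < a) : sph a (univ : Set (Metric.sphere (0 : Space n) 1)) < ⊤ := by
  have h1 : Integrable ((Metric.ball (0 : Space n) 1).indicator fun _ => (1 : ℝ)) (wvol a) := by
    rw [integrable_indicator_iff measurableSet_ball]
    exact integrableOn_const (wvol_slab_inter_ball_lt_top ha 1).ne
  have h2 := ae_integrable_sphere h1
  have h3 : ∀ᵐ r : ℝ ∂(volume.restrict (Ioo (0 : ℝ) 1)), r ∈ Ioo (0 : ℝ) 1 ∧ Integrable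
      (fun ζ : Metric.sphere (0 : Space n) 1 => (Metric.ball (0 : Space n) 1).indicator
        (fun _ => (1 : ℝ)) (r • (ζ : Space n))) (sph a) := by
    rw [ae_restrict_iff' measurableSet_Ioo]
    filter_upwards [h2] with r hr h using ⟨h, hr h.1⟩
  have : (volume.restrict (Ioo (0 : ℝ) 1)) ≠ 0 := by
    rw [Ne, Measure.restrict_eq_zero]; simp
  have : (ae (volume.restrict (Ioo (0 : ℝ) 1))).NeBot := ae_neBot.2 this
  obtain ⟨r, hr, hi⟩ := h3.exists
  have h4 : Integrable (fun _ : Metric.sphere (0 : Space n) 1 => (1 : ℝ)) (sph a) := by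
    refine hi.congr (Eventually.of_forall fun ζ => ?_)
    simp only
    rw [indicator_of_mem ((smul_sphere_mem_ball hr.1 ζ).2 hr.2)]
  exact ((integrable_const_iff_isFiniteMeasure one_ne_zero).1 h4).measure_univ_lt_top

lemma sphereIntegral_mul_weight {r : ℝ} (hr : 0 < r) (F : Space n → ℝ) :
    sphereIntegral r (fun p => F p * weight a p) = r ^ ((n : ℝ) + a) * sphInt a F r := by
  have hm : Measurable fun ζ : Metric.sphere (0 : Space n) 1 =>
      ENNReal.ofReal (weight a (ζ : Space n)) :=
    ((measurable_weight a).comp measurable_subtype_coe).ennreal_ofReal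
  rw [sphereIntegral, sphInt, sph, integral_withDensity_eq_integral_toReal_smul hm
    (Eventually.of_forall fun z => ENNReal.ofReal_lt_top), Real.rpow_add hr, Real.rpow_natCast,
    mul_assoc, ← integral_const_mul (r ^ a)]
  congr 2; ext ζ
  rw [weight_smul a hr, ENNReal.toReal_ofReal (weight_nonneg _ _), smul_eq_mul]
  ring

end

/-! ### Calculus on spheres and radial profiles. -/

section

variable {n : ℕ} {a R : ℝ} {u : Space n → ℝ}

lemma isFiniteMeasure_sph (ha : -1 < a) :
    IsFiniteMeasure (sph a : Measure (Metric.sphere (0 : Space n) 1)) := ⟨sph_univ_lt_top ha⟩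

namespace IsRegular

variable {v : Space n → ℝ}

lemma continuous_sphere (hv : IsRegular a R v) {r : ℝ} (hr : r ∈ Ioo 0 R) :
    Continuous fun ζ : Metric.sphere (0 : Space n) 1 => v (r • (ζ : Space n)) :=
  hv.continuousOn.comp_continuous (continuous_subtype_val.const_smul r)
    fun ζ => (smul_sphere_mem_ball hr.1 ζ).2 hr.2

lemma integrable_sphere (ha : -1 < a) (hv : IsRegular a R v) {r : ℝ} (hr : r ∈ Ioo 0 R)
    {g : Metric.sphere (0 : Space n) 1 → ℝ} (hg : Measurable g) {C : ℝ} (hC : ∀ ζ, |g ζ| ≤ C) :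
    Integrable (fun ζ : Metric.sphere (0 : Space n) 1 => v (r • (ζ : Space n)) * g ζ) (sph a) := by
  have := isFiniteMeasure_sph (n := n) ha
  obtain ⟨M, -, hM⟩ := hv.exists_bound hr.2
  refine Integrable.of_bound
    ((hv.continuous_sphere hr).aestronglyMeasurable.mul hg.aestronglyMeasurable) (M * C)
    (Eventually.of_forall fun ζ => ?_)
  have h1 := hM (r • (ζ : Space n))
    (by rw [mem_closedBall_zero_iff, norm_smul_sphere hr.1.le])
  rw [norm_mul, Real.norm_eq_abs, Real.norm_eq_abs]
  exact mul_le_mul h1 (hC ζ) (abs_nonneg _) ((abs_nonneg _).trans h1)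

lemma integrable_ray (ha : -1 < a) (hR : 0 < R) (hv : IsRegular a R v) {r₁ r₂ : ℝ} (h0 : 0 < r₁)
    (h2 : r₂ < R) {g : Metric.sphere (0 : Space n) 1 → ℝ} (hg : Measurable g) {C : ℝ}
    (hC : ∀ ζ, |g ζ| ≤ C) :
    Integrable (fun z : Metric.sphere (0 : Space n) 1 × ℝ =>
      inner ℝ (gradient v (z.2 • (z.1 : Space n))) (z.1 : Space n) * g z.1)
      ((sph a).prod (volume.restrict (Ioc r₁ r₂))) := by
  have h3 : Integrable ((Metric.closedBall (0 : Space n) r₂).indicator fun p => ‖gradient v p‖)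
      (wvol a) := by
    rw [integrable_indicator_iff Metric.isClosed_closedBall.measurableSet]
    exact hv.energy.integrableOn_norm ha hR (isCompact_closedBall _ _)
      (Metric.closedBall_subset_ball h2)
  have h4 := (integrable_polar h3).mono_measure (Measure.prod_mono (le_refl (sph a))
    (Measure.restrict_mono (fun r hr => h0.trans hr.1 : Ioc r₁ r₂ ⊆ Ioi 0) le_rfl))
  set s := (n : ℝ) + a
  -- A lower bound for r^s on [r₁, r₂] whatever the sign of the exponent.
  set c := min (r₁ ^ s) (r₂ ^ s) with hc
  have hm : Measurable fun z : Metric.sphere (0 : Space n) 1 × ℝ =>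
      inner ℝ (gradient v (z.2 • (z.1 : Space n))) (z.1 : Space n) * g z.1 :=
    (((measurable_gradient v).comp measurable_smul_sphere).inner
      (measurable_subtype_coe.comp measurable_fst)).mul (hg.comp measurable_fst)
  refine (h4.const_mul (C * c⁻¹)).mono' hm.aestronglyMeasurable ?_
  have h5 : ∀ᵐ z ∂((sph a).prod (volume.restrict (Ioc r₁ r₂)) :
      Measure (Metric.sphere (0 : Space n) 1 × ℝ)), z.2 ∈ Ioc r₁ r₂ :=
    Measure.quasiMeasurePreserving_snd.ae (ae_restrict_mem measurableSet_Ioc)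
  filter_upwards [h5] with z hz
  have hz0 : 0 < z.2 := h0.trans hz.1
  have hc0 : 0 < c := lt_min (by positivity) (Real.rpow_pos_of_pos (hz0.trans_le hz.2) _)
  have h6 : c ≤ z.2 ^ s := by
    rcases le_or_gt 0 s with hs | hs
    · exact (min_le_left _ _).trans (Real.rpow_le_rpow h0.le hz.1.le hs)
    · exact (min_le_right _ _).trans (Real.rpow_le_rpow_of_nonpos hz0 hz.2 hs.le)
  have hC0 : 0 ≤ C := (abs_nonneg _).trans (hC z.1)
  rw [indicator_of_mem (by rw [mem_closedBall_zero_iff, norm_smul_sphere hz0.le]; exact hz.2),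
    norm_mul, Real.norm_eq_abs, Real.norm_eq_abs]
  have h7 := abs_real_inner_le_norm (gradient v (z.2 • (z.1 : Space n))) (z.1 : Space n)
  rw [norm_eq_of_mem_sphere z.1, mul_one] at h7
  have h8 : 1 ≤ c⁻¹ * z.2 ^ s := by rw [inv_mul_eq_div, one_le_div hc0]; exact h6
  calc _ ≤ ‖gradient v (z.2 • (z.1 : Space n))‖ * C := by gcongr; exact hC _
    _ ≤ (c⁻¹ * z.2 ^ s) * (‖gradient v (z.2 • (z.1 : Space n))‖ * C) :=
        le_mul_of_one_le_left (by positivity) h8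
    _ = _ := by ring

/-- Fundamental theorem of calculus on almost every ray, those off {y = 0}, followed by Fubini. The
factor g depends on the direction only and so is carried along. -/
lemma sphere_sub_eq_integral (ha : -1 < a) (hR : 0 < R) (hv : IsRegular a R v) {r₁ r₂ : ℝ}
    (h0 : 0 < r₁) (h12 : r₁ ≤ r₂) (h2 : r₂ < R) {g : Metric.sphere (0 : Space n) 1 → ℝ}
    (hg : Measurable g) {C : ℝ} (hC : ∀ ζ, |g ζ| ≤ C) :
    ∫ ζ : Metric.sphere (0 : Space n) 1, v (r₂ • (ζ : Space n)) * g ζ ∂(sph a) -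
      ∫ ζ : Metric.sphere (0 : Space n) 1, v (r₁ • (ζ : Space n)) * g ζ ∂(sph a) =
    ∫ t in r₁..r₂, ∫ ζ : Metric.sphere (0 : Space n) 1,
      inner ℝ (gradient v (t • (ζ : Space n))) (ζ : Space n) * g ζ ∂(sph a) := by
  rw [← integral_sub (hv.integrable_sphere ha ⟨h0.trans_le h12, h2⟩ hg hC)
    (hv.integrable_sphere ha ⟨h0, h12.trans_lt h2⟩ hg hC), intervalIntegral.integral_of_le h12,
    ← integral_prod_symm _ (hv.integrable_ray ha hR h0 h2 hg hC),
    integral_prod _ (hv.integrable_ray ha hR h0 h2 hg hC)]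
  refine integral_congr_ae ?_
  filter_upwards [ae_sph_yCoord_ne_zero a] with ζ hζ
  have h1 : ∀ t ∈ uIcc r₁ r₂, t • (ζ : Space n) ∈ Metric.ball (0 : Space n) R ∧ t ≠ 0 := by
    intro t ht
    rw [uIcc_of_le h12] at ht
    exact ⟨(smul_sphere_mem_ball (h0.trans_le ht.1) ζ).2 (ht.2.trans_lt h2),
      (h0.trans_le ht.1).ne'⟩
  rw [integral_mul_const, ← intervalIntegral.integral_of_le h12,
    intervalIntegral.integral_eq_sub_of_hasDerivAt
    (fun t ht => hv.hasDerivAt_ray (h1 t ht).1 hζ (h1 t ht).2)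
    (hv.continuousOn_ray h1 hζ).intervalIntegrable]
  ring

lemma sphInt_sub_eq_integral (ha : -1 < a) (hR : 0 < R) (hv : IsRegular a R v) {r₁ r₂ : ℝ}
    (h0 : 0 < r₁) (h12 : r₁ ≤ r₂) (h2 : r₂ < R) :
    sphInt a v r₂ - sphInt a v r₁ = ∫ t in r₁..r₂, t⁻¹ * sphInt a (rad v) t := by
  have := hv.sphere_sub_eq_integral ha hR h0 h12 h2 (g := fun _ => 1) measurable_const (C := 1)
    (fun ζ => by simp)
  simp only [mul_one] at this
  rw [sphInt, sphInt, this]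
  refine intervalIntegral.integral_congr fun t ht => ?_
  rw [uIcc_of_le h12] at ht
  have ht0 : t ≠ 0 := (h0.trans_le ht.1).ne'
  simp only [sphInt]
  rw [← integral_const_mul]
  congr 1; ext ζ
  rw [rad, inner_smul_right, inv_mul_cancel_left₀ ht0]

end IsRegular

/-- Local integrability on `(0, R)`. -/
def LocInt (R : ℝ) (f : ℝ → ℝ) : Prop :=
  ∀ r₁ r₂, 0 < r₁ → r₂ < R → IntegrableOn f (Ioo r₁ r₂)

namespace LocInt

variable {f g : ℝ → ℝ}

lemma add (hf : LocInt R f) (hg : LocInt R g) : LocInt R fun r => f r + g r :=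
  fun r₁ r₂ h1 h2 => (hf r₁ r₂ h1 h2).add (hg r₁ r₂ h1 h2)

lemma sub (hf : LocInt R f) (hg : LocInt R g) : LocInt R fun r => f r - g r :=
  fun r₁ r₂ h1 h2 => (hf r₁ r₂ h1 h2).sub (hg r₁ r₂ h1 h2)

lemma mul_continuousOn {k : ℝ → ℝ} (hf : LocInt R f) (hk : ContinuousOn k (Ioo 0 R)) :
    LocInt R fun r => k r * f r := by
  intro r₁ r₂ h1 h2
  have hk' := hk.mono (Icc_subset_Ioo h1 h2)
  obtain ⟨C, hC⟩ := isCompact_Icc.exists_bound_of_continuousOn hk'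
  refine Integrable.bdd_mul (hf r₁ r₂ h1 h2)
    ((hk'.mono Ioo_subset_Icc_self).aestronglyMeasurable measurableSet_Ioo) (c := C)
    ((ae_restrict_iff' measurableSet_Ioo).2 (Eventually.of_forall fun r hr =>
      hC r (Ioo_subset_Icc_self hr)))

lemma of_continuousOn (hf : ContinuousOn f (Ioo 0 R)) : LocInt R f := fun _ _ h1 h2 =>
  ((hf.mono (Icc_subset_Ioo h1 h2)).integrableOn_compact isCompact_Icc).mono_set
    Ioo_subset_Icc_self

lemma locallyIntegrableOn (hf : LocInt R f) : LocallyIntegrableOn f (Ioo 0 R) := by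
  intro r hr
  obtain ⟨r₁, h1, h1'⟩ := exists_between hr.1
  obtain ⟨r₂, h2, h2'⟩ := exists_between hr.2
  exact ⟨Ioo r₁ r₂, mem_nhdsWithin_of_mem_nhds (Ioo_mem_nhds h1' h2), hf r₁ r₂ h1 h2'⟩

lemma intervalIntegrable (hf : LocInt R f) {r₁ r₂ : ℝ} (h1 : 0 < r₁) (h12 : r₁ ≤ r₂)
    (h2 : r₂ < R) : IntervalIntegrable f volume r₁ r₂ := by
  rw [intervalIntegrable_iff_integrableOn_Ioo_of_le h12]
  exact hf r₁ r₂ h1 h2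

end LocInt

namespace IsProfile

variable {c : ℝ → ℝ}

lemma integrable_deriv_mul (hR : 0 < R) (hc : IsProfile R c) {f : ℝ → ℝ} (hf : LocInt R f) :
    Integrable fun r => deriv c r * f r := by
  obtain ⟨ρ, hρ, h⟩ := hc.exists_support hR
  obtain ⟨s, hs, h'⟩ := hc.deriv_eq_zero
  obtain ⟨M, hM0, hM⟩ := hc.exists_bound hR
  obtain ⟨r₂, h2, h2'⟩ := exists_between hρ.2
  have h1 : IntegrableOn (fun r => deriv c r * f r) (Ioo (s / 2) r₂) :=
    Integrable.bdd_mul (hf _ _ (by positivity) h2')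
      (hc.contDiff.continuous_deriv (by simp)).aestronglyMeasurable (c := M)
      (Eventually.of_forall fun r => (hM r).2.1)
  refine (integrableOn_iff_integrable_of_support_subset fun r hr => ?_).1 h1
  constructor
  · by_contra! hr'
    exact hr (by simp only; rw [h' r (by linarith), zero_mul])
  · by_contra! hr'
    exact hr (by simp only; rw [(h r (by linarith)).2, zero_mul])

/-- Integration by parts without boundary terms: the primitive vanishes at 0 and the profile
vanishes near R. It turns volume terms into integrals against c'. -/
lemma integral_mul_eq (hR : 0 < R) (hc : IsProfile R c) {g : ℝ → ℝ}
    (hg : ∀ ρ < R, IntegrableOn g (Ioo 0 ρ)) :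
    ∫ r in Ioi 0, c r * g r = -∫ r in Ioi 0, deriv c r * ∫ t in (0 : ℝ)..r, g t := by
  obtain ⟨ρ, hρ, h⟩ := hc.exists_support hR
  have hgi : IntervalIntegrable g volume 0 ρ := by
    rw [intervalIntegrable_iff_integrableOn_Ioo_of_le hρ.1.le]
    exact hg ρ hρ.2
  have key : ∀ f : ℝ → ℝ, (∀ r, ρ ≤ r → f r = 0) → ∫ r in Ioi 0, f r = ∫ r in (0 : ℝ)..ρ, f r := by
    intro f hf
    rw [intervalIntegral.integral_of_le hρ.1.le]
    refine (setIntegral_eq_of_subset_of_forall_sdiff_eq_zero measurableSet_Ioi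
      Ioc_subset_Ioi_self fun r hr => hf r ?_)
    by_contra! h'
    exact hr.2 ⟨hr.1, h'.le⟩
  rw [key _ fun r hr => by rw [(h r hr).1, zero_mul],
    key _ fun r hr => by rw [(h r hr).2, zero_mul]]
  have hac1 : AbsolutelyContinuousOnInterval c 0 ρ :=
    (hc.contDiff.of_le (by simp)).contDiffOn.absolutelyContinuousOnInterval
  have hac2 : AbsolutelyContinuousOnInterval (fun r => ∫ t in (0 : ℝ)..r, g t) 0 ρ :=
    hgi.absolutelyContinuousOnInterval_intervalIntegral (by simp)
  have h1 := hac1.integral_mul_deriv_eq_deriv_mul hac2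
  rw [(h ρ le_rfl).1, intervalIntegral.integral_same] at h1
  have h2 : ∫ r in (0 : ℝ)..ρ, c r * g r =
      ∫ r in (0 : ℝ)..ρ, c r * deriv (fun r => ∫ t in (0 : ℝ)..r, g t) r := by
    refine intervalIntegral.integral_congr_ae ?_
    filter_upwards [hgi.ae_hasDerivAt_integral] with r hr hr'
    rw [(hr (uIoc_subset_uIcc hr') 0 (by simp)).deriv]
  rw [h2, h1]; ring

end IsProfile

/-- The primitive of `k` that vanishes at R is constant near 0 and zero near R, because `k` is
supported compactly in (0, R). Derivatives of profiles therefore exhaust the test functions on (0,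
R). -/
lemma exists_isProfile_deriv_eq (hR : 0 < R) {k : ℝ → ℝ} (hk : ContDiff ℝ ∞ k)
    (hc : HasCompactSupport k) (hs : tsupport k ⊆ Ioo 0 R) :
    ∃ c, IsProfile R c ∧ deriv c = k := by
  obtain ⟨s, ρ, hs0, hρR, hsρ⟩ : ∃ s ρ, 0 < s ∧ ρ < R ∧ ∀ r, k r ≠ 0 → s ≤ r ∧ r ≤ ρ := by
    rcases (tsupport k).eq_empty_or_nonempty with he | hne
    · refine ⟨1, 0, one_pos, hR, fun r hr => absurd (image_eq_zero_of_notMem_tsupport ?_) hr⟩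
      rw [he]; exact notMem_empty r
    · obtain ⟨s, hs1, hs2⟩ := hc.isCompact.exists_isLeast hne
      obtain ⟨ρ, hρ1, hρ2⟩ := hc.isCompact.exists_isGreatest hne
      exact ⟨s, ρ, (hs hs1).1, (hs hρ1).2, fun r hr =>
        ⟨hs2 (subset_tsupport _ hr), hρ2 (subset_tsupport _ hr)⟩⟩
  have hd : ∀ r, HasDerivAt (fun r => ∫ t in R..r, k t) (k r) r := fun r =>
    intervalIntegral.integral_hasDerivAt_right (hk.continuous.intervalIntegrable _ _)
      (hk.continuous.stronglyMeasurableAtFilter _ _) hk.continuous.continuousAt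
  have hd' : deriv (fun r => ∫ t in R..r, k t) = k := funext fun r => (hd r).deriv
  refine ⟨fun r => ∫ t in R..r, k t, ⟨?_, ⟨s / 2, by positivity, fun r hr => ?_⟩,
    max ρ 0, max_lt hρR hR, fun r hr => ?_⟩, hd'⟩
  · rw [contDiff_infty_iff_deriv, hd']
    exact ⟨fun r => (hd r).differentiableAt, hk⟩
  · rw [← intervalIntegral.integral_add_adjacent_intervals
      (hk.continuous.intervalIntegrable R 0) (hk.continuous.intervalIntegrable 0 r)]
    rw [intervalIntegral.integral_zero_ae (a := 0), add_zero]
    refine Eventually.of_forall fun t ht => ?_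
    by_contra h
    have h1 := (hsρ t h).1
    have h2 : t ≤ max 0 r := (mem_uIoc.1 ht).elim (fun h => h.2.trans (le_max_right _ _))
      (fun h => h.2.trans (le_max_left _ _))
    have h3 : max 0 r ≤ s / 2 := max_le (by positivity) hr
    linarith
  · refine intervalIntegral.integral_zero_ae (Eventually.of_forall fun t ht => ?_)
    by_contra h
    have h1 := (hsρ t h).2
    have h2 : min R r < t := (mem_uIoc.1 ht).elim (fun h => (min_le_left _ _).trans_lt h.1)
      (fun h => (min_le_right _ _).trans_lt h.1)
    have h3 : ρ ≤ min R r := le_min hρR.le ((le_max_left _ _).trans hr)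
    linarith

/-- The fundamental lemma of the calculus of variations, for radial profiles. -/
lemma ae_eq_zero_of_integral_deriv_profile (hR : 0 < R) {f : ℝ → ℝ} (hf : LocInt R f)
    (h : ∀ c, IsProfile R c → (∀ r, 0 ≤ c r) → ∫ r in Ioi 0, deriv c r * f r = 0) :
    ∀ᵐ r, r ∈ Ioo 0 R → f r = 0 := by
  refine isOpen_Ioo.ae_eq_zero_of_integral_contDiff_smul_eq_zero hf.locallyIntegrableOn
    fun k hk hkc hks => ?_
  obtain ⟨c, hc, rfl⟩ := exists_isProfile_deriv_eq hR hk hkc hks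
  obtain ⟨ρ, hρ, h0⟩ := hc.exists_support hR
  obtain ⟨M, hM0, hM⟩ := hc.exists_bound hR
  obtain ⟨c', hc', hc'0, -, hc'1⟩ := exists_isProfile hR hρ.2
  have hd1 := hc.contDiff.differentiable (by simp)
  have hd2 := hc'.contDiff.differentiable (by simp)
  -- The hypothesis covers nonnegative profiles only. A large multiple of a profile equal to 1 on
  -- the support of `c` makes the sum nonnegative, and linearity then removes it.
  have hp : IsProfile R fun r => c r + M * c' r := by
    obtain ⟨s, hs, hs'⟩ := hc.const_near_zero
    obtain ⟨t, ht, ht'⟩ := hc'.const_near_zero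
    obtain ⟨x, hx, hx'⟩ := hc.zero_near_R
    obtain ⟨y, hy, hy'⟩ := hc'.zero_near_R
    refine ⟨hc.contDiff.add (contDiff_const.mul hc'.contDiff), ⟨min s t, lt_min hs ht,
      fun r hr => ?_⟩, max x y, max_lt hx hy, fun r hr => ?_⟩
    · rw [hs' r (hr.trans (min_le_left _ _)), ht' r (hr.trans (min_le_right _ _))]
    · rw [hx' r ((le_max_left _ _).trans hr), hy' r ((le_max_right _ _).trans hr)]; simp
  have e1 := h _ hp fun r => by
    rcases le_or_gt ρ r with hr | hr
    · rw [(h0 r hr).1, zero_add]; exact mul_nonneg hM0 (hc'0 r)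
    · rw [hc'1 r hr.le, mul_one]; linarith [neg_abs_le (c r), (hM r).1]
  have e2 := h _ hc' hc'0
  have e3 : ∀ r, deriv (fun r => c r + M * c' r) r * f r =
      deriv c r * f r + M * (deriv c' r * f r) := fun r => by
    rw [deriv_fun_add (hd1 r) ((hd2 r).const_mul M), deriv_const_mul _ (hd2 r)]; ring
  simp_rw [e3] at e1
  rw [integral_add (hc.integrable_deriv_mul hR hf).integrableOn
    ((hc'.integrable_deriv_mul hR hf).integrableOn.const_mul M), integral_const_mul, e2, mul_zero,
    add_zero] at e1
  rw [← e1]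
  refine (setIntegral_eq_integral_of_forall_compl_eq_zero fun r hr => ?_).symm
  obtain ⟨s, hs, hs'⟩ := hc.deriv_eq_zero
  rw [hs' r ((not_lt.1 hr).trans_lt hs), zero_smul]

end

/-! ### Integral identities on almost every sphere. -/

section

variable {n : ℕ} {a R : ℝ} {u : Space n → ℝ}

/-- Local integrability on `B(R)` with respect to the weighted measure. -/
def BallInt (a R : ℝ) (F : Space n → ℝ) : Prop :=
  ∀ ρ < R, IntegrableOn F (Metric.ball 0 ρ) (wvol a)

namespace BallInt

variable {F G : Space n → ℝ}

lemma locInt (hF : BallInt a R F) : LocInt R fun r => r ^ ((n : ℝ) + a) * sphInt a F r :=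
  fun _ r₂ h1 h2 => (integrableOn_sphInt_Ioo (hF r₂ h2)).mono_set (Ioo_subset_Ioo_left h1.le)

lemma ae_integrable (hF : BallInt a R F) : ∀ᵐ r, r ∈ Ioo 0 R → Integrable
    (fun ζ : Metric.sphere (0 : Space n) 1 => F (r • (ζ : Space n))) (sph a) := by
  have : ∀ j : ℕ, ∀ᵐ r, r ∈ Ioo 0 (R - 1 / ((j : ℝ) + 1)) → Integrable
      (fun ζ : Metric.sphere (0 : Space n) 1 => F (r • (ζ : Space n))) (sph a) := fun j =>
    ae_integrable_sphere_Ioo (hF _ (by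
      have : 0 < 1 / ((j : ℝ) + 1) := by positivity
      linarith))
  filter_upwards [ae_all_iff.2 this] with r hr hr'
  obtain ⟨j, hj⟩ := exists_nat_one_div_lt (sub_pos.2 hr'.2)
  exact hr j ⟨hr'.1, by linarith⟩

lemma integrable_radial_mul (hF : BallInt a R F) {k : ℝ → ℝ} (hk : Measurable k) {M ρ : ℝ}
    (hM : ∀ r, |k r| ≤ M) (hρ : ρ < R) (h : ∀ r, ρ ≤ r → k r = 0) :
    Integrable (fun p => k ‖p‖ * F p) (wvol a) := by
  have h1 : IntegrableOn (fun p => k ‖p‖ * F p) (Metric.ball 0 ρ) (wvol a) :=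
    Integrable.bdd_mul (hF ρ hρ) (hk.comp measurable_norm).aestronglyMeasurable (c := M)
      (Eventually.of_forall fun p => hM _)
  refine (integrableOn_iff_integrable_of_support_subset fun p hp => ?_).1 h1
  rw [mem_ball_zero_iff]
  by_contra! hp'
  exact hp (by simp only; rw [h _ hp', zero_mul])

lemma integrable_profile_mul (hR : 0 < R) (hF : BallInt a R F) {c : ℝ → ℝ} (hc : IsProfile R c) :
    Integrable (fun p => c ‖p‖ * F p) (wvol a) := by
  obtain ⟨ρ, hρ, h⟩ := hc.exists_support hR
  obtain ⟨M, -, hM⟩ := hc.exists_bound hR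
  exact hF.integrable_radial_mul hc.contDiff.continuous.measurable (fun r => (hM r).1) hρ.2
    fun r hr => (h r hr).1

lemma integrable_deriv_profile_mul (hR : 0 < R) (hF : BallInt a R F) {c : ℝ → ℝ}
    (hc : IsProfile R c) : Integrable (fun p => deriv c ‖p‖ / ‖p‖ * F p) (wvol a) := by
  obtain ⟨ρ, hρ, h⟩ := hc.exists_support hR
  obtain ⟨M, -, hM⟩ := hc.exists_bound hR
  exact hF.integrable_radial_mul (k := fun r => deriv c r / r)
    ((hc.contDiff.continuous_deriv (by simp)).measurable.div measurable_id)
    (fun r => (hM r).2.2) hρ.2 fun r hr => by rw [(h r hr).2, zero_div]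

lemma integral_profile_mul (hR : 0 < R) (hF : BallInt a R F) {c : ℝ → ℝ} (hc : IsProfile R c) :
    ∫ p, c ‖p‖ * F p ∂(wvol a) =
      -∫ r in Ioi 0, deriv c r * ∫ t in (0 : ℝ)..r, t ^ ((n : ℝ) + a) * sphInt a F t := by
  rw [integral_radial_mul_polar (hF.integrable_profile_mul hR hc),
    hc.integral_mul_eq hR fun ρ hρ => integrableOn_sphInt_Ioo (hF ρ hρ)]

lemma integral_deriv_profile_mul (hR : 0 < R) (hF : BallInt a R F) {c : ℝ → ℝ}
    (hc : IsProfile R c) : ∫ p, deriv c ‖p‖ / ‖p‖ * F p ∂(wvol a) =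
      ∫ r in Ioi 0, deriv c r * (r⁻¹ * (r ^ ((n : ℝ) + a) * sphInt a F r)) := by
  rw [integral_radial_mul_polar (k := fun r => deriv c r / r)
    (hF.integrable_deriv_profile_mul hR hc)]
  simp only [div_eq_mul_inv, mul_assoc]

lemma continuousOn_primitive (hF : BallInt a R F) : ContinuousOn
    (fun r => ∫ t in (0 : ℝ)..r, t ^ ((n : ℝ) + a) * sphInt a F t) (Ioo 0 R) := by
  intro r hr
  obtain ⟨ρ, h1, h2⟩ := exists_between hr.2
  have h3 : IntervalIntegrable (fun t => t ^ ((n : ℝ) + a) * sphInt a F t) volume 0 ρ := by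
    rw [intervalIntegrable_iff_integrableOn_Ioo_of_le (hr.1.trans h1).le]
    exact integrableOn_sphInt_Ioo (hF ρ h2)
  have h4 := (h3.absolutelyContinuousOnInterval_intervalIntegral (c := 0) (by simp)).continuousOn
  rw [uIcc_of_le (hr.1.trans h1).le] at h4
  exact (h4.continuousAt (Icc_mem_nhds hr.1 h1)).continuousWithinAt

end BallInt

lemma sphInt_const_mul (c : ℝ) (F : Space n → ℝ) (r : ℝ) :
    sphInt a (fun p => c * F p) r = c * sphInt a F r := integral_const_mul _ _

namespace IsRegular

variable {v w : Space n → ℝ}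

lemma ballInt_gradient_sq (hv : IsRegular a R v) : BallInt a R fun p => ‖gradient v p‖ ^ 2 :=
  fun ρ hρ => hv.energy ρ hρ

lemma ballInt_inner (hv : IsRegular a R v) (hw : IsRegular a R w) :
    BallInt a R fun p => inner ℝ (gradient v p) (gradient w p) := fun ρ hρ =>
  integrable_inner_of_sq (measurable_gradient v).aestronglyMeasurable
    (measurable_gradient w).aestronglyMeasurable (hv.energy ρ hρ) (hw.energy ρ hρ)

lemma ballInt_rad_sq (hv : IsRegular a R v) : BallInt a R fun p => rad v p ^ 2 := fun ρ hρ => by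
  refine ((hv.energy ρ hρ).mul_const (ρ ^ 2)).mono'
    ((measurable_rad v).pow_const 2).aestronglyMeasurable
    ((ae_restrict_iff' measurableSet_ball).2 (Eventually.of_forall fun p hp => ?_))
  rw [Real.norm_eq_abs, abs_of_nonneg (sq_nonneg _)]
  refine (rad_sq_le v p).trans ?_
  gcongr
  exact (mem_ball_zero_iff.1 hp).le

lemma aestronglyMeasurable (hv : IsRegular a R v) {ρ : ℝ} (hρ : ρ < R) :
    AEStronglyMeasurable v ((wvol a).restrict (Metric.ball 0 ρ)) :=
  (hv.continuousOn.mono (Metric.ball_subset_ball hρ.le)).aestronglyMeasurable measurableSet_ball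

lemma ballInt_mul_rad (ha : -1 < a) (hv : IsRegular a R v) (hw : IsRegular a R w) :
    BallInt a R fun p => w p * rad v p := fun ρ hρ => by
  refine ((hw.integrableOn_sq ha hρ).add (hv.ballInt_rad_sq ρ hρ)).mono'
    ((hw.aestronglyMeasurable hρ).mul (measurable_rad v).aestronglyMeasurable)
    (Eventually.of_forall fun p => ?_)
  rw [norm_mul, Real.norm_eq_abs, Real.norm_eq_abs, Pi.add_apply, ← sq_abs (w p),
    ← sq_abs (rad v p)]
  nlinarith [sq_nonneg (|w p| - |rad v p|), sq_nonneg (|w p|), sq_nonneg (|rad v p|)]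

end IsRegular

/-- The defect in the formula `∫_{∂B(r)} w ∂_ν v |y|^a = ∫_{B(r)} ⟨∇v, ∇w⟩ |y|^a`. -/
def fluxDefect (a : ℝ) (v w : Space n → ℝ) (r : ℝ) : ℝ :=
  r⁻¹ * (r ^ ((n : ℝ) + a) * sphInt a (fun p => w p * rad v p) r) -
    ∫ t in (0 : ℝ)..r, t ^ ((n : ℝ) + a) *
      sphInt a (fun p => inner ℝ (gradient v p) (gradient w p)) t

lemma continuousOn_inv_Ioo : ContinuousOn (fun r : ℝ => r⁻¹) (Ioo 0 R) :=
  continuousOn_inv₀.mono fun _ hr => hr.1.ne'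

namespace IsRegular

variable {v w : Space n → ℝ}

lemma locInt_fluxDefect (ha : -1 < a) (hv : IsRegular a R v) (hw : IsRegular a R w) :
    LocInt R (fluxDefect a v w) :=
  ((hv.ballInt_mul_rad ha hw).locInt.mul_continuousOn continuousOn_inv_Ioo).sub
    (LocInt.of_continuousOn (hv.ballInt_inner hw).continuousOn_primitive)

/-- The gradient of c w has a part c ∇w, a volume term that is integrated by parts in r, and a part
along ∇c, which is already a sphere term. A weak statement on `v` thus becomes a distributional
statement on the flux defect, with c' as test function. -/
lemma pairing_profile_mul (ha : -1 < a) (hR : 0 < R) (hv : IsRegular a R v)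
    (hw : IsRegular a R w) {c : ℝ → ℝ} (hc : IsProfile R c) :
    pairing a v (fun p => c ‖p‖ * w p) = ∫ r in Ioi 0, deriv c r * fluxDefect a v w r := by
  have i1 := (hv.ballInt_inner hw).integrable_profile_mul hR hc
  have i2 := (hv.ballInt_mul_rad ha hw).integrable_deriv_profile_mul hR hc
  have h1 : pairing a v (fun p => c ‖p‖ * w p) =
      (∫ p, c ‖p‖ * inner ℝ (gradient v p) (gradient w p) ∂(wvol a)) +
        ∫ p, deriv c ‖p‖ / ‖p‖ * (w p * rad v p) ∂(wvol a) := by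
    rw [← integral_add i1 i2, pairing]
    refine integral_congr_ae ?_
    obtain ⟨ρ, hρ, h⟩ := hc.exists_support hR
    filter_upwards [ae_wvol_yCoord_ne_zero a] with p hy
    by_cases hp : p ∈ Metric.ball (0 : Space n) R
    · rw [gradient_mul (hc.contDiff_radial.differentiable (by simp) p) (hw.differentiableAt hp hy),
        hc.gradient_radial, inner_add_right, inner_smul_right, inner_smul_right, inner_smul_right,
        rad]
      ring
    · have h2 : R ≤ ‖p‖ := by simpa using hp
      have h3 : p ∉ tsupport fun p : Space n => c ‖p‖ * w p := fun h' =>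
        hp (hc.isCutoff.tsupport_subset (tsupport_mul_subset_left h'))
      rw [gradient_eq_zero_of_notMem_tsupport h3, (h _ (hρ.2.le.trans h2)).1,
        (h _ (hρ.2.le.trans h2)).2]
      simp
  rw [h1, (hv.ballInt_inner hw).integral_profile_mul hR hc,
    (hv.ballInt_mul_rad ha hw).integral_deriv_profile_mul hR hc]
  have j1 := hc.integrable_deriv_mul hR
    (LocInt.of_continuousOn (hv.ballInt_inner hw).continuousOn_primitive)
  have j2 := hc.integrable_deriv_mul hR
    ((hv.ballInt_mul_rad ha hw).locInt.mul_continuousOn continuousOn_inv_Ioo)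
  simp only [fluxDefect, mul_sub]
  rw [integral_sub j2.integrableOn j1.integrableOn]
  ring

lemma dirichlet_eq_integral (hv : IsRegular a R v) {r : ℝ} (hr : r ∈ Ioo 0 R) :
    dirichlet a v r = ∫ t in (0 : ℝ)..r, t ^ ((n : ℝ) + a) *
      sphInt a (fun p => ‖gradient v p‖ ^ 2) t := by
  rw [dirichlet, ← setIntegral_wvol a (fun p => ‖gradient v p‖ ^ 2) measurableSet_ball,
    setIntegral_ball_polar hr.1.le (hv.energy r hr.2)]

lemma continuousOn_dirichlet (hv : IsRegular a R v) : ContinuousOn (dirichlet a v) (Ioo 0 R) :=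
  hv.ballInt_gradient_sq.continuousOn_primitive.congr fun _ hr => hv.dirichlet_eq_integral hr

end IsRegular

namespace IsSolution

/-- The divergence formula ∫_{∂B(r)} u ∂_ν u |y|^a = D(r): by complementarity, c' integrates to zero
against the flux defect of u with itself. -/
lemma ae_sphInt_mul_rad (hu : IsSolution a R u) (ha : -1 < a) (hR : 0 < R) :
    ∀ᵐ r, r ∈ Ioo 0 R →
      r ^ ((n : ℝ) + a) * sphInt a (fun p => u p * rad u p) r = r * dirichlet a u r := by
  have h := ae_eq_zero_of_integral_deriv_profile hR
    (hu.isRegular.locInt_fluxDefect ha hu.isRegular) fun c hc _ => by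
      rw [← hu.isRegular.pairing_profile_mul ha hR hu.isRegular hc]
      exact hu.pairing_cutoff_self ha hR hc.isCutoff
  filter_upwards [h] with r hr hr'
  have h1 := hr hr'
  simp only [fluxDefect, real_inner_self_eq_norm_sq] at h1
  rw [← hu.isRegular.dirichlet_eq_integral hr', sub_eq_zero] at h1
  rw [← h1, mul_inv_cancel_left₀ hr'.1.ne']

/-- The Rellich identity localised to spheres: the left-hand side is r D'(r), and the last term is
2r ∫_{∂B(r)} (∂_ν u)² |y|^a. -/
lemma ae_sphInt_rad_sq (hu : IsSolution a R u) (ha : -1 < a) (hR : 0 < R) :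
    ∀ᵐ r, r ∈ Ioo 0 R →
      r * (r ^ ((n : ℝ) + a) * sphInt a (fun p => ‖gradient u p‖ ^ 2) r) =
        ((n : ℝ) + a - 1) * dirichlet a u r +
          2 * (r⁻¹ * (r ^ ((n : ℝ) + a) * sphInt a (fun p => rad u p ^ 2) r)) := by
  set A : ℝ → ℝ := fun r => r ^ ((n : ℝ) + a) * sphInt a (fun p => ‖gradient u p‖ ^ 2) r with hA
  set C : ℝ → ℝ := fun r => r⁻¹ * (r ^ ((n : ℝ) + a) * sphInt a (fun p => rad u p ^ 2) r) with hC
  set D : ℝ → ℝ := fun r => ∫ t in (0 : ℝ)..r, A t with hD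
  have lA : LocInt R fun r => r * A r :=
    hu.isRegular.ballInt_gradient_sq.locInt.mul_continuousOn continuousOn_id
  have lC : LocInt R C :=
    hu.isRegular.ballInt_rad_sq.locInt.mul_continuousOn continuousOn_inv_Ioo
  have lD : LocInt R D :=
    LocInt.of_continuousOn hu.isRegular.ballInt_gradient_sq.continuousOn_primitive
  have lD' : LocInt R fun r => ((n : ℝ) + a - 1) * D r := lD.mul_continuousOn continuousOn_const
  have lC' : LocInt R fun r => 2 * C r := lC.mul_continuousOn continuousOn_const
  have h := ae_eq_zero_of_integral_deriv_profile hR ((lD'.add lC').sub lA) fun c hc hc0 => by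
    have h1 := hu.rellich ha hR hc hc0
    rw [hu.isRegular.ballInt_rad_sq.integral_deriv_profile_mul hR hc,
      hu.isRegular.ballInt_gradient_sq.integral_profile_mul hR hc] at h1
    have h2 : ∫ p : Space n, ‖p‖ * deriv c ‖p‖ * ‖gradient u p‖ ^ 2 ∂(wvol a) =
        ∫ r in Ioi 0, deriv c r * (r * A r) := by
      obtain ⟨ρ, hρ, h⟩ := hc.exists_support hR
      obtain ⟨M, hM0, hM⟩ := hc.exists_bound hR
      rw [integral_radial_mul_polar (k := fun r => r * deriv c r)]
      · refine integral_congr_ae (Eventually.of_forall fun r => ?_)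
        simp only [hA]; ring
      -- The bound is required for all real r, whereas only r = ‖p‖ ≥ 0 occurs; `max r 0` takes care
      -- of negative r.
      · have hb : ∀ r, |max r 0 * deriv c r| ≤ ρ * M := fun r => by
          rcases le_or_gt ρ r with hr | hr
          · rw [(h r hr).2, mul_zero, abs_zero]; exact mul_nonneg hρ.1.le hM0
          · rw [abs_mul]
            refine mul_le_mul ?_ (hM r).2.1 (abs_nonneg _) hρ.1.le
            rw [abs_of_nonneg (le_max_right _ _)]
            exact max_le hr.le hρ.1.le
        have := hu.isRegular.ballInt_gradient_sq.integrable_radial_mul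
          (k := fun r => max r 0 * deriv c r)
          ((measurable_id.max measurable_const).mul
            (hc.contDiff.continuous_deriv (by simp)).measurable) hb hρ.2
          fun r hr => by rw [(h r hr).2, mul_zero]
        simpa only [max_eq_left (norm_nonneg _)] using this
    rw [h2] at h1
    have j1 := (hc.integrable_deriv_mul hR lD).const_mul ((n : ℝ) + a - 1)
    have j2 := (hc.integrable_deriv_mul hR lC).const_mul 2
    have j3 := hc.integrable_deriv_mul hR lA
    have e : ∀ r, deriv c r * (((n : ℝ) + a - 1) * D r + 2 * C r - r * A r) =
        ((n : ℝ) + a - 1) * (deriv c r * D r) + 2 * (deriv c r * C r) - deriv c r * (r * A r) :=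
      fun r => by ring
    simp_rw [e]
    have j12 : Integrable fun r => ((n : ℝ) + a - 1) * (deriv c r * D r) +
        2 * (deriv c r * C r) := j1.add j2
    rw [integral_sub j12.integrableOn j3.integrableOn,
      integral_add j1.integrableOn j2.integrableOn, integral_const_mul, integral_const_mul]
    linarith
  filter_upwards [h] with r hr hr'
  have h1 := hr hr'
  rw [hu.isRegular.dirichlet_eq_integral hr']
  linarith

end IsSolution

end

/-! ### Weiss monotonicity and the frequency. -/

section

variable {n : ℕ} {a R : ℝ} {u : Space n → ℝ}

/-- Absolute continuity is what allows a sign of the derivative known only almost everywhere to be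
integrated. -/
lemma le_of_ae_hasDerivAt_nonneg {f : ℝ → ℝ} {r₁ r₂ : ℝ} (h12 : r₁ ≤ r₂)
    (hf : AbsolutelyContinuousOnInterval f r₁ r₂)
    (h : ∀ᵐ r, r ∈ Icc r₁ r₂ → ∃ d, 0 ≤ d ∧ HasDerivAt f d r) : f r₁ ≤ f r₂ := by
  have h1 := hf.integral_deriv_eq_sub
  have h2 : 0 ≤ ∫ r in r₁..r₂, deriv f r := by
    refine intervalIntegral.integral_nonneg_of_ae_restrict h12 ?_
    rw [EventuallyLE, ae_restrict_iff' measurableSet_Icc]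
    filter_upwards [h] with r hr hr'
    obtain ⟨d, hd, hd'⟩ := hr hr'
    rw [hd'.deriv]; exact hd
  linarith

lemma absolutelyContinuous_rpow {r₁ r₂ : ℝ} (h0 : 0 < r₁) (h12 : r₁ ≤ r₂) (e : ℝ) :
    AbsolutelyContinuousOnInterval (fun r : ℝ => r ^ e) r₁ r₂ := by
  refine ContDiffOn.absolutelyContinuousOnInterval fun r hr => ?_
  rw [uIcc_of_le h12] at hr
  exact (contDiffAt_id.rpow_const_of_ne (h0.trans_le hr.1).ne').contDiffWithinAt

lemma sphInt_nonneg {F : Space n → ℝ} (hF : ∀ p, 0 ≤ F p) (r : ℝ) : 0 ≤ sphInt a F r :=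
  integral_nonneg fun _ => hF _

namespace IsRegular

variable {v w : Space n → ℝ}

lemma rad_mul (hv : IsRegular a R v) (hw : IsRegular a R w) {p : Space n}
    (hp : p ∈ Metric.ball (0 : Space n) R) (hy : yCoord p ≠ 0) :
    rad (fun q => v q * w q) p = w p * rad v p + v p * rad w p := by
  rw [rad, gradient_mul (hv.differentiableAt hp hy) (hw.differentiableAt hp hy), inner_add_left,
    inner_smul_left, inner_smul_left, rad, rad]
  simp only [conj_trivial]
  ring

lemma ae_sphere (a : ℝ) {r : ℝ} (hr : r ∈ Ioo 0 R) :
    ∀ᵐ ζ : Metric.sphere (0 : Space n) 1 ∂(sph a),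
      r • (ζ : Space n) ∈ Metric.ball (0 : Space n) R ∧ yCoord (r • (ζ : Space n)) ≠ 0 := by
  filter_upwards [ae_sph_yCoord_ne_zero a] with ζ hζ
  exact ⟨(smul_sphere_mem_ball hr.1 ζ).2 hr.2, by
    rw [yCoord_smul]; exact mul_ne_zero hr.1.ne' hζ⟩

lemma sphInt_rad_sq_fun (hv : IsRegular a R v) {r : ℝ} (hr : r ∈ Ioo 0 R) :
    sphInt a (rad fun p => v p ^ 2) r = 2 * sphInt a (fun p => v p * rad v p) r := by
  rw [sphInt, sphInt, ← integral_const_mul]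
  refine integral_congr_ae ?_
  filter_upwards [ae_sphere a hr] with ζ hζ
  have h : (fun p => v p ^ 2) = fun p => v p * v p := by ext p; ring
  rw [h, hv.rad_mul hv hζ.1 hζ.2]; ring

lemma sq (hv : IsRegular a R v) : IsRegular a R fun p => v p ^ 2 := by
  simpa only [← pow_two] using hv.mul hv

end IsRegular

namespace IsSolution

/-- Along rays the derivative of u² is 2u Zu / t, and the sphere integral of u Zu is given by the
Dirichlet energy for almost every radius. -/
lemma sphInt_sq_sub (hu : IsSolution a R u) (ha : -1 < a) (hR : 0 < R) {r₁ r₂ : ℝ} (h0 : 0 < r₁)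
    (h12 : r₁ ≤ r₂) (h2 : r₂ < R) :
    sphInt a (fun p => u p ^ 2) r₂ - sphInt a (fun p => u p ^ 2) r₁ =
      ∫ t in r₁..r₂, 2 * (t ^ (-((n : ℝ) + a)) * dirichlet a u t) := by
  rw [hu.isRegular.sq.sphInt_sub_eq_integral ha hR h0 h12 h2]
  refine intervalIntegral.integral_congr_ae ?_
  filter_upwards [hu.ae_sphInt_mul_rad ha hR] with t ht ht'
  rw [uIoc_of_le h12] at ht'
  have ht0 : 0 < t := h0.trans ht'.1
  have htR : t ∈ Ioo 0 R := ⟨ht0, ht'.2.trans_lt h2⟩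
  rw [hu.isRegular.sphInt_rad_sq_fun htR]
  have h3 := ht htR
  have h4 : t ^ (-((n : ℝ) + a)) * t ^ ((n : ℝ) + a) = 1 := by
    rw [← Real.rpow_add ht0]; simp
  have h5 : sphInt a (fun p => u p * rad u p) t =
      t ^ (-((n : ℝ) + a)) * (t * dirichlet a u t) := by
    rw [← h3, ← mul_assoc, h4, one_mul]
  rw [h5]; field_simp

lemma continuousOn_sphInt_deriv (hu : IsSolution a R u) :
    ContinuousOn (fun t => 2 * (t ^ (-((n : ℝ) + a)) * dirichlet a u t)) (Ioo 0 R) :=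
  continuousOn_const.mul ((continuousOn_id.rpow_const fun _ ht => Or.inl ht.1.ne').mul
    hu.isRegular.continuousOn_dirichlet)

/-- Although the flux identity holds only almost everywhere, the integrand above is continuous,
because D is; hence h is C¹ and the formula holds at every radius. -/
lemma hasDerivAt_sphInt_sq (hu : IsSolution a R u) (ha : -1 < a) (hR : 0 < R) {r : ℝ}
    (hr : r ∈ Ioo 0 R) : HasDerivAt (sphInt a fun p => u p ^ 2)
      (2 * (r ^ (-((n : ℝ) + a)) * dirichlet a u r)) r := by
  obtain ⟨r₁, h1, h1'⟩ := exists_between hr.1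
  have hc := hu.continuousOn_sphInt_deriv
  have hsub : uIcc r₁ r ⊆ Ioo 0 R := by
    rw [uIcc_of_le h1'.le]; exact Icc_subset_Ioo h1 hr.2
  have h3 := intervalIntegral.integral_hasDerivAt_right
    (hc.mono hsub).intervalIntegrable
    (hc.stronglyMeasurableAtFilter isOpen_Ioo r hr) (hc.continuousAt (isOpen_Ioo.mem_nhds hr))
  refine (h3.const_add (sphInt a (fun p => u p ^ 2) r₁)).congr_of_eventuallyEq ?_
  filter_upwards [Ioo_mem_nhds h1' hr.2] with t ht
  rw [← hu.sphInt_sq_sub ha hR h1 ht.1.le ht.2]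
  ring

lemma monotoneOn_sphInt_sq (hu : IsSolution a R u) (ha : -1 < a) (hR : 0 < R) :
    MonotoneOn (sphInt a fun p => u p ^ 2) (Ioo 0 R) := by
  refine monotoneOn_of_deriv_nonneg (convex_Ioo 0 R)
    (fun r hr => (hu.hasDerivAt_sphInt_sq ha hR hr).continuousAt.continuousWithinAt)
    (fun r hr => ?_) fun r hr => ?_
  · rw [interior_Ioo] at hr
    exact (hu.hasDerivAt_sphInt_sq ha hR hr).differentiableAt.differentiableWithinAt
  · rw [interior_Ioo] at hr
    rw [(hu.hasDerivAt_sphInt_sq ha hR hr).deriv]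
    have hd : 0 ≤ dirichlet a u r := by
      rw [dirichlet]
      exact integral_nonneg fun p => mul_nonneg (by positivity) (weight_nonneg a p)
    have := Real.rpow_nonneg hr.1.le (-((n : ℝ) + a))
    positivity

/-- Monotonicity of the Weiss energies, for an arbitrary homogeneity `γ`. -/
lemma weiss_mono (hu : IsSolution a R u) (ha : -1 < a) (hR : 0 < R) (γ : ℝ) {r₁ r₂ : ℝ}
    (h0 : 0 < r₁) (h12 : r₁ ≤ r₂) (h2 : r₂ < R) :
    r₁ ^ (-2 * γ - ((n : ℝ) + a) + 1) * dirichlet a u r₁ -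
        γ * (r₁ ^ (-2 * γ) * sphInt a (fun p => u p ^ 2) r₁) ≤
      r₂ ^ (-2 * γ - ((n : ℝ) + a) + 1) * dirichlet a u r₂ -
        γ * (r₂ ^ (-2 * γ) * sphInt a (fun p => u p ^ 2) r₂) := by
  set A : ℝ → ℝ := fun r => r ^ ((n : ℝ) + a) * sphInt a (fun p => ‖gradient u p‖ ^ 2) r with hA
  set D : ℝ → ℝ := fun r => ∫ t in (0 : ℝ)..r, A t with hD
  set E : ℝ → ℝ := fun t => 2 * (t ^ (-((n : ℝ) + a)) * dirichlet a u t) with hE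
  set h : ℝ → ℝ := sphInt a fun p => u p ^ 2 with hh
  -- The same function as h on [r₁, r₂], written as an integral so that absolute continuity is
  -- immediate.
  set H : ℝ → ℝ := fun r => h r₁ + ∫ t in r₁..r, E t with hH
  have hHh : ∀ r ∈ Icc r₁ r₂, H r = h r := fun r hr => by
    simp only [hH]
    rw [← hu.sphInt_sq_sub ha hR h0 hr.1 (hr.2.trans_lt h2)]; ring
  have hDd : ∀ r ∈ Icc r₁ r₂, dirichlet a u r = D r := fun r hr =>
    hu.isRegular.dirichlet_eq_integral ⟨h0.trans_le hr.1, hr.2.trans_lt h2⟩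
  have hAi : IntervalIntegrable A volume 0 r₂ := by
    rw [intervalIntegrable_iff_integrableOn_Ioo_of_le (h0.trans_le h12).le]
    exact integrableOn_sphInt_Ioo (hu.isRegular.ballInt_gradient_sq r₂ h2)
  have hEi : IntervalIntegrable E volume r₁ r₂ := by
    refine (hu.continuousOn_sphInt_deriv.mono ?_).intervalIntegrable
    rw [uIcc_of_le h12]; exact Icc_subset_Ioo h0 h2
  have hsub : uIcc r₁ r₂ ⊆ uIcc 0 r₂ := by
    rw [uIcc_of_le h12, uIcc_of_le (h0.trans_le h12).le]; exact Icc_subset_Icc_left h0.le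
  have acD : AbsolutelyContinuousOnInterval D r₁ r₂ :=
    (hAi.absolutelyContinuousOnInterval_intervalIntegral (by simp)).mono hsub
  have acH : AbsolutelyContinuousOnInterval H r₁ r₂ :=
    (contDiffOn_const (c := h r₁)).absolutelyContinuousOnInterval.add
      (hEi.absolutelyContinuousOnInterval_intervalIntegral (by simp))
  have acF := ((absolutelyContinuous_rpow h0 h12 (-2 * γ - ((n : ℝ) + a) + 1)).mul acD).sub
    (((absolutelyContinuous_rpow h0 h12 (-2 * γ)).mul acH).const_mul γ)
  have key := le_of_ae_hasDerivAt_nonneg h12 acF ?_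
  · simp only [Pi.sub_apply, Pi.mul_apply] at key
    rwa [hHh r₁ ⟨le_rfl, h12⟩, hHh r₂ ⟨h12, le_rfl⟩, ← hDd r₁ ⟨le_rfl, h12⟩,
      ← hDd r₂ ⟨h12, le_rfl⟩] at key
  filter_upwards [hAi.ae_hasDerivAt_integral, hEi.ae_hasDerivAt_integral,
    hu.ae_sphInt_mul_rad ha hR, hu.ae_sphInt_rad_sq ha hR,
    hu.isRegular.ballInt_rad_sq.ae_integrable,
    (hu.isRegular.ballInt_mul_rad ha hu.isRegular).ae_integrable] with r k1 k2 k3 k4 k5 k6 hr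
  have hr0 : 0 < r := h0.trans_le hr.1
  have hrR : r ∈ Ioo 0 R := ⟨hr0, hr.2.trans_lt h2⟩
  have hru : r ∈ uIcc r₁ r₂ := by rw [uIcc_of_le h12]; exact hr
  have d1 : HasDerivAt D (A r) r := k1 (hsub hru) 0 (by simp)
  have d2 : HasDerivAt H (E r) r := (k2 hru r₁ (by simp)).const_add _
  have p1 := Real.hasDerivAt_rpow_const (x := r) (p := -2 * γ - ((n : ℝ) + a) + 1)
    (Or.inl hr0.ne')
  have p2 := Real.hasDerivAt_rpow_const (x := r) (p := -2 * γ) (Or.inl hr0.ne')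
  refine ⟨_, ?_, (p1.mul d1).sub ((p2.mul d2).const_mul γ)⟩
  rw [hHh r hr, ← hDd r hr]
  have m3 := k3 hrR
  have m4 := k4 hrR
  have hC := k5 hrR
  have hB := k6 hrR
  have hh' := hu.isRegular.sq.integrable_sphere ha hrR (g := fun _ => 1) measurable_const (C := 1)
    (fun ζ => by simp)
  simp only [mul_one] at hh'
  -- This is the integral of (Zu - γu)² over the sphere; the derivative of the Weiss energy turns
  -- out to be 2r^(-2γ-1) times it.
  have hsq : 0 ≤ sphInt a (fun p => rad u p ^ 2) r - 2 * γ * sphInt a (fun p => u p * rad u p) r +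
      γ ^ 2 * h r := by
    have e : sphInt a (fun p => rad u p ^ 2) r - 2 * γ * sphInt a (fun p => u p * rad u p) r +
      γ ^ 2 * h r = sphInt a (fun p => (rad u p - γ * u p) ^ 2) r := by
      simp only [hh, sphInt]
      have hCB : Integrable (fun ζ : Metric.sphere (0 : Space n) 1 =>
          rad u (r • (ζ : Space n)) ^ 2 -
            2 * γ * (u (r • (ζ : Space n)) * rad u (r • (ζ : Space n)))) (sph a) :=
        hC.sub (hB.const_mul _)
      rw [← integral_const_mul, ← integral_const_mul, ← integral_sub hC (hB.const_mul _),
        ← integral_add hCB (hh'.const_mul _)]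
      congr 1; ext ζ
      ring
    rw [e]
    exact sphInt_nonneg (fun p => sq_nonneg _) r
  set B := sphInt a (fun p => u p * rad u p) r
  set C := sphInt a (fun p => rad u p ^ 2) r
  set d := dirichlet a u r
  set x := r ^ (-2 * γ - ((n : ℝ) + a)) with hx
  set y := r ^ ((n : ℝ) + a) with hy
  have hx0 : 0 < x := Real.rpow_pos_of_pos hr0 _
  have hy0 : 0 < y := Real.rpow_pos_of_pos hr0 _
  have e1 : r ^ (-2 * γ - ((n : ℝ) + a) + 1) = x * r := by
    rw [hx, Real.rpow_add hr0, Real.rpow_one]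
  have e2 : r ^ (-2 * γ - ((n : ℝ) + a) + 1 - 1) = x := by rw [hx]; congr 1; ring
  have e3 : r ^ (-2 * γ) = x * y := by
    rw [hx, hy, ← Real.rpow_add hr0]; congr 1; ring
  have e4 : r ^ (-2 * γ - 1) = x * y * r⁻¹ := by
    rw [← e3, Real.rpow_sub hr0, Real.rpow_one, div_eq_mul_inv]
  have e5 : r ^ (-((n : ℝ) + a)) = y⁻¹ := by rw [hy, Real.rpow_neg hr0.le]
  have hAr : r * A r = ((n : ℝ) + a - 1) * d + 2 * (r⁻¹ * (y * C)) := m4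
  have hBr : d = r⁻¹ * (y * B) := by rw [m3, inv_mul_cancel_left₀ hr0.ne']
  simp only [hE]
  rw [e1, e2, e3, e4, e5]
  have e6 : (-2 * γ - ((n : ℝ) + a) + 1) * x * d + x * r * A r -
      γ * (-2 * γ * (x * y * r⁻¹) * h r + x * y * (2 * (y⁻¹ * d))) =
      2 * (x * y * r⁻¹) * (C - 2 * γ * B + γ ^ 2 * h r) := by
    have e7 : x * r * A r = x * (((n : ℝ) + a - 1) * d + 2 * (r⁻¹ * (y * C))) := by
      rw [mul_assoc, hAr]
    have e8 : x * y * (2 * (y⁻¹ * d)) = 2 * x * d := by field_simp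
    rw [e7, e8, hBr]; ring
  rw [e6]
  have : 0 < r⁻¹ := inv_pos.2 hr0
  positivity

lemma height_eq {r : ℝ} (hr : 0 < r) :
    height a u r = r ^ ((n : ℝ) + a) * sphInt a (fun p => u p ^ 2) r :=
  sphereIntegral_mul_weight hr _

lemma weiss_eq {κ r : ℝ} (hr : 0 < r) : weiss a κ u r =
    r ^ (-2 * κ - ((n : ℝ) + a) + 1) * dirichlet a u r -
      κ * (r ^ (-2 * κ) * sphInt a (fun p => u p ^ 2) r) := by
  rw [weiss, height_eq hr]
  have e1 : r ^ (-2 * κ - ((n : ℝ) + a) + 1) = (r ^ ((n : ℝ) + a - 1 + 2 * κ))⁻¹ := by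
    rw [← Real.rpow_neg hr.le]; congr 1; ring
  have e2 : r ^ (-2 * κ) = (r ^ ((n : ℝ) + a + 2 * κ))⁻¹ * r ^ ((n : ℝ) + a) := by
    rw [← Real.rpow_neg hr.le, ← Real.rpow_add hr]; congr 1; ring
  rw [e1, e2]; ring

lemma dirichlet_nonneg (r : ℝ) : 0 ≤ dirichlet a u r :=
  integral_nonneg fun p => mul_nonneg (by positivity) (weight_nonneg a p)

lemma frequency_nonneg {r : ℝ} (hr : 0 < r) : 0 ≤ frequency a u r := by
  rw [frequency, height_eq hr]
  have h1 := dirichlet_nonneg (a := a) (u := u) r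
  have h2 := sphInt_nonneg (a := a) (F := fun p => u p ^ 2) (fun p => sq_nonneg _) r
  positivity

/-- Factoring out the height exhibits the sign of the Weiss energy as that of N - κ, for any value
of κ. -/
lemma weiss_eq_frequency {κ r : ℝ} (hr : 0 < r) (hh : 0 < sphInt a (fun p => u p ^ 2) r) :
    r ^ (-2 * κ - ((n : ℝ) + a) + 1) * dirichlet a u r -
      κ * (r ^ (-2 * κ) * sphInt a (fun p => u p ^ 2) r) =
    r ^ (-2 * κ) * sphInt a (fun p => u p ^ 2) r * (frequency a u r - κ) := by
  rw [frequency, height_eq hr]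
  have e1 : r ^ (-2 * κ - ((n : ℝ) + a) + 1) = r ^ (-2 * κ) * (r ^ ((n : ℝ) + a))⁻¹ * r := by
    rw [← Real.rpow_neg hr.le, Real.rpow_add hr, Real.rpow_one, ← Real.rpow_add hr]; rfl
  have h1 : 0 < r ^ ((n : ℝ) + a) := by positivity
  rw [e1]; field_simp

/-- Monotonicity of the frequency, and its consequence for the Weiss energy. -/
lemma exists_frequency_limit (hu : IsSolution a R u) (ha : -1 < a) (hR : 0 < R) :
    ∃ κ : ℝ, Tendsto (frequency a u) (𝓝[>] 0) (𝓝 κ) ∧ ∀ r ∈ Ioo 0 R, 0 ≤ weiss a κ u r := by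
  have hnn : ∀ r, 0 ≤ sphInt a (fun p => u p ^ 2) r := sphInt_nonneg fun p => sq_nonneg _
  by_cases hpos : ∀ r ∈ Ioo 0 R, 0 < sphInt a (fun p => u p ^ 2) r
  · have hmono : MonotoneOn (frequency a u) (Ioo 0 R) := by
      intro r₁ h1 r₂ h2 h12
      -- For γ = N(r₁) the Weiss energy vanishes at r₁, so it is nonnegative at r₂, which means
      -- N(r₂) ≥ N(r₁).
      have h3 := hu.weiss_mono ha hR (frequency a u r₁) h1.1 h12 h2.2
      rw [weiss_eq_frequency h1.1 (hpos r₁ h1), weiss_eq_frequency h2.1 (hpos r₂ h2), sub_self,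
        mul_zero] at h3
      have h4 : 0 < r₂ ^ (-2 * frequency a u r₁) * sphInt a (fun p => u p ^ 2) r₂ :=
        mul_pos (Real.rpow_pos_of_pos h2.1 _) (hpos r₂ h2)
      exact sub_nonneg.1 (nonneg_of_mul_nonneg_right h3 h4)
    have hbdd : BddBelow (frequency a u '' Ioo 0 R) :=
      ⟨0, by rintro _ ⟨r, hr, rfl⟩; exact frequency_nonneg hr.1⟩
    refine ⟨_, hmono.tendsto_nhdsWithin_Ioo_right (nonempty_Ioo.2 hR) hbdd, fun r hr => ?_⟩
    rw [weiss_eq hr.1, weiss_eq_frequency hr.1 (hpos r hr)]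
    exact mul_nonneg (mul_nonneg (Real.rpow_nonneg hr.1.le _) (hnn r))
      (sub_nonneg.2 (csInf_le hbdd ⟨r, hr, rfl⟩))
  -- If h vanishes at one radius it vanishes at all smaller ones, so N = 0 near 0, division by zero
  -- giving 0. Then κ = 0, and the Weiss energy is a nonnegative multiple of D.
  · push Not at hpos
    obtain ⟨r₀, hr₀, h0⟩ := hpos
    refine ⟨0, ?_, fun r hr => ?_⟩
    · refine tendsto_const_nhds.congr' ?_
      filter_upwards [Ioo_mem_nhdsGT hr₀.1] with r hr
      have h1 : sphInt a (fun p => u p ^ 2) r = 0 := le_antisymm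
        ((hu.monotoneOn_sphInt_sq ha hR ⟨hr.1, hr.2.trans hr₀.2⟩ hr₀ hr.2.le).trans h0) (hnn r)
      rw [frequency, height_eq hr.1, h1, mul_zero, div_zero]
    · rw [weiss_eq hr.1, zero_mul, sub_zero]
      exact mul_nonneg (Real.rpow_nonneg hr.1.le _) (dirichlet_nonneg r)

end IsSolution

end

/-! ### Even harmonic functions and the Neumann condition. -/

section

variable {n : ℕ} {a R : ℝ} {u : Space n → ℝ}

lemma contDiffAt_weight (a : ℝ) {p : Space n} (hp : yCoord p ≠ 0) {k : WithTop ℕ∞} :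
    ContDiffAt ℝ k (weight a : Space n → ℝ) p := by
  unfold weight
  rcases lt_or_gt_of_ne hp with h | h
  · have : (fun q : Space n => |yCoord q| ^ a) =ᶠ[𝓝 p] fun q => (-yCoord q) ^ a := by
      filter_upwards [(isOpen_lt continuous_yCoord continuous_const).mem_nhds h] with q hq
      rw [abs_of_neg hq]
    exact (contDiff_yCoord.neg.contDiffAt.rpow_const_of_ne (neg_ne_zero.2 hp)).congr_of_eventuallyEq
      this
  · have : (fun q : Space n => |yCoord q| ^ a) =ᶠ[𝓝 p] fun q => (yCoord q) ^ a := by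
      filter_upwards [(isOpen_lt continuous_const continuous_yCoord).mem_nhds h] with q hq
      rw [abs_of_pos hq]
    exact (contDiff_yCoord.contDiffAt.rpow_const_of_ne hp).congr_of_eventuallyEq this

lemma contDiff_partialDeriv {w : Space n → ℝ} (hw : ContDiff ℝ 2 w) (i : Fin (n + 1)) :
    ContDiff ℝ 1 (partialDeriv i w) :=
  (hw.fderiv_right (m := 1) (by norm_num)).clm_apply contDiff_const

lemma inner_gradient_eq_sum (v w : Space n → ℝ) (p : Space n) :
    inner ℝ (gradient v p) (gradient w p) = ∑ i, partialDeriv i v p * partialDeriv i w p := by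
  have h : ∀ (f : Space n → ℝ) i, gradient f p i = partialDeriv i f p := by
    intro f i
    have := inner_gradient_left (𝕜 := ℝ) (f := f) (x := p) (y := EuclideanSpace.single i (1 : ℝ))
    rw [partialDeriv, ← this, EuclideanSpace.inner_single_right]
    simp
  rw [PiLp.inner_apply]
  refine Finset.sum_congr rfl fun i _ => ?_
  rw [h, h]; simp [mul_comm]

lemma integrable_mul_of_tsupport_subset {O : Set (Space n)} (hO : IsOpen O) {f h : Space n → ℝ}
    (hf : ContinuousOn f O) (hh : Continuous h) (hc : HasCompactSupport h) (hs : tsupport h ⊆ O) :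
    Integrable fun p => f p * h p := by
  refine Continuous.integrable_of_hasCompactSupport ?_ hc.mul_left
  refine continuous_of_tsupport fun p hp => ?_
  exact (hf.continuousAt (hO.mem_nhds (hs (tsupport_mul_subset_right hp)))).mul hh.continuousAt

/-- Integration by parts away from `{y = 0}`. -/
lemma pairing_eq_zero_of_tsupport_off_thin {w φ : Space n → ℝ} (hw : ContDiff ℝ 2 w)
    (hL : ∀ p, yCoord p ≠ 0 → La a w p = 0) (hφ : ContDiff ℝ 1 φ) (hc : HasCompactSupport φ)
    (hs : tsupport φ ⊆ {p | yCoord p ≠ 0}) : pairing a w φ = 0 := by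
  set f : Fin (n + 1) → Space n → ℝ := fun i p => weight a p * partialDeriv i w p with hf
  have hfC : ∀ i, ∀ p, yCoord p ≠ 0 → ContDiffAt ℝ 1 (f i) p := fun i p hp =>
    (contDiffAt_weight a hp).mul (contDiff_partialDeriv hw i).contDiffAt
  have hf0 : ∀ i, ContinuousOn (f i) {p | yCoord p ≠ 0} := fun i p hp =>
    (hfC i p hp).continuousAt.continuousWithinAt
  have hf1 : ∀ i, ContinuousOn (partialDeriv i (f i)) {p | yCoord p ≠ 0} := fun i => by
    have : ContDiffOn ℝ 1 (f i) {p | yCoord p ≠ 0} := fun p hp => (hfC i p hp).contDiffWithinAt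
    exact (this.continuousOn_fderiv_of_isOpen isOpen_off_thin le_rfl).clm_apply continuousOn_const
  have hφc : ∀ i, Continuous (partialDeriv i φ) := fun i =>
    (hφ.continuous_fderiv one_ne_zero).clm_apply continuous_const
  have hφs : ∀ i, tsupport (partialDeriv i φ) ⊆ tsupport φ := fun i =>
    closure_minimal (fun p hp => by
      by_contra h
      refine hp ?_
      have := support_fderiv_subset ℝ (f := φ)
      have h2 : fderiv ℝ φ p = 0 := by
        by_contra h3; exact h (this h3)
      simp [partialDeriv, h2]) (isClosed_tsupport φ)
  have hφcs : ∀ i, HasCompactSupport (partialDeriv i φ) := fun i =>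
    hc.mono' ((subset_tsupport _).trans (hφs i))
  have hi1 : ∀ i, Integrable fun p => f i p * partialDeriv i φ p := fun i =>
    integrable_mul_of_tsupport_subset isOpen_off_thin (hf0 i) (hφc i) (hφcs i) ((hφs i).trans hs)
  have hi2 : ∀ i, Integrable fun p => partialDeriv i (f i) p * φ p := fun i =>
    integrable_mul_of_tsupport_subset isOpen_off_thin (hf1 i) hφ.continuous hc hs
  have hi3 : ∀ i, Integrable fun p => f i p * φ p := fun i =>
    integrable_mul_of_tsupport_subset isOpen_off_thin (hf0 i) hφ.continuous hc hs
  have hibp : ∀ i, ∫ p, f i p * partialDeriv i φ p = -∫ p, partialDeriv i (f i) p * φ p := fun i =>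
    integral_mul_fderiv_eq_neg_fderiv_mul_of_integrable (hi2 i) (hi1 i) (hi3 i)
      (fun p hp => (hfC i p (hs hp)).differentiableAt one_ne_zero)
      (fun p _ => hφ.differentiable one_ne_zero p)
  calc pairing a w φ = ∫ p, ∑ i, f i p * partialDeriv i φ p := by
        rw [pairing_eq]
        refine integral_congr_ae (Eventually.of_forall fun p => ?_)
        simp only [inner_gradient_eq_sum, hf, Finset.sum_mul]
        exact Finset.sum_congr rfl fun i _ => by ring
    _ = -∫ p, ∑ i, partialDeriv i (f i) p * φ p := by
        rw [integral_finsetSum _ fun i _ => hi1 i, integral_finsetSum _ fun i _ => hi2 i,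
          ← Finset.sum_neg_distrib]
        exact Finset.sum_congr rfl fun i _ => hibp i
    _ = 0 := by
        rw [neg_eq_zero]
        refine integral_eq_zero_of_ae (Eventually.of_forall fun p => ?_)
        simp only [Pi.zero_apply, ← Finset.sum_mul]
        by_cases hp : p ∈ tsupport φ
        · have := hL p (hs hp)
          rw [La] at this
          simp only [hf, this, zero_mul]
        · rw [image_eq_zero_of_notMem_tsupport hp, mul_zero]

/-- The derivative at 0 of an even function of y equals its own opposite. -/
lemma partialDeriv_last_eq_zero {w : Space n → ℝ} (hw : ContDiff ℝ 1 w)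
    (he : ∀ p, w (reflect p) = w p) {p : Space n} (hp : yCoord p = 0) :
    partialDeriv (Fin.last n) w p = 0 := by
  set e : Space n := EuclideanSpace.single (Fin.last n) 1 with hedef
  have hline : HasDerivAt (fun t : ℝ => w (p + t • e)) (partialDeriv (Fin.last n) w p) 0 := by
    exact (hw.differentiable one_ne_zero p).hasFDerivAt.hasLineDerivAt e
  have hev : ∀ t : ℝ, w (p + (-t) • e) = w (p + t • e) := by
    intro t
    rw [← he (p + t • e)]
    congr 1
    ext i
    by_cases hi : i = Fin.last n
    · subst hi
      have : p (Fin.last n) = 0 := hp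
      simp [reflect, hedef, this]
    · simp [reflect, hedef, hi]
  have h3 : HasDerivAt (fun t : ℝ => w (p + t • e)) (-partialDeriv (Fin.last n) w p) 0 := by
    have h4 : HasDerivAt (fun t : ℝ => w (p + t • e)) (partialDeriv (Fin.last n) w p) (-0) := by
      simpa using hline
    have h5 := h4.scomp (0 : ℝ) (hasDerivAt_neg (0 : ℝ))
    have e1 : (fun t : ℝ => w (p + t • e)) = (fun t : ℝ => w (p + t • e)) ∘ Neg.neg := by
      funext t; exact (hev t).symm
    rw [e1]; simpa using h5
  have := hline.unique h3
  linarith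

/-- D_y w is C¹ and vanishes on {y = 0}; the mean value inequality from the projection onto {y = 0}
gives the linear bound. The projection stays in the ball of radius 2ρ. -/
lemma exists_abs_partialDeriv_last_le {w : Space n → ℝ} (hw : ContDiff ℝ 2 w)
    (he : ∀ p, w (reflect p) = w p) (ρ : ℝ) : ∃ C, 0 ≤ C ∧ ∀ p ∈ Metric.closedBall (0 : Space n) ρ,
      |partialDeriv (Fin.last n) w p| ≤ C * |yCoord p| := by
  have hC1 := contDiff_partialDeriv hw (Fin.last n)
  obtain ⟨C, hC⟩ := (isCompact_closedBall (0 : Space n) (2 * ρ)).exists_bound_of_continuousOn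
    (hC1.continuous_fderiv one_ne_zero).continuousOn
  refine ⟨max C 0, le_max_right _ _, fun p hp => ?_⟩
  have hp0 : ‖p‖ ≤ ρ := by simpa using hp
  have hsp : ‖setY 0 p‖ ≤ 2 * ρ := by
    have h1 := norm_setY_sub 0 p
    have h2 := abs_yCoord_le p
    rw [zero_sub, abs_neg] at h1
    calc ‖setY 0 p‖ = ‖(setY 0 p - p) + p‖ := by rw [sub_add_cancel]
      _ ≤ ‖setY 0 p - p‖ + ‖p‖ := norm_add_le _ _
      _ ≤ _ := by linarith
  have := (convex_closedBall (0 : Space n) (2 * ρ)).norm_image_sub_le_of_norm_fderiv_le (𝕜 := ℝ)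
    (f := partialDeriv (Fin.last n) w) (C := C) (fun q _ => hC1.differentiable one_ne_zero q)
    hC (x := setY 0 p) (y := p) (by simpa using hsp) (by
      simp only [mem_closedBall_zero_iff]; linarith [norm_nonneg p])
  rw [partialDeriv_last_eq_zero (p := setY 0 p) (hw.of_le one_le_two) he (by simp), sub_zero,
    norm_sub_rev, norm_setY_sub, zero_sub, abs_neg, Real.norm_eq_abs] at this
  exact this.trans (mul_le_mul_of_nonneg_right (le_max_left _ _) (abs_nonneg _))

/-- The cutoff depends on y alone, so only D_y w enters, and for even w it is small near {y = 0}. -/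
lemma abs_inner_gradient_slabCut_le {C : ℝ} (hC : ∀ t, |deriv Real.smoothTransition t| ≤ C)
    {k : ℝ} (hk : 0 ≤ k) (δ : ℝ) (w : Space n → ℝ) (p : Space n) :
    |inner ℝ (gradient w p) (gradient (slabCut k δ : Space n → ℝ) p)| ≤
      |partialDeriv (Fin.last n) w p| * (C * (k * (2 * |yCoord p|))) := by
  have h1 : ∀ i, i ≠ Fin.last n → partialDeriv i (slabCut k δ : Space n → ℝ) p = 0 := by
    intro i hi
    have hd : DifferentiableAt ℝ (slabCut k δ : Space n → ℝ) p :=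
      (contDiff_slabCut (n := n) k δ).differentiable (by simp) p
    have hl : HasDerivAt (fun t : ℝ => slabCut k δ (p + t • EuclideanSpace.single i (1 : ℝ)))
        (partialDeriv i (slabCut k δ : Space n → ℝ) p) 0 := by
      have := hd.hasFDerivAt.hasLineDerivAt (EuclideanSpace.single i (1 : ℝ))
      exact this
    have hc : (fun t : ℝ => slabCut k δ (p + t • EuclideanSpace.single i (1 : ℝ))) =
        fun _ => slabCut k δ p := by
      funext t
      simp [slabCut, yCoord, hi.symm]
    rw [hc] at hl
    exact hl.unique (hasDerivAt_const _ _)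
  rw [inner_gradient_eq_sum, Finset.sum_eq_single (Fin.last n)
    (fun i _ hi => by rw [h1 i hi, mul_zero]) (by simp), abs_mul]
  refine mul_le_mul_of_nonneg_left ?_ (abs_nonneg _)
  refine le_trans ?_ (norm_gradient_slabCut_le hC hk δ p)
  rw [norm_gradient, partialDeriv]
  have := (fderiv ℝ (slabCut k δ : Space n → ℝ) p).le_opNorm (EuclideanSpace.single (Fin.last n) 1)
  simpa using this

/-- Even smooth `L_a`-harmonic functions solve the weighted Neumann problem on `{y = 0}`. -/
lemma pairing_eq_zero_of_even_harmonic (ha : -1 < a) {w φ : Space n → ℝ} (hw : ContDiff ℝ 2 w)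
    (hL : ∀ p, yCoord p ≠ 0 → La a w p = 0) (he : ∀ p, w (reflect p) = w p)
    (hφ : ContDiff ℝ 1 φ) (hc : HasCompactSupport φ) : pairing a w φ = 0 := by
  obtain ⟨C₁, hC₁0, hC₁⟩ := exists_deriv_smoothTransition_bound
  obtain ⟨ρ, hρ⟩ := hc.isCompact.isBounded.subset_closedBall (0 : Space n)
  obtain ⟨C, hC0, hC⟩ := exists_abs_partialDeriv_last_le hw he ρ
  obtain ⟨M, hM⟩ := (hc.isCompact).exists_bound_of_continuousOn (hφ.continuous.continuousOn)
  have hw1 : ContDiff ℝ 1 w := hw.of_le one_le_two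
  obtain ⟨M', hM'⟩ := (hc.isCompact).exists_bound_of_continuousOn
    (f := fun p => inner ℝ (gradient w p) (gradient φ p)) (by
      have h1 := continuousOn_gradient isOpen_univ hw1.contDiffOn
      have h2 := continuousOn_gradient isOpen_univ hφ.contDiffOn
      exact (h1.inner h2).mono (subset_univ _))
  set δ : ℕ → ℝ := fun j => 1 / ((j : ℝ) + 1) with hδ
  have hδ0 : ∀ j, 0 < δ j := fun j => by positivity
  have hδl : Tendsto δ atTop (𝓝 0) := tendsto_one_div_add_atTop_nhds_zero_nat
  -- Since k δ² = 1/3, the cutoff is constant except where k y² lies between 1/3 and 4/3. There its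
  -- gradient against ∇w is at most a constant times k y², hence bounded, and dominated convergence
  -- applies as δ tends to 0.
  set k : ℕ → ℝ := fun j => 1 / (3 * δ j ^ 2) with hk
  have hk0 : ∀ j, 0 < k j := fun j => by have := hδ0 j; positivity
  have hkδ : ∀ j, k j * δ j ^ 2 = 1 / 3 := fun j => by
    have := (hδ0 j).ne'; simp only [hk]; field_simp
  set F : ℕ → Space n → ℝ := fun j p => slabCut (k j) (δ j) p * φ p with hF
  have hFC : ∀ j, ContDiff ℝ 1 (F j) := fun j =>
    ((contDiff_slabCut (k j) (δ j)).of_le (by simp)).mul hφ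
  have hFs : ∀ j, tsupport (F j) ⊆ tsupport φ := fun j => tsupport_mul_subset_right
  have hFs2 : ∀ j, tsupport (F j) ⊆ {p | yCoord p ≠ 0} := by
    intro j
    have : tsupport (F j) ⊆ {p | δ j ≤ |yCoord p|} := by
      refine closure_minimal (fun p hp => ?_) (isClosed_le continuous_const continuous_yCoord.abs)
      by_contra h
      refine hp ?_
      simp only [hF]
      rw [slabCut_eq_zero (hk0 j).le ((not_le.1 h).le.trans (le_abs_self _)), zero_mul]
    exact this.trans fun p hp => abs_pos.1 ((hδ0 j).trans_le hp)
  have hz : ∀ j, pairing a w (F j) = 0 := fun j =>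
    pairing_eq_zero_of_tsupport_off_thin hw hL (hFC j)
      (hc.mono' ((subset_tsupport _).trans (hFs j))) (hFs2 j)
  have hds : ∀ j p, DifferentiableAt ℝ (slabCut (k j) (δ j) : Space n → ℝ) p := fun j p =>
    (contDiff_slabCut (n := n) _ _).differentiable (by simp) p
  have hsl : ∀ j p, |inner ℝ (gradient w p) (gradient (slabCut (k j) (δ j) : Space n → ℝ) p)| ≤
      |partialDeriv (Fin.last n) w p| * (C₁ * (k j * (2 * |yCoord p|))) := fun j p =>
    abs_inner_gradient_slabCut_le hC₁ (hk0 j).le (δ j) w p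
  have hone : ∀ j (p : Space n), 4 / 3 < k j * yCoord p ^ 2 →
      slabCut (k j) (δ j) =ᶠ[𝓝 p] fun _ => 1 := by
    intro j p hp
    have hop : IsOpen {q : Space n | 4 / 3 < k j * yCoord q ^ 2} :=
      isOpen_lt continuous_const (continuous_const.mul (continuous_yCoord.pow 2))
    filter_upwards [hop.mem_nhds hp] with q hq
    refine slabCut_eq_one ?_
    have h1 : 4 / 3 < k j * yCoord q ^ 2 := hq
    rw [mul_sub, hkδ]; linarith
  have hbound : ∀ j, ∀ p ∈ tsupport φ, |inner ℝ (gradient w p) (gradient (F j) p)| ≤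
      M' + M * (C * C₁ * (8 / 3)) := by
    intro j p hp
    have hM0 : 0 ≤ M := (norm_nonneg _).trans (hM p hp)
    rw [hF, gradient_mul (hds j p) (hφ.differentiable one_ne_zero p), inner_add_right,
      inner_smul_right, inner_smul_right]
    refine (abs_add_le _ _).trans (add_le_add ?_ ?_)
    · rw [abs_mul, abs_of_nonneg (slabCut_nonneg _ _ _)]
      exact (mul_le_of_le_one_left (abs_nonneg _) (slabCut_le_one _ _ _)).trans (hM' p hp)
    · rw [abs_mul]
      refine mul_le_mul (hM p hp) ?_ (abs_nonneg _) hM0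
      rcases le_or_gt (k j * yCoord p ^ 2) (4 / 3) with h | h
      · refine (hsl j p).trans ?_
        calc _ ≤ C * |yCoord p| * (C₁ * (k j * (2 * |yCoord p|))) :=
              mul_le_mul_of_nonneg_right (hC p (hρ hp)) (by have := hk0 j; positivity)
          _ = C * C₁ * 2 * (k j * |yCoord p| ^ 2) := by ring
          _ ≤ C * C₁ * 2 * (4 / 3) := by
              rw [sq_abs]; exact mul_le_mul_of_nonneg_left h (by positivity)
          _ = _ := by ring
      · rw [(hone j p h).gradient_eq, gradient_fun_const, inner_zero_right, abs_zero]
        positivity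
  have hlim : Tendsto (fun j => ∫ p, inner ℝ (gradient w p) (gradient (F j) p) ∂(wvol a)) atTop
      (𝓝 (∫ p, inner ℝ (gradient w p) (gradient φ p) ∂(wvol a))) := by
    refine tendsto_integral_of_dominated_convergence
      ((tsupport φ).indicator fun p => M' + M * (C * C₁ * (8 / 3))) ?_ ?_ ?_ ?_
    · exact fun k => ((measurable_gradient w).inner (measurable_gradient _)).aestronglyMeasurable
    · refine (integrable_indicator_iff (isClosed_tsupport φ).measurableSet).2 ?_
      exact integrableOn_const (wvol_lt_top_of_isCompact ha hc.isCompact).ne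
    · refine fun j => Eventually.of_forall fun p => ?_
      by_cases hp : p ∈ tsupport φ
      · rw [indicator_of_mem hp]; exact hbound j p hp
      · rw [indicator_of_notMem hp,
          gradient_eq_zero_of_notMem_tsupport fun h => hp (hFs j h)]
        simp
    · filter_upwards [ae_wvol_yCoord_ne_zero a] with p hp
      have hy : 0 < yCoord p ^ 2 := by positivity
      refine tendsto_const_nhds.congr' ?_
      have hδ2 : Tendsto (fun j => 4 * δ j ^ 2) atTop (𝓝 0) := by
        simpa using (hδl.pow 2).const_mul 4
      filter_upwards [hδ2.eventually_lt_const hy] with j hj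
      have h1 : 4 / 3 < k j * yCoord p ^ 2 := by
        have := mul_lt_mul_of_pos_left hj (hk0 j)
        have e := hkδ j
        nlinarith
      have : F j =ᶠ[𝓝 p] φ := by
        filter_upwards [hone j p h1] with q hq
        simp only [hF, hq, one_mul]
      rw [this.gradient_eq]
  refine tendsto_nhds_unique hlim (tendsto_const_nhds.congr fun j => (hz j).symm)

end

/-! ### Solid harmonics tested against solutions. -/

section

variable {n : ℕ} {a R : ℝ} {u : Space n → ℝ}

lemma contDiff_polyFun (P : MvPolynomial (Fin (n + 1)) ℝ) {k : WithTop ℕ∞} :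
    ContDiff ℝ k (polyFun P : Space n → ℝ) := by
  unfold polyFun
  induction P using MvPolynomial.induction_on with
  | C c => simpa using contDiff_const
  | add p q hp hq => simpa using hp.add hq
  | mul_X p i hp =>
    have : ContDiff ℝ k fun q : Space n => q i :=
      (EuclideanSpace.proj (𝕜 := ℝ) i).contDiff
    simpa using hp.mul this

namespace IsSolidHarmonicPlus

variable {κ : ℝ} {P : MvPolynomial (Fin (n + 1)) ℝ}

lemma isRegular (hP : IsSolidHarmonicPlus a κ P) (ha : -1 < a) (R : ℝ) :
    IsRegular a R (polyFun P) :=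
  IsRegular.of_contDiff ha (contDiff_polyFun P) hP.even

/-- Making the polynomial itself a solution gives access to the estimates proved for solutions, in
particular `abs_pairing_le`. -/
lemma isSolution (hP : IsSolidHarmonicPlus a κ P) (ha : -1 < a) (R : ℝ) :
    IsSolution a R (polyFun P) := by
  have h0 : ∀ φ : Space n → ℝ, ContDiff ℝ ∞ φ → HasCompactSupport φ →
      ∫ p, inner ℝ (gradient (polyFun P) p) (gradient φ p) * weight a p = 0 := fun φ h1 h2 => by
    rw [← pairing_eq]
    exact pairing_eq_zero_of_even_harmonic ha (contDiff_polyFun P) hP.harmonic hP.even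
      (h1.of_le (by simp)) h2
  exact
    { continuousOn := (contDiff_polyFun P (k := 0)).continuous.continuousOn
      contDiffOn := (contDiff_polyFun P).contDiffOn
      finite_energy := fun r hr => (integrableOn_wvol_iff a _ measurableSet_ball).1
        ((hP.isRegular ha R).energy r hr)
      harmonic := fun p _ hp => hP.harmonic p hp
      nonneg := fun p _ hp => hP.nonneg p hp
      even := fun p _ => hP.even p
      neumann_nonneg := fun φ h1 h2 _ _ => (h0 φ h1 h2).ge
      neumann_eq_zero := fun φ h1 h2 _ => h0 φ h1 h2 }

/-- Passage from C¹ test functions to those of class `IsTest`: the pairing is dominated by that of a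
smooth radial bump, which is zero. -/
lemma pairing_eq_zero (hP : IsSolidHarmonicPlus a κ P) (ha : -1 < a) (hR : 0 < R)
    {φ : Space n → ℝ} (hφ : IsTest a R φ) : pairing a (polyFun P) φ = 0 := by
  obtain ⟨ρ, hρ, hs⟩ := hφ.exists_closedBall hR
  obtain ⟨c, hc, hc0, -, hc1⟩ := exists_isProfile hR hρ.2
  obtain ⟨M, hM⟩ := hφ.hasCompactSupport.isCompact.exists_bound_of_continuousOn
    hφ.continuous.continuousOn
  have hb : pairing a (polyFun P) (fun p : Space n => c ‖p‖) = 0 :=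
    pairing_eq_zero_of_even_harmonic ha (contDiff_polyFun P) hP.harmonic hP.even
      (hc.contDiff_radial.of_le (by simp)) (hc.isCutoff.isTest ha).hasCompactSupport
  have := hφ.abs_pairing_le (hP.isSolution ha R) ha hR (hc.isCutoff.isTest ha) (c := max M 0)
    fun p _ => by
      by_cases hp : p ∈ tsupport φ
      · rw [hc1 _ (by simpa using hs hp), mul_one]
        exact (hM p hp).trans (le_max_left _ _)
      · rw [image_eq_zero_of_notMem_tsupport hp, abs_zero]
        exact mul_nonneg (le_max_right _ _) (hc0 _)
  rw [hb, mul_zero] at this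
  exact abs_nonpos_iff.1 this

lemma rad_polyFun (hP : IsSolidHarmonicPlus a κ P) (p : Space n) :
    rad (polyFun P) p = κ * polyFun P p := by
  rw [← hP.homogeneous p, rad, PiLp.inner_apply]
  refine Finset.sum_congr rfl fun i _ => ?_
  have := inner_gradient_left (𝕜 := ℝ) (f := polyFun P) (x := p)
    (y := EuclideanSpace.single i (1 : ℝ))
  rw [partialDeriv, ← this, EuclideanSpace.inner_single_right]
  simp

/-- Euler's relation says that t^(-κ) P(tp) has zero derivative in t. -/
lemma polyFun_smul (hP : IsSolidHarmonicPlus a κ P) {r : ℝ} (hr : 0 < r) (p : Space n) :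
    polyFun P (r • p) = r ^ κ * polyFun P p := by
  have hd : ∀ t : ℝ, 0 < t →
      HasDerivAt (fun t : ℝ => t ^ (-κ) * polyFun P (t • p)) 0 t := fun t ht => by
    have h1 : HasDerivAt (fun t : ℝ => polyFun P (t • p)) (t⁻¹ * (κ * polyFun P (t • p))) t := by
      have h2 : HasDerivAt (fun t : ℝ => polyFun P (t • p))
          (fderiv ℝ (polyFun P) (t • p) ((1 : ℝ) • p)) t := by
        have hid : HasDerivAt (fun t : ℝ => t • p) ((1 : ℝ) • p) t :=
          (hasDerivAt_id t).smul_const p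
        exact ((contDiff_polyFun (n := n) P (k := 1)).differentiable one_ne_zero
          (t • p)).hasFDerivAt.comp_hasDerivAt t hid
      have h3 := hP.rad_polyFun (t • p)
      rw [rad, inner_gradient_left, map_smul, smul_eq_mul] at h3
      rw [← h3, inv_mul_cancel_left₀ ht.ne']
      rwa [one_smul] at h2
    have h4 := (Real.hasDerivAt_rpow_const (x := t) (p := -κ) (Or.inl ht.ne')).mul h1
    refine h4.congr_deriv ?_
    rw [Real.rpow_sub_one ht.ne']
    field_simp; ring
  have h := isOpen_Ioi.is_const_of_deriv_eq_zero (isPreconnected_Ioi (a := (0 : ℝ)))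
    (fun t ht => (hd t ht).differentiableAt.differentiableWithinAt)
    (fun t ht => (hd t ht).deriv) (show r ∈ Ioi 0 from hr) (mem_Ioi.2 one_pos)
  simp only [Real.one_rpow, one_smul, one_mul] at h
  rw [← h, ← mul_assoc, ← Real.rpow_add hr]
  simp

end IsSolidHarmonicPlus

/-- A function whose integrals against derivatives of nonnegative profiles are nonnegative has
nonpositive integrals over intervals. -/
lemma integral_nonpos_of_integral_deriv_profile (hR : 0 < R) {f : ℝ → ℝ} (hf : LocInt R f)
    (h : ∀ c, IsProfile R c → (∀ r, 0 ≤ c r) → 0 ≤ ∫ r in Ioi 0, deriv c r * f r)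
    {r₁ r₂ : ℝ} (h1 : 0 < r₁) (h12 : r₁ ≤ r₂) (h2 : r₂ < R) : ∫ r in r₁..r₂, f r ≤ 0 := by
  set k : ℕ → ℝ → ℝ := fun j r =>
    Real.smoothTransition (j * (r - r₁)) * Real.smoothTransition (j * (r₂ - r)) with hk
  have hk0 : ∀ j r, 0 ≤ k j r := fun j r =>
    mul_nonneg (Real.smoothTransition.nonneg _) (Real.smoothTransition.nonneg _)
  have hk1 : ∀ j r, k j r ≤ 1 := fun j r =>
    mul_le_one₀ (Real.smoothTransition.le_one _) (Real.smoothTransition.nonneg _)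
      (Real.smoothTransition.le_one _)
  have hkC : ∀ j, ContDiff ℝ ∞ (k j) := fun j =>
    (Real.smoothTransition.contDiff.comp (contDiff_const.mul (contDiff_id.sub contDiff_const))).mul
      (Real.smoothTransition.contDiff.comp (contDiff_const.mul (contDiff_const.sub contDiff_id)))
  have hkz : ∀ j r, r ∉ Ioo r₁ r₂ → k j r = 0 := fun j r hr => by
    rw [mem_Ioo, not_and_or, not_lt, not_lt] at hr
    have hj : (0 : ℝ) ≤ j := Nat.cast_nonneg j
    rcases hr with hr | hr
    · simp only [hk]
      rw [Real.smoothTransition.zero_of_nonpos (by nlinarith), zero_mul]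
    · simp only [hk]
      rw [Real.smoothTransition.zero_of_nonpos (x := j * (r₂ - r)) (by nlinarith), mul_zero]
  have hks : ∀ j, tsupport (k j) ⊆ Icc r₁ r₂ := fun j =>
    closure_minimal (fun r hr => by
      by_contra h'
      exact hr (hkz j r fun h'' => h' (Ioo_subset_Icc_self h''))) isClosed_Icc
  have hfi : IntegrableOn f (Ioo r₁ r₂) := hf r₁ r₂ h1 h2
  have hj : ∀ j, ∫ r in Ioo r₁ r₂, k j r * f r ≤ 0 := fun j => by
    have hkc : HasCompactSupport (k j) :=
      isCompact_Icc.of_isClosed_subset (isClosed_tsupport _) (hks j)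
    -- A profile with derivative -k is nonincreasing and vanishes near R, hence is nonnegative and
    -- admissible. The functions k increase to the indicator of the interval, so they pick out the
    -- sign of the integral.
    obtain ⟨c, hc, hck⟩ := exists_isProfile_deriv_eq hR (k := fun r => -k j r) (hkC j).neg
      hkc.neg (by
        have : tsupport (fun r => -k j r) = tsupport (k j) := tsupport_neg (k j)
        rw [this]
        exact (hks j).trans (Icc_subset_Ioo h1 h2))
    have hanti : Antitone c := by
      refine antitone_of_deriv_nonpos (hc.contDiff.differentiable (by simp)) fun r => ?_
      rw [hck]; exact neg_nonpos.2 (hk0 j r)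
    obtain ⟨ρ, hρ, h0⟩ := hc.exists_support hR
    have := h c hc fun r => by
      rw [← (h0 (max r ρ) (le_max_right _ _)).1]
      exact hanti (le_max_left _ _)
    rw [hck, setIntegral_eq_of_subset_of_forall_sdiff_eq_zero measurableSet_Ioi
      (s := Ioo r₁ r₂) (fun r hr => h1.trans hr.1) fun r hr => by simp only; rw [hkz j r hr.2]; simp] at this
    simp only [neg_mul, integral_neg] at this
    linarith
  rw [intervalIntegral.integral_of_le h12, integral_Ioc_eq_integral_Ioo]
  refine le_of_tendsto (tendsto_integral_of_dominated_convergence (fun r => ‖f r‖)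
    (F := fun j r => k j r * f r) (fun j => ?_) hfi.norm (fun j => ?_) ?_)
    (Eventually.of_forall hj)
  · exact (hkC j).continuous.aestronglyMeasurable.mul hfi.aestronglyMeasurable
  · refine Eventually.of_forall fun r => ?_
    rw [norm_mul, Real.norm_eq_abs, abs_of_nonneg (hk0 j r)]
    exact mul_le_of_le_one_left (norm_nonneg _) (hk1 j r)
  · refine (ae_restrict_iff' measurableSet_Ioo).2 (Eventually.of_forall fun r hr => ?_)
    refine tendsto_const_nhds.congr' ?_
    have e1 := tendsto_natCast_atTop_atTop (R := ℝ) |>.atTop_mul_const (sub_pos.2 hr.1)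
    have e2 := tendsto_natCast_atTop_atTop (R := ℝ) |>.atTop_mul_const (sub_pos.2 hr.2)
    filter_upwards [e1.eventually_ge_atTop 1, e2.eventually_ge_atTop 1] with j h3 h4
    simp only [hk]
    rw [Real.smoothTransition.one_of_one_le h3, Real.smoothTransition.one_of_one_le h4]
    ring

/-- The primitive of `f` is nonincreasing by the previous lemma, and its derivative is `f` almost
everywhere. -/
lemma ae_nonpos_of_integral_deriv_profile (hR : 0 < R) {f : ℝ → ℝ} (hf : LocInt R f)
    (h : ∀ c, IsProfile R c → (∀ r, 0 ≤ c r) → 0 ≤ ∫ r in Ioi 0, deriv c r * f r)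
    {r₁ r₂ : ℝ} (h1 : 0 < r₁) (h12 : r₁ ≤ r₂) (h2 : r₂ < R) :
    ∀ᵐ r, r ∈ Ioo r₁ r₂ → f r ≤ 0 := by
  have hanti : AntitoneOn (fun r => ∫ t in r₁..r, f t) (Ioo r₁ r₂) := by
    intro s hs t ht hst
    have i1 := hf.intervalIntegrable h1 hs.1.le (hs.2.trans h2)
    have i2 := hf.intervalIntegrable (h1.trans hs.1) hst (ht.2.trans h2)
    have := integral_nonpos_of_integral_deriv_profile hR hf h (h1.trans hs.1) hst (ht.2.trans h2)
    simp only
    rw [← intervalIntegral.integral_add_adjacent_intervals i1 i2]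
    linarith
  filter_upwards [(hf.intervalIntegrable h1 h12 h2).ae_hasDerivAt_integral] with r hr hr'
  have hd := hr (by rw [uIcc_of_le h12]; exact Ioo_subset_Icc_self hr') r₁ (by simp)
  rw [← hd.deriv, ← derivWithin_of_isOpen isOpen_Ioo hr']
  exact hanti.derivWithin_nonpos

namespace IsSolution

variable {κ : ℝ} {P : MvPolynomial (Fin (n + 1)) ℝ}

/-- Comparison of the weighted fluxes of `u` and of a solid harmonic through spheres. -/
lemma ae_sphInt_flux_le (hu : IsSolution a R u) (ha : -1 < a) (hR : 0 < R)
    (hP : IsSolidHarmonicPlus a κ P) {r₁ r₂ : ℝ} (h1 : 0 < r₁) (h12 : r₁ ≤ r₂) (h2 : r₂ < R) :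
    ∀ᵐ r, r ∈ Ioo r₁ r₂ → sphInt a (fun p => polyFun P p * rad u p) r ≤
      κ * sphInt a (fun p => u p * polyFun P p) r := by
  have hPr := hP.isRegular ha R
  have l1 := hu.isRegular.locInt_fluxDefect ha hPr
  have l2 := hPr.locInt_fluxDefect ha hu.isRegular
  have key := ae_nonpos_of_integral_deriv_profile hR (l1.sub l2) (fun c hc hc0 => ?_) h1 h12 h2
  · filter_upwards [key] with r hr hr'
    have h3 := hr hr'
    have hr0 : 0 < r := h1.trans hr'.1
    simp only [fluxDefect, hP.rad_polyFun, real_inner_comm] at h3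
    have e : sphInt a (fun p => u p * (κ * polyFun P p)) r =
        κ * sphInt a (fun p => u p * polyFun P p) r := by
      rw [← sphInt_const_mul]; congr 1; ext p; ring
    rw [e] at h3
    have h4 : r⁻¹ * r ^ ((n : ℝ) + a) * (sphInt a (fun p => polyFun P p * rad u p) r -
        κ * sphInt a (fun p => u p * polyFun P p) r) ≤ 0 := by linarith
    have h5 : 0 < r⁻¹ * r ^ ((n : ℝ) + a) := mul_pos (inv_pos.2 hr0) (Real.rpow_pos_of_pos hr0 _)
    by_contra! h6
    exact absurd h4 (not_le.2 (mul_pos h5 (sub_pos.2 h6)))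
  -- Tested against c', the difference of the flux defects is the form of u against cP, nonnegative
  -- since P ≥ 0 on {y = 0}, minus the form of P against cu, which is zero.
  · simp only [mul_sub]
    rw [integral_sub (hc.integrable_deriv_mul hR l1).integrableOn
      (hc.integrable_deriv_mul hR l2).integrableOn,
      ← hu.isRegular.pairing_profile_mul ha hR hPr hc,
      ← hPr.pairing_profile_mul ha hR hu.isRegular hc,
      hP.pairing_eq_zero ha hR (hc.isCutoff.isTest_mul ha hR hu.isRegular), sub_zero]
    exact hu.pairing_nonneg ha hR (hc.isCutoff.isTest_mul ha hR hPr) fun p hp =>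
      mul_nonneg (hc0 _) (hP.nonneg p hp)

/-- As ZP = κP, the derivative is r^(-2κ-1) times the integral of P Zu - κ u P over the unit sphere
dilated by r, and the comparison of fluxes makes this nonpositive for almost every r. -/
lemma antitoneOn_sphInt_mul_polyFun (hu : IsSolution a R u) (ha : -1 < a) (hR : 0 < R)
    (hP : IsSolidHarmonicPlus a κ P) :
    AntitoneOn (fun r => r ^ (-2 * κ) * sphInt a (fun p => u p * polyFun P p) r) (Ioo 0 R) := by
  intro r₁ hr₁ r₂ hr₂ h12
  have h0 := hr₁.1
  have h2 := hr₂.2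
  have hPr := hP.isRegular ha R
  have hw := hu.isRegular.mul hPr
  set q : ℝ → ℝ := sphInt a (fun p => u p * polyFun P p) with hq
  set E : ℝ → ℝ := fun t => t⁻¹ * sphInt a (rad fun p => u p * polyFun P p) t with hE
  have hrad : ∀ᵐ r, r ∈ Ioo 0 R → sphInt a (rad fun p => u p * polyFun P p) r =
      sphInt a (fun p => polyFun P p * rad u p) r + κ * q r := by
    filter_upwards [(hu.isRegular.ballInt_mul_rad ha hPr).ae_integrable] with r k1 hr
    have k2 := hw.integrable_sphere ha hr (g := fun _ => 1) measurable_const (C := 1)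
      (fun ζ => by simp)
    simp only [mul_one] at k2
    simp only [hq, sphInt]
    rw [← integral_const_mul, ← integral_add (k1 hr) (k2.const_mul κ)]
    refine integral_congr_ae ?_
    filter_upwards [IsRegular.ae_sphere a hr] with ζ hζ
    rw [hu.isRegular.rad_mul hPr hζ.1 hζ.2, hP.rad_polyFun]; ring
  have hEl : LocInt R E := by
    have hloc : LocInt R fun r => r ^ (-((n : ℝ) + a) - 1) *
        (r ^ ((n : ℝ) + a) * sphInt a (fun p => polyFun P p * rad u p) r) :=
      (hu.isRegular.ballInt_mul_rad ha hPr).locInt.mul_continuousOn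
        (continuousOn_id.rpow_const fun t ht => Or.inl ht.1.ne')
    have hloc2 : LocInt R fun r => r ^ (-((n : ℝ) + a) - 1) *
        (r ^ ((n : ℝ) + a) * sphInt a (fun p => u p * rad (polyFun P) p) r) :=
      (hPr.ballInt_mul_rad ha hu.isRegular).locInt.mul_continuousOn
        (continuousOn_id.rpow_const fun t ht => Or.inl ht.1.ne')
    intro s t hs ht
    refine ((hloc.add hloc2) s t hs ht).congr ?_
    rw [EventuallyEq, ae_restrict_iff' measurableSet_Ioo]
    filter_upwards [hrad] with r hr hr'
    have hr0 : 0 < r := hs.trans hr'.1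
    have e : sphInt a (fun p => u p * rad (polyFun P) p) r = κ * q r := by
      simp only [hP.rad_polyFun, hq]
      rw [← sphInt_const_mul]; congr 1; ext p; ring
    have e2 : r ^ (-((n : ℝ) + a) - 1) * r ^ ((n : ℝ) + a) = r⁻¹ := by
      rw [← Real.rpow_add hr0, ← Real.rpow_neg_one]; congr 1; ring
    simp only [hE]
    rw [hr ⟨hr0, hr'.2.trans ht⟩, e, ← mul_assoc, ← mul_assoc, e2]; ring
  have hEi : IntervalIntegrable E volume r₁ r₂ := hEl.intervalIntegrable h0 h12 h2
  set Q : ℝ → ℝ := fun r => q r₁ + ∫ t in r₁..r, E t with hQ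
  have hQq : ∀ r ∈ Icc r₁ r₂, Q r = q r := fun r hr => by
    simp only [hQ]
    rw [← hw.sphInt_sub_eq_integral ha hR h0 hr.1 (hr.2.trans_lt h2)]; ring
  have acQ : AbsolutelyContinuousOnInterval Q r₁ r₂ :=
    (contDiffOn_const (c := q r₁)).absolutelyContinuousOnInterval.add
      (hEi.absolutelyContinuousOnInterval_intervalIntegral (by simp))
  have acF := (((absolutelyContinuous_rpow h0 h12 (-2 * κ)).mul acQ)).const_mul (-1)
  have key := le_of_ae_hasDerivAt_nonneg h12 acF ?_
  · simp only [Pi.mul_apply] at key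
    rw [hQq r₁ ⟨le_rfl, h12⟩, hQq r₂ ⟨h12, le_rfl⟩] at key
    simp only; linarith
  obtain ⟨s, hs, hs'⟩ := exists_between h0
  obtain ⟨t, ht, ht'⟩ := exists_between h2
  filter_upwards [hEi.ae_hasDerivAt_integral, hrad,
    hu.ae_sphInt_flux_le ha hR hP hs ((hs'.le.trans h12).trans ht.le) ht'] with r k1 k2 k3 hr
  have hr0 : 0 < r := h0.trans_le hr.1
  have d1 : HasDerivAt Q (E r) r :=
    (k1 (by rw [uIcc_of_le h12]; exact hr) r₁ (by simp)).const_add _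
  have p1 := Real.hasDerivAt_rpow_const (x := r) (p := -2 * κ) (Or.inl hr0.ne')
  refine ⟨_, ?_, (p1.mul d1).const_mul (-1)⟩
  have m3 := k3 ⟨hs'.trans_le hr.1, hr.2.trans_lt ht⟩
  simp only [hE]
  rw [hQq r hr, k2 ⟨hr0, hr.2.trans_lt h2⟩, Real.rpow_sub_one hr0.ne']
  have h5 : 0 < r ^ (-2 * κ) * r⁻¹ := mul_pos (Real.rpow_pos_of_pos hr0 _) (inv_pos.2 hr0)
  have := mul_nonneg h5.le (sub_nonneg.2 m3)
  rw [div_eq_mul_inv]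
  linarith

end IsSolution

end

/-! ### From almost every radius to every radius. -/

section

variable {n : ℕ} {a R : ℝ} {u : Space n → ℝ}

/-- The increment is at most the integral of |∇v||g| over the shell; Young's inequality separates
the energy from the thickness of the shell. Because n + a ≥ 0, the factor r^(n+a) is at least
s^(n+a) on the shell. -/
lemma IsRegular.abs_sphere_sub_le {v : Space n → ℝ} (ha : -1 < a) (hna : 0 ≤ (n : ℝ) + a)
    (hR : 0 < R) (hv : IsRegular a R v) {s r₁ r₂ : ℝ} (hs : 0 < s) (hs1 : s ≤ r₁) (h12 : r₁ ≤ r₂)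
    (h2 : r₂ < R) {g : Metric.sphere (0 : Space n) 1 → ℝ} (hg : Measurable g) {C : ℝ}
    (hC : ∀ ζ, |g ζ| ≤ C) {θ : ℝ} (hθ : 0 < θ) :
    |∫ ζ : Metric.sphere (0 : Space n) 1, v (r₂ • (ζ : Space n)) * g ζ ∂(sph a) -
      ∫ ζ : Metric.sphere (0 : Space n) 1, v (r₁ • (ζ : Space n)) * g ζ ∂(sph a)| ≤
    θ * (s ^ ((n : ℝ) + a))⁻¹ * ∫ p in Metric.ball (0 : Space n) r₂, ‖gradient v p‖ ^ 2 ∂(wvol a) +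
      C ^ 2 / (4 * θ) * (sph a : Measure (Metric.sphere (0 : Space n) 1)).real univ *
        (r₂ - r₁) := by
  have := isFiniteMeasure_sph (n := n) ha
  have h0 : 0 < r₁ := hs.trans_le hs1
  have hs0 : 0 < s ^ ((n : ℝ) + a) := Real.rpow_pos_of_pos hs _
  set A : ℝ → ℝ := fun r => r ^ ((n : ℝ) + a) * sphInt a (fun p => ‖gradient v p‖ ^ 2) r with hA
  set m : ℝ := C ^ 2 / (4 * θ) * (sph a : Measure (Metric.sphere (0 : Space n) 1)).real univ
    with hm
  have hAi : IntervalIntegrable A volume 0 r₂ := by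
    rw [intervalIntegrable_iff_integrableOn_Ioo_of_le (h0.trans_le h12).le]
    exact integrableOn_sphInt_Ioo (hv.energy r₂ h2)
  have hA0 : ∀ r, 0 ≤ r → 0 ≤ A r := fun r hr =>
    mul_nonneg (Real.rpow_nonneg hr _) (sphInt_nonneg (fun _ => by positivity) r)
  have i1 : IntervalIntegrable A volume 0 r₁ := hAi.mono_set (by
    rw [uIcc_of_le h0.le, uIcc_of_le (h0.trans_le h12).le]; exact Icc_subset_Icc_right h12)
  have i2 : IntervalIntegrable A volume r₁ r₂ := hAi.mono_set (by
    rw [uIcc_of_le h12, uIcc_of_le (h0.trans_le h12).le]; exact Icc_subset_Icc_left h0.le)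
  have hAb : ∫ r in r₁..r₂, A r ≤
      ∫ p in Metric.ball (0 : Space n) r₂, ‖gradient v p‖ ^ 2 ∂(wvol a) := by
    rw [setIntegral_ball_polar (h0.trans_le h12).le (hv.energy r₂ h2),
      ← intervalIntegral.integral_add_adjacent_intervals i1 i2]
    have := intervalIntegral.integral_nonneg (μ := volume) h0.le fun r hr => hA0 r hr.1
    linarith
  rw [hv.sphere_sub_eq_integral ha hR h0 h12 h2 hg hC, ← Real.norm_eq_abs]
  refine (intervalIntegral.norm_integral_le_of_norm_le h12
    (g := fun t => θ * (s ^ ((n : ℝ) + a))⁻¹ * A t + m) ?_ ?_).trans ?_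
  · filter_upwards [hv.ballInt_gradient_sq.ae_integrable] with t ht ht'
    have ht0 : 0 < t := h0.trans ht'.1
    have hi := ht ⟨ht0, ht'.2.trans_lt h2⟩
    refine (norm_integral_le_of_norm_le ((hi.const_mul θ).add
      (integrable_const (C ^ 2 / (4 * θ)))) (Eventually.of_forall fun ζ => ?_)).trans ?_
    · have h7 := abs_real_inner_le_norm (gradient v (t • (ζ : Space n))) (ζ : Space n)
      rw [norm_eq_of_mem_sphere ζ, mul_one] at h7
      have hC0 : 0 ≤ C := (abs_nonneg _).trans (hC ζ)
      rw [norm_mul, Real.norm_eq_abs, Real.norm_eq_abs]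
      set x := ‖gradient v (t • (ζ : Space n))‖ with hx
      have h8 : |inner ℝ (gradient v (t • (ζ : Space n))) (ζ : Space n)| * |g ζ| ≤ x * C :=
        mul_le_mul h7 (hC ζ) (abs_nonneg _) (norm_nonneg _)
      refine h8.trans ?_
      have h9 : θ * x ^ 2 + C ^ 2 / (4 * θ) - x * C = (2 * θ * x - C) ^ 2 / (4 * θ) := by
        field_simp; ring
      have h10 : 0 ≤ (2 * θ * x - C) ^ 2 / (4 * θ) := by positivity
      simp only [Pi.add_apply]
      linarith
    · rw [integral_add' (hi.const_mul θ) (integrable_const _), integral_const_mul, integral_const,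
        smul_eq_mul]
      have h3 : sphInt a (fun p => ‖gradient v p‖ ^ 2) t ≤ (s ^ ((n : ℝ) + a))⁻¹ * A t := by
        rw [hA, ← div_eq_inv_mul, le_div_iff₀ hs0, mul_comm]
        exact mul_le_mul_of_nonneg_right
          (Real.rpow_le_rpow hs.le (hs1.trans ht'.1.le) hna)
          (sphInt_nonneg (fun _ => by positivity) t)
      have h4 := mul_le_mul_of_nonneg_left h3 hθ.le
      simp only [sphInt] at h4
      rw [hm, mul_comm (C ^ 2 / (4 * θ))]
      linarith
  · exact (i2.const_mul _).add intervalIntegrable_const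
  · rw [intervalIntegral.integral_add (i2.const_mul _) intervalIntegrable_const,
      intervalIntegral.integral_const_mul, intervalIntegral.integral_const, smul_eq_mul,
      mul_comm (r₂ - r₁)]
    gcongr

/-- The increments under dilation of the spherical averages of a solution are equicontinuous in
the radius, with a modulus proportional to the increment. -/
lemma IsSolution.exists_dilation_equicontinuity (hu : IsSolution a R u) (ha : -1 < a)
    (hna : 0 ≤ (n : ℝ) + a) {r₀ : ℝ} (hr₀ : r₀ ∈ Ioo 0 R)
    {g : Metric.sphere (0 : Space n) 1 → ℝ} (hg : Measurable g) {C : ℝ} (hC : ∀ ζ, |g ζ| ≤ C)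
    {F : ℝ → ℝ}
    (hF : ∀ r, F r = ∫ ζ : Metric.sphere (0 : Space n) 1, u (r • (ζ : Space n)) * g ζ ∂(sph a))
    {η : ℝ} (hη : 0 < η) : ∃ δ > 0, ∃ ε > 0, ∀ l r, |l - 1| ≤ ε → |r - r₀| < δ →
      |(F (l * r) - F r) - (F (l * r₀) - F r₀)| ≤ η * |l - 1| := by
  obtain ⟨ρ, hρ, hρR⟩ := exists_between hr₀.2
  have hρ0 : 0 < ρ := hr₀.1.trans hρ
  obtain ⟨ε, hε0, hε, hερ⟩ : ∃ ε > 0, ε < 1 / 2 ∧ (1 + ε) * ρ < R := by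
    have h1 : 0 < R / ρ - 1 := by rw [sub_pos, one_lt_div hρ0]; exact hρR
    refine ⟨min (1 / 4) ((R / ρ - 1) / 2), lt_min (by norm_num) (by linarith),
      (min_le_left _ _).trans_lt (by norm_num), ?_⟩
    rw [← lt_div_iff₀ hρ0]
    have := min_le_right (1 / 4) ((R / ρ - 1) / 2)
    linarith
  obtain ⟨K, hK0, hK⟩ := hu.exists_lintegral_gradient_sub_le ha hρ0 hε0 hε hερ
  obtain ⟨R', hR'1, hR'2⟩ := exists_between ((lt_div_iff₀' (by linarith : 0 < 1 + ε)).2 hερ)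
  rw [lt_div_iff₀' (by linarith)] at hR'2
  have hR'0 : 0 < R' := hρ0.trans hR'1
  set s := r₀ / 2 with hs
  have hs0 : 0 < s := by have := hr₀.1; positivity
  set S := s ^ ((n : ℝ) + a) with hS
  have hS0 : 0 < S := Real.rpow_pos_of_pos hs0 _
  set σ := (sph a : Measure (Metric.sphere (0 : Space n) 1)).real univ with hσ
  have hσ0 : 0 ≤ σ := measureReal_nonneg
  -- Chosen so that the energy half of the estimate is at most η/2; the thickness half is then made
  -- small by the choice of δ.
  set θ := η / (2 * (S⁻¹ * K + 1)) with hθdef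
  have hθ : 0 < θ := by positivity
  set B := C ^ 2 / (4 * θ) * σ with hB
  have hB0 : 0 ≤ B := by positivity
  have hη1 : θ * S⁻¹ * K ≤ η / 2 := by
    have h1 : 0 < S⁻¹ * K + 1 := by positivity
    have : θ * (S⁻¹ * K + 1) = η / 2 := by rw [hθdef]; field_simp
    nlinarith
  have hδ0 : 0 < min (min s (ρ - r₀)) (η / (2 * (B + 1))) :=
    lt_min (lt_min hs0 (by linarith)) (by positivity)
  refine ⟨_, hδ0, ε, hε0, fun l r hl hr => ?_⟩
  rcases eq_or_ne l 1 with rfl | hl1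
  · simp
  have hl0 : 0 < |l - 1| := abs_pos.2 (sub_ne_zero.2 hl1)
  have hlb := abs_le.1 hl
  have hlpos : 0 < l := by linarith [hlb.1]
  have hv : IsRegular a R' fun p => u (l • p) - u p :=
    (hu.isRegular.comp_smul hlpos (by nlinarith [hlb.2])).sub (hu.isRegular.mono (by nlinarith))
  have hFv : ∀ t ∈ Ioo 0 R', F (l * t) - F t =
      ∫ ζ : Metric.sphere (0 : Space n) 1, (u (l • t • (ζ : Space n)) - u (t • (ζ : Space n))) *
        g ζ ∂(sph a) := fun t ht => by
    rw [hF, hF, ← integral_sub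
      (hu.isRegular.integrable_sphere ha ⟨mul_pos hlpos ht.1, by nlinarith [hlb.2, ht.2]⟩ hg hC)
      (hu.isRegular.integrable_sphere ha ⟨ht.1, by nlinarith [ht.2]⟩ hg hC)]
    congr 1; ext ζ
    rw [smul_smul]; ring
  have hK2 : ∀ t, t ≤ ρ → ∫ p in Metric.ball (0 : Space n) t,
      ‖gradient (fun q => u (l • q) - u q) p‖ ^ 2 ∂(wvol a) ≤ (l - 1) ^ 2 * K := fun t ht => by
    have hi := hv.energy ρ hR'1
    refine (setIntegral_mono_set hi (Eventually.of_forall fun p => by positivity)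
      (Metric.ball_subset_ball ht).eventuallyLE).trans ?_
    rw [integral_eq_lintegral_of_nonneg_ae (Eventually.of_forall fun p => by positivity)
      hi.aestronglyMeasurable]
    exact ENNReal.toReal_le_of_le_ofReal (by positivity) (hK l hl)
  have key : ∀ t₁ t₂, s ≤ t₁ → t₁ ≤ t₂ → t₂ ≤ ρ → t₂ - t₁ ≤ η / (2 * (B + 1)) →
      |(F (l * t₂) - F t₂) - (F (l * t₁) - F t₁)| ≤ η * |l - 1| := by
    intro t₁ t₂ h1 h12 h2 hd
    have ht1 : 0 < t₁ := hs0.trans_le h1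
    rw [hFv t₂ ⟨ht1.trans_le h12, h2.trans_lt hR'1⟩,
      hFv t₁ ⟨ht1, (h12.trans h2).trans_lt hR'1⟩]
    -- The energy of u(l·) - u is O((l - 1)²), so the parameter θ/|l - 1| gives both halves exactly
    -- one factor |l - 1|.
    refine (hv.abs_sphere_sub_le ha hna hR'0 hs0 h1 h12 (h2.trans_lt hR'1) hg hC
      (div_pos hθ hl0)).trans ?_
    have e1 : θ / |l - 1| * S⁻¹ * ((l - 1) ^ 2 * K) = |l - 1| * (θ * S⁻¹ * K) := by
      rw [← sq_abs (l - 1)]; field_simp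
    have e2 : C ^ 2 / (4 * (θ / |l - 1|)) * σ = |l - 1| * B := by
      rw [hB]; field_simp
    rw [e2]
    have e3 : B * (t₂ - t₁) ≤ η / 2 := by
      have h5 : B * (t₂ - t₁) ≤ (B + 1) * (η / (2 * (B + 1))) :=
        mul_le_mul (by linarith) hd (by linarith) (by linarith)
      refine h5.trans (le_of_eq ?_)
      have : B + 1 ≠ 0 := by positivity
      field_simp
    have e4 := mul_le_mul_of_nonneg_left (hK2 t₂ h2)
      (by positivity : 0 ≤ θ / |l - 1| * S⁻¹)
    rw [e1] at e4
    have e5 := mul_le_mul_of_nonneg_left hη1 hl0.le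
    have e6 := mul_le_mul_of_nonneg_left e3 hl0.le
    rw [← mul_assoc] at e6
    linarith
  have hr1 := hr.trans_le ((min_le_left _ _).trans (min_le_left _ _))
  have hr2 := hr.trans_le ((min_le_left _ _).trans (min_le_right _ _))
  have hr3 := hr.le.trans (min_le_right _ _)
  have hb1 := abs_lt.1 hr1
  have hb2 := abs_lt.1 hr2
  have hb3 := abs_le.1 hr3
  have hs2 : s + s = r₀ := by rw [hs]; ring
  rcases le_total r r₀ with h | h
  · rw [abs_sub_comm]
    exact key r r₀ (by linarith) h hρ.le (by linarith)
  · exact key r₀ r (by linarith) h (by linarith) (by linarith)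

/-- Differentiability on a dense set propagates to all points under equicontinuity of the
dilation quotients. -/
lemma differentiableAt_of_dilation_equicontinuity {F : ℝ → ℝ} {r₀ : ℝ} (hr₀ : 0 < r₀)
    (hF : ∀ η > 0, ∃ δ > 0, ∃ ε > 0, ∀ l r, |l - 1| ≤ ε → |r - r₀| < δ →
      |(F (l * r) - F r) - (F (l * r₀) - F r₀)| ≤ η * |l - 1|)
    (hd : ∀ δ > 0, ∃ r, |r - r₀| < δ ∧ DifferentiableAt ℝ F r) : DifferentiableAt ℝ F r₀ := by
  -- The slopes at r₀ are uniformly close to those at a nearby point of differentiability, which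
  -- converge. Hence the slopes at r₀ are Cauchy, although no limit is known in advance.
  have hQ : ∀ η > 0, ∃ m, ∀ᶠ l in 𝓝[≠] (1 : ℝ),
      |slope (fun l => F (l * r₀)) 1 l - m| ≤ η := by
    intro η hη
    obtain ⟨δ, hδ, ε, hε, h⟩ := hF (η / 2) (half_pos hη)
    obtain ⟨r, hr, hrd⟩ := hd δ hδ
    have h1 : HasDerivAt (fun l => F (l * r)) (deriv F r * r) 1 := by
      have h2 : HasDerivAt F (deriv F r) ((1 : ℝ) * r) := by rw [one_mul]; exact hrd.hasDerivAt
      have h3 : HasDerivAt (fun l : ℝ => l * r) r 1 := by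
        simpa using (hasDerivAt_id (1 : ℝ)).mul_const r
      exact h2.comp 1 h3
    refine ⟨deriv F r * r, ?_⟩
    have h4 := (hasDerivAt_iff_tendsto_slope.1 h1).eventually
      (Metric.closedBall_mem_nhds _ (half_pos hη))
    have h5 : ∀ᶠ l in 𝓝[≠] (1 : ℝ), |l - 1| ≤ ε :=
      mem_nhdsWithin_of_mem_nhds (Metric.closedBall_mem_nhds (1 : ℝ) hε)
    filter_upwards [h4, h5, self_mem_nhdsWithin] with l hl1 hl2 hl3
    have hl0 : 0 < |l - 1| := abs_pos.2 (sub_ne_zero.2 hl3)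
    have h6 : |slope (fun l => F (l * r)) 1 l - deriv F r * r| ≤ η / 2 := hl1
    have h7 : |slope (fun l => F (l * r)) 1 l - slope (fun l => F (l * r₀)) 1 l| ≤ η / 2 := by
      rw [slope_def_field, slope_def_field, ← sub_div, abs_div, div_le_iff₀ hl0, one_mul, one_mul]
      exact h l r hl2 hr
    have h8 := abs_le.1 h6
    have h9 := abs_le.1 h7
    exact abs_le.2 ⟨by linarith, by linarith⟩
  have hcauchy : Cauchy (map (slope (fun l => F (l * r₀)) 1) (𝓝[≠] (1 : ℝ))) := by
    rw [Metric.cauchy_iff]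
    refine ⟨inferInstance, fun η hη => ?_⟩
    obtain ⟨m, hm⟩ := hQ (η / 3) (by positivity)
    refine ⟨Metric.closedBall m (η / 3), hm, fun x hx y hy => ?_⟩
    have := dist_triangle_right x y m
    rw [Metric.mem_closedBall] at hx hy
    linarith
  obtain ⟨d, hd'⟩ := cauchy_map_iff_exists_tendsto.1 hcauchy
  have h1 := hasDerivAt_iff_tendsto_slope.2 hd'
  have h2 : HasDerivAt (fun l => F (l * r₀)) d (r₀ / r₀) := by rwa [div_self hr₀.ne']
  have h3 : HasDerivAt (fun r : ℝ => r / r₀) (1 / r₀) r₀ := (hasDerivAt_id r₀).div_const r₀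
  have h4 := (HasDerivAt.comp (h := fun r => r / r₀) r₀ h2 h3).differentiableAt
  refine h4.congr_of_eventuallyEq (Eventually.of_forall fun r => ?_)
  simp only [Function.comp_apply, div_mul_cancel₀ r hr₀.ne']

namespace IsSolution

variable {κ : ℝ} {P : MvPolynomial (Fin (n + 1)) ℝ}

/-- A monotone function is differentiable almost everywhere, hence on a dense set, and dilation
equicontinuity extends this to every radius. By homogeneity the factor P(rζ) is replaced by P(ζ),
since equicontinuity is available for weights that depend on the direction only. -/
lemma differentiableAt_sphInt_mul_polyFun (hu : IsSolution a R u) (ha : -1 < a)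
    (hna : 0 ≤ (n : ℝ) + a) (hR : 0 < R) (hP : IsSolidHarmonicPlus a κ P) {r₀ : ℝ}
    (hr₀ : r₀ ∈ Ioo 0 R) :
    DifferentiableAt ℝ (fun r => r ^ (-2 * κ) * sphInt a (fun p => u p * polyFun P p) r) r₀ := by
  set f : ℝ → ℝ := fun r => r ^ (-2 * κ) * sphInt a (fun p => u p * polyFun P p) r with hf
  set g : Metric.sphere (0 : Space n) 1 → ℝ := fun ζ => polyFun P (ζ : Space n) with hg
  set F : ℝ → ℝ := fun r =>
    ∫ ζ : Metric.sphere (0 : Space n) 1, u (r • (ζ : Space n)) * g ζ ∂(sph a) with hF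
  have hgc : Continuous g := (contDiff_polyFun P (k := 0)).continuous.comp continuous_subtype_val
  obtain ⟨C, hC⟩ := isCompact_univ.exists_bound_of_continuousOn hgc.continuousOn
  have hfF : ∀ r, 0 < r → f r = r ^ (-κ) * F r := fun r hr => by
    simp only [hf, hF, sphInt]
    rw [← integral_const_mul, ← integral_const_mul]
    congr 1; ext ζ
    rw [hP.polyFun_smul hr]
    have : r ^ (-2 * κ) * r ^ κ = r ^ (-κ) := by rw [← Real.rpow_add hr]; congr 1; ring
    rw [← this]; ring
  have hFf : ∀ r, 0 < r → F r = r ^ κ * f r := fun r hr => by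
    rw [hfF r hr, ← mul_assoc, ← Real.rpow_add hr]; simp
  have hrp : ∀ (e : ℝ) {r : ℝ}, 0 < r → DifferentiableAt ℝ (fun r : ℝ => r ^ e) r :=
    fun e r hr => (Real.hasDerivAt_rpow_const (Or.inl hr.ne')).differentiableAt
  have hdF : DifferentiableAt ℝ F r₀ := by
    refine differentiableAt_of_dilation_equicontinuity hr₀.1
      (fun η hη => hu.exists_dilation_equicontinuity ha hna hr₀ hgc.measurable
        (fun ζ => hC ζ (mem_univ _)) (fun r => rfl) hη) fun δ hδ => ?_
    have hae := (hu.antitoneOn_sphInt_mul_polyFun ha hR hP).neg.ae_differentiableWithinAt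
      measurableSet_Ioo
    rw [ae_restrict_iff' measurableSet_Ioo] at hae
    obtain ⟨r, ⟨hr1, hr2⟩, hr3⟩ := (Measure.dense_of_ae hae).inter_open_nonempty
      (Ioo 0 R ∩ Metric.ball r₀ δ) (isOpen_Ioo.inter Metric.isOpen_ball)
      ⟨r₀, hr₀, Metric.mem_ball_self hδ⟩
    refine ⟨r, hr2, ?_⟩
    have h1 := ((hr3 hr1).differentiableAt (isOpen_Ioo.mem_nhds hr1)).neg
    have h2 : DifferentiableAt ℝ f r := by simpa [hf, Function.comp_def] using h1
    refine ((hrp κ hr1.1).mul h2).congr_of_eventuallyEq ?_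
    filter_upwards [Ioi_mem_nhds hr1.1] with t ht using hFf t ht
  refine ((hrp (-κ) hr₀.1).mul hdF).congr_of_eventuallyEq ?_
  filter_upwards [Ioi_mem_nhds hr₀.1] with t ht using hfF t ht

end IsSolution

end

/-! ### The derivative of the Monneau functional. -/

section

variable {n : ℕ} {a R : ℝ} {u : Space n → ℝ}

namespace IsSolution

variable {κ : ℝ} {P : MvPolynomial (Fin (n + 1)) ℝ}

/-- Expansion of the square; with the normalisation r^(-2κ) the term in P² is independent of r by
homogeneity. -/
lemma monneau_eq (hu : IsSolution a R u) (ha : -1 < a) (hP : IsSolidHarmonicPlus a κ P) {r : ℝ}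
    (hr : r ∈ Ioo 0 R) : monneau a κ u P r = r ^ (-2 * κ) * sphInt a (fun p => u p ^ 2) r -
      2 * (r ^ (-2 * κ) * sphInt a (fun p => u p * polyFun P p) r) +
      sphInt a (fun p => polyFun P p ^ 2) 1 := by
  have hPr := hP.isRegular ha R
  have int : ∀ {w : Space n → ℝ}, IsRegular a R w → Integrable
      (fun ζ : Metric.sphere (0 : Space n) 1 => w (r • (ζ : Space n))) (sph a) := fun hw => by
    simpa only [mul_one] using hw.integrable_sphere ha hr (g := fun _ => 1) measurable_const
      (C := 1) (fun ζ => by simp)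
  have i1 := int hu.isRegular.sq
  have i2 := (int (hu.isRegular.mul hPr)).const_mul 2
  have i12 : Integrable (fun ζ : Metric.sphere (0 : Space n) 1 => u (r • (ζ : Space n)) ^ 2 -
      2 * (u (r • (ζ : Space n)) * polyFun P (r • (ζ : Space n)))) (sph a) := i1.sub i2
  have i3 := int hPr.sq
  have hsq : sphInt a (fun p => polyFun P p ^ 2) r =
      r ^ (2 * κ) * sphInt a (fun p => polyFun P p ^ 2) 1 := by
    simp only [sphInt]
    rw [← integral_const_mul]
    congr 1; ext ζ
    rw [hP.polyFun_smul hr.1, one_smul, mul_pow, ← Real.rpow_natCast, ← Real.rpow_mul hr.1.le]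
    congr 2; push_cast; ring
  have hexp : sphInt a (fun p => (u p - polyFun P p) ^ 2) r = sphInt a (fun p => u p ^ 2) r -
      2 * sphInt a (fun p => u p * polyFun P p) r + sphInt a (fun p => polyFun P p ^ 2) r := by
    simp only [sphInt]
    rw [← integral_const_mul, ← integral_sub i1 i2, ← integral_add i12 i3]
    congr 1; ext ζ
    ring
  rw [monneau, sphereIntegral_mul_weight hr.1 fun p => (u p - polyFun P p) ^ 2, hexp, hsq]
  have e1 : 1 / r ^ ((n : ℝ) + a + 2 * κ) * r ^ ((n : ℝ) + a) = r ^ (-2 * κ) := by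
    rw [one_div, ← Real.rpow_neg hr.1.le, ← Real.rpow_add hr.1]; congr 1; ring
  have e2 : r ^ (-2 * κ) * r ^ (2 * κ) = 1 := by
    rw [← Real.rpow_add hr.1]; simp
  rw [← mul_assoc, e1, mul_add, mul_sub, ← mul_assoc _ (r ^ (2 * κ)), e2]
  ring

/-- In the product rule, h' supplies the Dirichlet part of the Weiss energy and the derivative of
r^(-2κ) supplies the part in κ. -/
lemma hasDerivAt_rpow_mul_sphInt_sq (hu : IsSolution a R u) (ha : -1 < a) (hR : 0 < R) {r : ℝ}
    (hr : r ∈ Ioo 0 R) : HasDerivAt (fun r => r ^ (-2 * κ) * sphInt a (fun p => u p ^ 2) r)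
      (2 / r * weiss a κ u r) r := by
  have h := (Real.hasDerivAt_rpow_const (x := r) (p := -2 * κ) (Or.inl hr.1.ne')).mul
    (hu.hasDerivAt_sphInt_sq ha hR hr)
  refine h.congr_deriv ?_
  have e : r ^ (-2 * κ - ((n : ℝ) + a) + 1) = r ^ (-2 * κ) * r ^ (-((n : ℝ) + a)) * r := by
    rw [← Real.rpow_add hr.1, ← Real.rpow_add_one hr.1.ne']; congr 1
  rw [weiss_eq hr.1, e, Real.rpow_sub_one hr.1.ne']
  have := hr.1.ne'
  field_simp
  ring

/-- The derivative equals 2W/r - 2f', and f' ≤ 0; the inequality is exactly the loss of the flux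
term. -/
lemma monneau_deriv (hu : IsSolution a R u) (ha : -1 < a) (hna : 0 ≤ (n : ℝ) + a) (hR : 0 < R)
    (hP : IsSolidHarmonicPlus a κ P) {r : ℝ} (hr : r ∈ Ioo 0 R) :
    DifferentiableAt ℝ (monneau a κ u P) r ∧
      2 / r * weiss a κ u r ≤ deriv (monneau a κ u P) r := by
  set f : ℝ → ℝ := fun r => r ^ (-2 * κ) * sphInt a (fun p => u p * polyFun P p) r with hf
  have hfd : DifferentiableAt ℝ f r := hu.differentiableAt_sphInt_mul_polyFun ha hna hR hP hr
  have hf0 : deriv f r ≤ 0 := by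
    rw [← derivWithin_of_isOpen isOpen_Ioo hr]
    exact (hu.antitoneOn_sphInt_mul_polyFun ha hR hP).derivWithin_nonpos
  have hM : HasDerivAt (monneau a κ u P) (2 / r * weiss a κ u r - 2 * deriv f r) r := by
    refine (((hu.hasDerivAt_rpow_mul_sphInt_sq ha hR hr).sub
      (hfd.hasDerivAt.const_mul 2)).add_const
      (sphInt a (fun p => polyFun P p ^ 2) 1)).congr_of_eventuallyEq ?_
    filter_upwards [isOpen_Ioo.mem_nhds hr] with t ht using hu.monneau_eq ha hP ht
  refine ⟨hM.differentiableAt, ?_⟩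
  rw [hM.deriv]
  linarith

end IsSolution

end

end ThinObstacle

end

theorem mainTheorem3 (n : ℕ) (hn : 1 ≤ n) (a : ℝ) (ha : a ∈ Set.Ioo (-1 : ℝ) 1)
    (R : ℝ) (hR : 0 < R) (u : ThinObstacle.Space n → ℝ) (hu : ThinObstacle.IsSolution a R u) :
    ∃ κ : ℝ, Tendsto (ThinObstacle.frequency a u) (𝓝[>] 0) (𝓝 κ) ∧
      ∀ P : MvPolynomial (Fin (n + 1)) ℝ, ThinObstacle.IsSolidHarmonicPlus a κ P →
        (∀ r ∈ Set.Ioo 0 R,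
          DifferentiableAt ℝ (ThinObstacle.monneau a κ u P) r ∧
          2 / r * ThinObstacle.weiss a κ u r ≤ deriv (ThinObstacle.monneau a κ u P) r) ∧
        MonotoneOn (ThinObstacle.monneau a κ u P) (Set.Ioo 0 R) := by
  obtain ⟨κ, hκ, hW⟩ := hu.exists_frequency_limit ha.1 hR
  refine ⟨κ, hκ, fun P hP => ?_⟩
  -- The exponent of r in the polar density is nonnegative because n ≥ 1 and a > -1; the shell
  -- estimate behind differentiability needs this.
  have hna : 0 ≤ (n : ℝ) + a := by
    have : (1 : ℝ) ≤ n := by exact_mod_cast hn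
    linarith [ha.1]
  have h := fun r (hr : r ∈ Set.Ioo 0 R) => hu.monneau_deriv ha.1 hna hR hP hr
  refine ⟨h, monotoneOn_of_deriv_nonneg (convex_Ioo 0 R)
    (fun r hr => (h r hr).1.continuousAt.continuousWithinAt)
    (fun r hr => (h r (interior_subset hr)).1.differentiableWithinAt) fun r hr => ?_⟩
  have hr' := interior_subset hr
  exact (mul_nonneg (div_nonneg zero_le_two hr'.1.le) (hW r hr')).trans (h r hr').2
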